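/- **Conventions.** Graphs are finite multigraphs $G=(V,E)$ (loops and parallel edges allowed) with $n=|V|$, $m=|E|$, whose edges carry a fixed arbitrary orientation. For an integer $q\ge 2$ and $w>0$ let $Z_{\mathrm{Potts}}(G;q,w)=\sum_{\sigma:V\to\{1,\dots,q\}}w^{m(\sigma)}$, where $m(\sigma)$ is the number of edges whose two ends have the same value under $\sigma$ (so loops always count). A $\mathbb Z$-flow is a map $f:E\to\mathbb Z$ such that at every vertex the sum of $f$ over the incoming edges equals the sum over the outgoing edges. An even subgraph $C\subseteq E$ (all degrees even, loops counting twice) with an Eulerian orientation (in-degree equals out-degree at every vertex) has a signed indicator vector $\chi_C\in\{-1,0,1\}^E$, which is $0$ off $C$ and $\pm1$ on $C$ according to whether the Eulerian orientation agrees with the fixed one. An *even generating set* $\mathcal C$ of $G$ is a set of such vectors which generates the $\mathbb Z$-module of all $\mathbb Z$-flows of $G$; its elements are identified with the even subgraphs where this is convenient. Put $d(\mathcal C)=\max_{C\in\mathcal C}|\{D\in\mathcal C\setminus\{C\}: C\cap D\ne\emptyset\}|$, $\iota(\mathcal C)=\max_{C_1\neq C_2}|C_1\cap C_2|$, $\ell(\mathcal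 C)=\max_{C\in\mathcal C}|C|$, and $s(\mathcal C)=\max_{e\in E}|\{C\in\mathcal C:e\in C\}|$ (a maximum over the empty set is $0$). Algorithms are programs for a randomised unit-cost random access machine with integer memory (addition, subtraction, indirect addressing) and real memory (field operations, comparisons); choosing a uniformly random element of $\{0,\dots,t-1\}$, or flipping a coin with a computed bias, takes one unit of time. The input consists of $G$, of $\mathcal C$ (for each element, the list of its edges with their signs), of $w$ and of $\epsilon$. The running time is the worst case over all random choices. **Theorem.** Fix an integer $q\ge 2$ and a real number $K$. (i) Let $d\ge 2$ and $\iota\ge 1$ be integers and let $w>\frac{(d+1)\iota}{2}q-(q-1)$. There is a randomised algorithm that, for every $\epsilon\in(0,1)$ and every graph $G$ with $n$ vertices and $m$ edges, given with an even generating set $\mathcal C$ such that $|\mathcal C|\le Km$, $d(\mathcal C)\le d$ and $\iota(\mathcal C)\le\iota$, always halts and outputs a number $Z'$ such that, with probability at least $3/4$, $$1-\epsilon\le \frac{Z_{\mathrm{Potts}}(G;q,w)}{Z'}\le 1+\epsilon .$$ Its running time is $O\big(n^2m^2\epsilon^{-2}\log(nm\epsilon^{-1})\big)$. (ii) Let $\ell\ge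 3$ and $s\ge 2$ be integers and let $w>(q-1)(\ell s-1)$. There is a randomised algorithm that, for every $\epsilon\in(0,1)$ and every graph $G$ with $n$ vertices and $m$ edges, given with an even generating set $\mathcal C$ such that $|\mathcal C|\le Km$, $\ell(\mathcal C)\le \ell$ and $s(\mathcal C)\le s$, always halts and outputs a number $Z'$ with the same guarantee, in running time $O\big(n^2m\,\epsilon^{-2}\log(nm\epsilon^{-1})\big)$. The implied constants depend only on $q$, $K$, $w$ and on $d,\iota$ in (i), on $\ell,s$ in (ii). The bounds on the running time are asserted for all inputs with $nm\ge 2$ (for an edgeless graph, or a single vertex with one loop, the expressions may be $0$ or arbitrarily close to $0$). -/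

import Mathlib

open scoped ENNReal

/-! ## Multigraphs, the Potts partition function, flows and even generating sets -/

namespace PottsFlow

/-- A finite multigraph (loops and parallel edges allowed) with vertex set `Fin n` and edge set
`Fin m`; every edge carries a fixed, arbitrary orientation from `src e` to `tgt e`. -/
structure Multigraph (n m : ℕ) where
  src : Fin m → Fin n
  tgt : Fin m → Fin n

variable {n m r : ℕ}

namespace Multigraph

/-- `m(σ)`: the number of monochromatic edges of a `q`-spin configuration `σ`. -/
def mono (G : Multigraph n m) {q : ℕ} (σ : Fin n → Fin q) : ℕ :=
  (Finset.univ.filter fun e : Fin m => σ (G.src e) = σ (G.tgt e)).card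

/-- The partition function `Z_Potts(G; q, w) = ∑_σ w ^ m(σ)`. -/
def zPotts (G : Multigraph n m) (q : ℕ) (w : ℝ) : ℝ :=
  ∑ σ : Fin n → Fin q, w ^ G.mono σ

/-- The degree of the vertex `v` in the subgraph with edge set `S`; a loop counts twice. -/
def degreeIn (G : Multigraph n m) (S : Finset (Fin m)) (v : Fin n) : ℕ :=
  (S.filter fun e => G.src e = v).card + (S.filter fun e => G.tgt e = v).card

/-- `S` is (the edge set of) an even subgraph: every vertex has even degree in it. -/
def IsEvenSubgraph (G : Multigraph n m) (S : Finset (Fin m)) : Prop :=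
  ∀ v, Even (G.degreeIn S v)

/-- `f` is a `ℤ`-flow: at every vertex, the inflow equals the outflow. -/
def IsFlow (G : Multigraph n m) (f : Fin m → ℤ) : Prop :=
  ∀ v, ∑ e ∈ Finset.univ.filter (fun e => G.tgt e = v), f e =
    ∑ e ∈ Finset.univ.filter (fun e => G.src e = v), f e

/-- `χ` is the signed indicator vector of the even subgraph `S` with respect to some Eulerian
orientation of `S`: it is `0` off `S`, on `S` it is `1` or `-1` according to whether the Eulerian
orientation agrees with the fixed orientation of the edge, and the orientation being Eulerian
(in-degree equals out-degree at every vertex) says that `χ` is a flow. -/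
def IsSignedIndicator (G : Multigraph n m) (S : Finset (Fin m)) (χ : Fin m → ℤ) : Prop :=
  G.IsEvenSubgraph S ∧ (∀ e, e ∉ S → χ e = 0) ∧ (∀ e ∈ S, χ e = 1 ∨ χ e = -1) ∧ G.IsFlow χ

/-- The cycle space of `G`: the `ℤ`-module of all `ℤ`-flows. -/
def cycleSpace (G : Multigraph n m) : Submodule ℤ (Fin m → ℤ) where
  carrier := {f | G.IsFlow f}
  zero_mem' := by intro v; simp
  add_mem' := by
    intro f g hf hg v
    simp only [Pi.add_apply, Finset.sum_add_distrib]
    rw [hf v, hg v]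
  smul_mem' := by
    intro c f hf v
    simp only [Pi.smul_apply, smul_eq_mul, ← Finset.mul_sum]
    rw [hf v]

/-- The family `C 0, …, C (r - 1)` enumerates, without repetition, an even generating set of the
cycle space of `G`: a set of signed indicator vectors of even subgraphs which generates the
`ℤ`-module of `ℤ`-flows. Its size is `r`. -/
def IsEvenGeneratingSet (G : Multigraph n m) (C : Fin r → Fin m → ℤ) : Prop :=
  Function.Injective C ∧ (∀ k, ∃ S, G.IsSignedIndicator S (C k)) ∧
    Submodule.span ℤ (Set.range C) = G.cycleSpace

end Multigraph

/-- The edge set of the `k`-th even subgraph. -/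
def edges (C : Fin r → Fin m → ℤ) (k : Fin r) : Finset (Fin m) :=
  Finset.univ.filter fun e => C k e ≠ 0

/-- `d(𝒞)`: the maximum over `C ∈ 𝒞` of the number of `D ∈ 𝒞 \ {C}` with `C ∩ D ≠ ∅`. -/
def dParam (C : Fin r → Fin m → ℤ) : ℕ :=
  Finset.univ.sup fun k =>
    (Finset.univ.filter fun j => j ≠ k ∧ (edges C k ∩ edges C j).Nonempty).card

/-- `ι(𝒞)`: the maximum of `|C₁ ∩ C₂|` over distinct `C₁, C₂ ∈ 𝒞`. -/
def iotaParam (C : Fin r → Fin m → ℤ) : ℕ :=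
  (Finset.univ.filter fun p : Fin r × Fin r => p.1 ≠ p.2).sup fun p =>
    (edges C p.1 ∩ edges C p.2).card

/-- `ℓ(𝒞)`: the maximum of `|C|` over `C ∈ 𝒞`. -/
def ellParam (C : Fin r → Fin m → ℤ) : ℕ :=
  Finset.univ.sup fun k => (edges C k).card

/-- `s(𝒞)`: the maximum over the edges `e` of the number of `C ∈ 𝒞` that contain `e`. -/
def sParam (C : Fin r → Fin m → ℤ) : ℕ :=
  Finset.univ.sup fun e : Fin m => (Finset.univ.filter fun k => e ∈ edges C k).card

/-! ## A randomised unit-cost random access machine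

The memory consists of integer registers, integer arrays, real registers and real arrays (named by
numbers); the arrays are indexed by integers that the program computes. Integers (elements
of `ℕ`) can be added and subtracted; there is no integer multiplication. Reals can be added,
subtracted, multiplied, divided and compared; there is no rounding from reals to integers. The only
constants in a program are natural numbers. Programs are finite and fixed, independent of the
input, so every expression in a program stands for a bounded number of elementary operations. -/

/-- The memory of the machine. -/
structure State where
  reg : ℕ → ℕ
  arr : ℕ → ℕ → ℕ
  rreg : ℕ → ℝ
  rarr : ℕ → ℕ → ℝ

/-- Integer expressions: constants, registers, array cells, sums, truncated differences. -/
inductive NExpr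
  | lit (c : ℕ)
  | reg (i : ℕ)
  | arr (a : ℕ) (idx : NExpr)
  | add (x y : NExpr)
  | sub (x y : NExpr)

/-- The value of an integer expression. -/
def NExpr.eval (s : State) : NExpr → ℕ
  | .lit c => c
  | .reg i => s.reg i
  | .arr a idx => s.arr a (idx.eval s)
  | .add x y => x.eval s + y.eval s
  | .sub x y => x.eval s - y.eval s

/-- Real expressions: integers read as reals, registers, array cells, field operations. -/
inductive RExpr
  | nat (x : NExpr)
  | reg (i : ℕ)
  | arr (a : ℕ) (idx : NExpr)
  | add (x y : RExpr)
  | sub (x y : RExpr)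
  | mul (x y : RExpr)
  | div (x y : RExpr)

/-- The value of a real expression (a division by zero returns zero). -/
noncomputable def RExpr.eval (s : State) : RExpr → ℝ
  | .nat x => (x.eval s : ℝ)
  | .reg i => s.rreg i
  | .arr a idx => s.rarr a (idx.eval s)
  | .add x y => x.eval s + y.eval s
  | .sub x y => x.eval s - y.eval s
  | .mul x y => x.eval s * y.eval s
  | .div x y => x.eval s / y.eval s

/-- Tests: comparisons and their Boolean combinations. -/
inductive Test
  | nlt (x y : NExpr)
  | neq (x y : NExpr)
  | rlt (x y : RExpr)
  | not (b : Test)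
  | and (b c : Test)

/-- The truth value of a test; `neq x y` tests whether the integers `x` and `y` are equal. -/
def Test.holds (s : State) : Test → Prop
  | .nlt x y => x.eval s < y.eval s
  | .neq x y => x.eval s = y.eval s
  | .rlt x y => x.eval s < y.eval s
  | .not b => ¬ b.holds s
  | .and b c => b.holds s ∧ c.holds s

/-- Elementary instructions: assignments, writing to an array cell, and two random choices:
`unif i x` puts a uniformly random element of `{0, …, x - 1}` into the integer register `i`
(and `0` if `x = 0`), and `coin i p` puts `1` into it with probability `p` and `0` with
probability `1 - p` (where `p` is first clamped to `[0, 1]`). -/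
inductive Instr
  | set (i : ℕ) (x : NExpr)
  | write (a : ℕ) (idx x : NExpr)
  | rset (i : ℕ) (x : RExpr)
  | rwrite (a : ℕ) (idx : NExpr) (x : RExpr)
  | unif (i : ℕ) (x : NExpr)
  | coin (i : ℕ) (p : RExpr)

/-- Setting an integer register. -/
def State.setReg (s : State) (i v : ℕ) : State := { s with reg := Function.update s.reg i v }

/-- Setting a cell of an integer array. -/
def State.setArr (s : State) (a j v : ℕ) : State :=
  { s with arr := Function.update s.arr a (Function.update (s.arr a) j v) }

/-- Setting a real register. -/
noncomputable def State.setRReg (s : State) (i : ℕ) (v : ℝ) : State :=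
  { s with rreg := Function.update s.rreg i v }

/-- Setting a cell of a real array. -/
noncomputable def State.setRArr (s : State) (a j : ℕ) (v : ℝ) : State :=
  { s with rarr := Function.update s.rarr a (Function.update (s.rarr a) j v) }

/-- The uniform distribution on `{0, …, t - 1}`; the point mass at `0` if `t = 0`. -/
noncomputable def uniformBelow : ℕ → PMF ℕ
  | 0 => PMF.pure 0
  | t + 1 => (PMF.uniformOfFintype (Fin (t + 1))).map fun i => (i : ℕ)

/-- The distribution on `{0, 1}` that gives `1` the probability `p`, clamped to `[0, 1]`. -/
noncomputable def coinFlip (p : ℝ) : PMF ℕ :=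
  (PMF.ofFintype (fun b : Bool => cond b (min (ENNReal.ofReal p) 1) (1 - min (ENNReal.ofReal p) 1))
    (by simp [add_tsub_cancel_of_le])).map fun b => cond b 1 0

/-- The distribution of the memory after an elementary instruction. -/
noncomputable def Instr.exec (s : State) : Instr → PMF State
  | .set i x => PMF.pure (s.setReg i (x.eval s))
  | .write a idx x => PMF.pure (s.setArr a (idx.eval s) (x.eval s))
  | .rset i x => PMF.pure (s.setRReg i (x.eval s))
  | .rwrite a idx x => PMF.pure (s.setRArr a (idx.eval s) (x.eval s))
  | .unif i x => (uniformBelow (x.eval s)).map fun v => s.setReg i v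
  | .coin i p => (coinFlip (p.eval s)).map fun v => s.setReg i v

/-- Programs. -/
inductive Prog
  | skip
  | act (a : Instr)
  | seq (P Q : Prog)
  | ite (b : Test) (P Q : Prog)
  | loop (b : Test) (P : Prog)

/-- A configuration: the pieces of program that remain to be executed, in order, and the memory.
The machine has halted when nothing remains to be executed. -/
abbrev Config := List Prog × State

open Classical in
/-- One step of the machine, which takes one unit of time; `loop b P` executes `P` as long as the
test `b` holds. -/
noncomputable def step : Config → PMF Config
  | ([], s) => PMF.pure ([], s)
  | (.skip :: k, s) => PMF.pure (k, s)
  | (.act a :: k, s) => (a.exec s).map fun s' => (k, s')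
  | (.seq P Q :: k, s) => PMF.pure (P :: Q :: k, s)
  | (.ite b P Q :: k, s) => PMF.pure (if b.holds s then P :: k else Q :: k, s)
  | (.loop b P :: k, s) => PMF.pure (if b.holds s then P :: .loop b P :: k else k, s)

/-- The distribution of the configuration after `t` steps of the program `P` started with the
memory `s`. -/
noncomputable def run (P : Prog) (s : State) (t : ℕ) : PMF Config :=
  (fun μ : PMF Config => μ.bind step)^[t] (PMF.pure ([P], s))

/-- Whatever the outcomes of the random choices, `P` started with the memory `s` halts within `t`
steps. -/
def HaltsWithin (P : Prog) (s : State) (t : ℕ) : Prop :=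
  ∀ c ∈ (run P s t).support, c.1 = []

/-- The distribution of the output, the real register `0`, after `t` steps. -/
noncomputable def output (P : Prog) (s : State) (t : ℕ) : PMF ℝ :=
  (run P s t).map fun c => c.2.rreg 0

/-! ## The input -/

/-- The list of the pairs (edge of `C k`, sign of `C k` on that edge), by increasing edge. -/
def signedEdges (C : Fin r → Fin m → ℤ) (k : Fin r) : List (Fin m × ℤ) :=
  ((List.finRange m).filter fun e => C k e ≠ 0).map fun e => (e, C k e)

/-- The total length of the lists of the first `k` elements of the generating set. -/
def offset (C : Fin r → Fin m → ℤ) (k : ℕ) : ℕ :=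
  (((List.finRange r).take k).map fun j => (signedEdges C j).length).sum

/-- The concatenation of the lists of all elements of the generating set. -/
def allSignedEdges (C : Fin r → Fin m → ℤ) : List (Fin m × ℤ) :=
  (List.finRange r).flatMap fun k => signedEdges C k

/-- The initial memory, on the input `G`, `C`, `w`, `ε`. The integer registers `0, 1, 2` hold
`n`, `m`, `r`; the arrays `0, 1` hold the two ends of each edge; the edges of `C k` and the
signs on them (`1` for `+1` and `0` for `-1`) are in the cells of the arrays `3` and `4` whose
index is at least the entry `k` and less than the entry `k + 1` of the array `2`; the real registers
`0, 1` hold `ε` and `w`. Everything else is `0`. -/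
noncomputable def input (G : Multigraph n m) (C : Fin r → Fin m → ℤ) (w ε : ℝ) : State where
  reg := fun i => match i with
    | 0 => n
    | 1 => m
    | 2 => r
    | _ => 0
  arr := fun a i => match a with
    | 0 => if h : i < m then (G.src ⟨i, h⟩ : ℕ) else 0
    | 1 => if h : i < m then (G.tgt ⟨i, h⟩ : ℕ) else 0
    | 2 => if i ≤ r then offset C i else 0
    | 3 => if h : i < (allSignedEdges C).length then ((allSignedEdges C)[i].1 : ℕ) else 0
    | 4 => if h : i < (allSignedEdges C).length then (if (allSignedEdges C)[i].2 = 1 then 1 else 0)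
        else 0
    | _ => 0
  rreg := fun i => match i with
    | 0 => ε
    | 1 => w
    | _ => 0
  rarr := fun _ _ => 0

/-- On the input `G`, `C`, `w`, `ε` the program `P` always halts within `t` steps, and with
probability at least `3/4` its output `Z'` satisfies `1 - ε ≤ Z / Z' ≤ 1 + ε`, where
`Z = Z_Potts(G; q, w)`. -/
def ApproxCounts (P : Prog) (q : ℕ) (G : Multigraph n m) (C : Fin r → Fin m → ℤ) (w ε : ℝ)
    (t : ℕ) : Prop :=
  HaltsWithin P (input G C w ε) t ∧
    3 / 4 ≤ (output P (input G C w ε) t).toOuterMeasure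
      {z : ℝ | 1 - ε ≤ G.zPotts q w / z ∧ G.zPotts q w / z ≤ 1 + ε}

end PottsFlow

/-! Duality. Fourier analysis on `ZMod q` shows that the Potts partition function is, up to an
explicit factor, the sum over all flows modulo `q` of y to the number of edges on which the flow
vanishes, with y = 1 + q/(w - 1) (`pow_mul_flowSum`, `zPotts_eq_flowSum`). Giving an edge the weight
1 for every value of the flow amounts to contracting it, since on the side of the colourings its
factor becomes q times the indicator that its ends agree. When e is contracted in addition to F, the
ratio of the two flow sums is the expected weight of e, a number in [1, y], in a random flow for F ∪
{e} (`sum_flowWeight_ratio`). Once a spanning forest is contracted, all other edges are loops and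
the sum is explicit (`IsForest.flowSum_eq`). So Z is an explicit factor times at most n ratios, each
of which is estimated by averaging bounded samples.

Sampling. A flow modulo `q` lifts to an integral flow because the zeroth homology is torsion-free.
Hence the combinations of the generating set with coefficients in `ZMod q` give every flow, each
equally often (`exists_sum_flow`). The heat bath chain resamples one uniformly chosen coefficient at
a time, at a cost proportional to the size of one even subgraph. It is analysed by path coupling in
its dual form, as a contraction of Lipschitz constants for the Hamming metric. Changing the
coefficient k alters each weight used for resampling j by a factor of at most y^i, where i = |C_k ∩
C_j|, and hence the resampling law by at most (1 - y^(-i))/(1 + y^(-i)) in total variation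
(`weighted_average_sub_le`). If these influences on each k sum to less than 1, a transition
contracts by 1 - Ω(1/r) (`abs_chainOp_sub_le`). The two hypotheses on w ensure this
(`mul_influence_lt_one_of_dParam`, `mul_influence_lt_one_of_ellParam`). As r ≤ Km, O(m log(nm/ε))
transitions suffice.

Errors. Each ratio has relative bias O(ε/n), and averaging O(n/ε²) samples leaves a relative
variance O(ε²/n). First and second moments multiply along the run (`HasMoments.bind`), and
Chebyshev's inequality applies to the product. The time is n ratios, times O(n/ε²) samples, times
O(m log(nm/ε)) transitions, times O(ℓ) per transition, where ℓ is replaced by the trivial bound m in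
(i).

Machine. `Sim` says that a program halts in bounded time with a memory that is coupled to an
abstract random variable. It is compositional (`Sim.seq`, `Sim.loop`), so the probabilistic argument
only concerns abstract distributions (`sim_mainLoop`). -/

namespace PottsFlow

/-! ## Execution of programs: composition of distributions and of running times -/

/-- The distribution of the configuration after `t` steps from the configuration `c`. -/
noncomputable def runFrom (c : Config) (t : ℕ) : PMF Config :=
  (fun μ : PMF Config => μ.bind step)^[t] (PMF.pure c)

theorem _root_.PMF.bind_congr_support {α β : Type*} {μ : PMF α} {f g : α → PMF β}
    (h : ∀ a ∈ μ.support, f a = g a) : μ.bind f = μ.bind g := by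
  ext b
  simp only [PMF.bind_apply]
  refine tsum_congr fun a => ?_
  by_cases ha : μ a = 0
  · simp [ha]
  · rw [h a ((PMF.mem_support_iff _ _).2 ha)]

theorem iterate_bind_step (μ : PMF Config) (t : ℕ) :
    (fun μ : PMF Config => μ.bind step)^[t] μ = μ.bind fun c => runFrom c t := by
  induction t with
  | zero => simp [runFrom]
  | succ t ih =>
    rw [Function.iterate_succ_apply', ih, PMF.bind_bind]
    refine PMF.bind_congr_support fun a _ => ?_
    rw [runFrom, runFrom, Function.iterate_succ_apply']

theorem runFrom_succ (c : Config) (t : ℕ) :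
    runFrom c (t + 1) = (step c).bind fun c' => runFrom c' t := by
  rw [runFrom, Function.iterate_succ_apply, PMF.pure_bind, iterate_bind_step]

theorem runFrom_add (c : Config) (t u : ℕ) :
    runFrom c (t + u) = (runFrom c t).bind fun c' => runFrom c' u := by
  rw [runFrom, add_comm, Function.iterate_add_apply, iterate_bind_step]; rfl

theorem runFrom_nil (s : State) (t : ℕ) : runFrom ([], s) t = PMF.pure ([], s) := by
  induction t with
  | zero => rfl
  | succ t ih => rw [runFrom_succ]; simp [step, ih]

/-- From the configuration `c`, the machine halts within `T` steps, with a memory of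
distribution `ρ`. -/
def Finishes (c : Config) (T : ℕ) (ρ : PMF State) : Prop :=
  runFrom c T = ρ.map fun s => ([], s)

/-- A halted configuration is a fixed point of `step`, so surplus time is harmless. This lets
branches of different lengths share one time bound. -/
theorem Finishes.mono {c : Config} {T T' : ℕ} {ρ : PMF State} (h : Finishes c T ρ)
    (hT : T ≤ T') : Finishes c T' ρ := by
  obtain ⟨u, rfl⟩ := Nat.exists_eq_add_of_le hT
  unfold Finishes at *
  rw [runFrom_add, h, PMF.bind_map]
  simp only [Function.comp_def, runFrom_nil]
  rfl

theorem Finishes.unique {c : Config} {T : ℕ} {ρ ρ' : PMF State} (h : Finishes c T ρ)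
    (h' : Finishes c T ρ') : ρ = ρ' := by
  unfold Finishes at *
  have := congrArg (PMF.map Prod.snd) (h.symm.trans h')
  simp only [PMF.map_comp] at this
  exact (PMF.map_id ρ).symm.trans (this.trans (PMF.map_id ρ'))

/-- Executing `P` on the memory `s` takes at most `T` steps and results in a memory of
distribution `μ`, whatever remains to be executed afterwards. -/
def Computes (P : Prog) (s : State) (T : ℕ) (μ : PMF State) : Prop :=
  ∀ (k : List Prog) (N : ℕ) (ρ : State → PMF State),
    (∀ s' ∈ μ.support, Finishes (k, s') N (ρ s')) → Finishes (P :: k, s) (T + N) (μ.bind ρ)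

theorem Computes.finishes {P : Prog} {s : State} {T : ℕ} {μ : PMF State}
    (h : Computes P s T μ) : Finishes ([P], s) T μ := by
  have := h [] 0 PMF.pure fun s' _ => by simp [Finishes, runFrom, PMF.pure_map]
  simpa using this

theorem Computes.mono {P : Prog} {s : State} {T T' : ℕ} {μ : PMF State}
    (h : Computes P s T μ) (hT : T ≤ T') : Computes P s T' μ :=
  fun k N ρ hρ => (h k N ρ hρ).mono (by omega)

/-- The empty continuation exposes the final memory, whose law is determined by the program and the
initial memory. This makes independently chosen output laws agree in `computes_choice`. -/
theorem Computes.unique {P : Prog} {s : State} {T T' : ℕ} {μ μ' : PMF State}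
    (h : Computes P s T μ) (h' : Computes P s T' μ') : μ = μ' :=
  ((h.mono (le_max_left T T')).finishes).unique ((h'.mono (le_max_right T T')).finishes)

theorem Computes.of_step {P : Prog} {s s' : State} {l : List Prog} {T : ℕ} {μ : PMF State}
    (hs : ∀ k, step (P :: k, s) = PMF.pure (l ++ k, s'))
    (h : ∀ (k : List Prog) (N : ℕ) (ρ : State → PMF State),
      (∀ s' ∈ μ.support, Finishes (k, s') N (ρ s')) →
        Finishes (l ++ k, s') (T + N) (μ.bind ρ)) : Computes P s (T + 1) μ := by
  intro k N ρ hρ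
  have := h k N ρ hρ
  unfold Finishes at *
  rw [show T + 1 + N = T + N + 1 by omega, runFrom_succ, hs, PMF.pure_bind, this]

theorem Computes.skip (s : State) : Computes .skip s 1 (PMF.pure s) :=
  Computes.of_step (l := []) (T := 0) (fun k => rfl) fun k N ρ hρ => by
    simpa using hρ s (by simp)

theorem Computes.act (a : Instr) (s : State) : Computes (.act a) s 1 (a.exec s) := by
  intro k N ρ hρ
  unfold Finishes at *
  rw [add_comm, runFrom_succ, step, PMF.bind_map, PMF.map_bind]
  exact PMF.bind_congr_support fun s' hs' => hρ s' hs'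

/-- Because `Computes` quantifies over the continuation, the possibly random moment at which `P`
ends never has to be named: the rest of the execution is passed to `P` as its continuation. -/
theorem Computes.seq {P Q : Prog} {s : State} {T T' : ℕ} {μ : PMF State}
    {κ : State → PMF State} (h : Computes P s T μ)
    (h' : ∀ s' ∈ μ.support, Computes Q s' T' (κ s')) :
    Computes (.seq P Q) s (T + T' + 1) (μ.bind κ) := by
  refine Computes.of_step (l := [P, Q]) (fun k => rfl) fun k N ρ hρ => ?_
  rw [PMF.bind_bind, add_assoc]
  refine h _ _ _ fun s' hs' => h' s' hs' _ _ _ fun s'' hs'' => hρ _ ?_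
  rw [PMF.mem_support_bind_iff]
  exact ⟨s', hs', hs''⟩

theorem Computes.ite_pos {b : Test} {P Q : Prog} {s : State} {T : ℕ} {μ : PMF State}
    (hb : b.holds s) (h : Computes P s T μ) : Computes (.ite b P Q) s (T + 1) μ :=
  Computes.of_step (l := [P]) (s' := s) (fun k => by simp [step, hb]) h

theorem Computes.ite_neg {b : Test} {P Q : Prog} {s : State} {T : ℕ} {μ : PMF State}
    (hb : ¬ b.holds s) (h : Computes Q s T μ) : Computes (.ite b P Q) s (T + 1) μ :=
  Computes.of_step (l := [Q]) (s' := s) (fun k => by simp [step, hb]) h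

theorem Computes.loop_neg {b : Test} {P : Prog} {s : State} (hb : ¬ b.holds s) :
    Computes (.loop b P) s 1 (PMF.pure s) :=
  Computes.of_step (l := []) (s' := s) (T := 0) (fun k => by simp [step, hb]) fun k N ρ hρ => by
    simpa using hρ s (by simp)

theorem Computes.loop_pos {b : Test} {P : Prog} {s : State} {T T' : ℕ} {μ : PMF State}
    {κ : State → PMF State} (hb : b.holds s) (h : Computes P s T μ)
    (h' : ∀ s' ∈ μ.support, Computes (.loop b P) s' T' (κ s')) :
    Computes (.loop b P) s (T + T' + 1) (μ.bind κ) := by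
  refine Computes.of_step (l := [P, .loop b P]) (s' := s) (fun k => by simp [step, hb]) fun k N ρ hρ => ?_
  rw [PMF.bind_bind, add_assoc]
  refine h _ _ _ fun s' hs' => h' s' hs' _ _ _ fun s'' hs'' => hρ _ ?_
  rw [PMF.mem_support_bind_iff]
  exact ⟨s', hs', hs''⟩

/-! ## Simulation of an abstract random variable by a program -/

/-- The distributions `ν` and `μ` have a coupling that is supported on the relation `R`. -/
def Lifts {α β : Type*} (R : α → β → Prop) (ν : PMF α) (μ : PMF β) : Prop :=
  ∃ ω : PMF (α × β), ω.map Prod.fst = ν ∧ ω.map Prod.snd = μ ∧ ∀ p ∈ ω.support, R p.1 p.2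

theorem Lifts.pure {α β : Type*} {R : α → β → Prop} {a : α} {b : β} (h : R a b) :
    Lifts R (PMF.pure a) (PMF.pure b) :=
  ⟨PMF.pure (a, b), by simp [PMF.pure_map], by simp [PMF.pure_map], by simpa using h⟩

theorem Lifts.map {α β γ : Type*} {R : β → γ → Prop} (ν : PMF α) {f : α → β} {g : α → γ}
    (h : ∀ a, R (f a) (g a)) : Lifts R (ν.map f) (ν.map g) :=
  ⟨ν.map fun a => (f a, g a), by simp [PMF.map_comp, Function.comp_def],
    by simp [PMF.map_comp, Function.comp_def], by
      intro p hp
      rw [PMF.mem_support_map_iff] at hp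
      obtain ⟨a, _, rfl⟩ := hp
      exact h a⟩

/-- Couplings are glued: a pair is drawn from the first coupling, and then a coupling of the two
kernels at that pair is used. -/
theorem Lifts.bind {α β γ δ : Type*} {R : α → β → Prop} {R' : γ → δ → Prop} {ν : PMF α}
    {μ : PMF β} {ν' : α → PMF γ} {μ' : β → PMF δ} (h : Lifts R ν μ)
    (h' : ∀ a ∈ ν.support, ∀ b ∈ μ.support, R a b → Lifts R' (ν' a) (μ' b)) :
    Lifts R' (ν.bind ν') (μ.bind μ') := by
  classical
  obtain ⟨ω, rfl, rfl, hω⟩ := h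
  have hsupp : ∀ p ∈ ω.support, Lifts R' (ν' p.1) (μ' p.2) := fun p hp =>
    h' _ ((PMF.mem_support_map_iff _ _ _).2 ⟨p, hp, rfl⟩) _
      ((PMF.mem_support_map_iff _ _ _).2 ⟨p, hp, rfl⟩) (hω p hp)
  have : Nonempty (PMF (γ × δ)) := by
    obtain ⟨p, hp⟩ := ω.support_nonempty
    exact ⟨(hsupp p hp).choose⟩
  choose! θ h1 h2 h3 using hsupp
  refine ⟨ω.bind θ, ?_, ?_, ?_⟩
  · rw [PMF.map_bind, PMF.bind_map]
    exact PMF.bind_congr_support h1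
  · rw [PMF.map_bind, PMF.bind_map]
    exact PMF.bind_congr_support h2
  · intro p hp
    rw [PMF.mem_support_bind_iff] at hp
    obtain ⟨a, ha, hp⟩ := hp
    exact h3 a ha p hp

theorem Lifts.mono {α β : Type*} {R R' : α → β → Prop} {ν : PMF α} {μ : PMF β}
    (h : Lifts R ν μ) (hR : ∀ a ∈ ν.support, ∀ b, R a b → R' a b) : Lifts R' ν μ := by
  obtain ⟨ω, h1, h2, h3⟩ := h
  refine ⟨ω, h1, h2, fun p hp => hR _ ?_ _ (h3 p hp)⟩
  rw [← h1, PMF.mem_support_map_iff]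
  exact ⟨p, hp, rfl⟩

theorem Lifts.map_left {α β γ : Type*} {R : α → β → Prop} {R' : γ → β → Prop} {ν : PMF α}
    {μ : PMF β} (f : α → γ) (h : Lifts R ν μ) (hR : ∀ a b, R a b → R' (f a) b) :
    Lifts R' (ν.map f) μ := by
  obtain ⟨ω, rfl, h2, h3⟩ := h
  refine ⟨ω.map fun p => (f p.1, p.2), ?_, ?_, ?_⟩
  · simp [PMF.map_comp, Function.comp_def]
  · simpa [PMF.map_comp, Function.comp_def] using h2
  · intro p hp
    rw [PMF.mem_support_map_iff] at hp
    obtain ⟨a, ha, rfl⟩ := hp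
    exact hR _ _ (h3 a ha)

theorem Lifts.exists_left {α β : Type*} {R : α → β → Prop} {ν : PMF α} {μ : PMF β}
    (h : Lifts R ν μ) {b : β} (hb : b ∈ μ.support) : ∃ a ∈ ν.support, R a b := by
  obtain ⟨ω, rfl, rfl, h3⟩ := h
  rw [PMF.mem_support_map_iff] at hb
  obtain ⟨p, hp, rfl⟩ := hb
  exact ⟨p.1, (PMF.mem_support_map_iff _ _ _).2 ⟨p, hp, rfl⟩, h3 p hp⟩

theorem Lifts.toOuterMeasure_le {α β : Type*} {R : α → β → Prop} {ν : PMF α} {μ : PMF β}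
    (h : Lifts R ν μ) {A : Set α} {B : Set β} (hAB : ∀ a b, R a b → a ∈ A → b ∈ B) :
    ν.toOuterMeasure A ≤ μ.toOuterMeasure B := by
  obtain ⟨ω, rfl, rfl, h3⟩ := h
  rw [PMF.toOuterMeasure_map_apply, PMF.toOuterMeasure_map_apply]
  refine PMF.toOuterMeasure_mono _ ?_
  rintro p ⟨hp, hs⟩
  exact hAB _ _ (h3 p hs) hp

/-- On the memory `s`, the program `P` halts within `T` steps, and the resulting memory simulates,
with respect to the relation `R`, a random element of distribution `ν`. -/
def Sim {α : Type*} (P : Prog) (s : State) (T : ℕ) (ν : PMF α) (R : α → State → Prop) : Prop :=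
  ∃ μ, Computes P s T μ ∧ Lifts R ν μ

section Sim

variable {α β : Type*} {P Q : Prog} {s : State} {T T' : ℕ} {ν : PMF α} {R : α → State → Prop}

theorem Sim.mono (h : Sim P s T ν R) (hT : T ≤ T') : Sim P s T' ν R :=
  let ⟨μ, h1, h2⟩ := h
  ⟨μ, h1.mono hT, h2⟩

theorem Sim.weaken {R' : α → State → Prop} (h : Sim P s T ν R)
    (hR : ∀ a ∈ ν.support, ∀ s', R a s' → R' a s') : Sim P s T ν R' :=
  let ⟨μ, h1, h2⟩ := h
  ⟨μ, h1, h2.mono hR⟩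

theorem Sim.map {R' : β → State → Prop} (f : α → β) (h : Sim P s T ν R)
    (hR : ∀ a s', R a s' → R' (f a) s') : Sim P s T (ν.map f) R' :=
  let ⟨μ, h1, h2⟩ := h
  ⟨μ, h1, h2.map_left f hR⟩

/-- One memory may be coupled to several abstract values, each of which promises some output law of
`Q`. By `Computes.unique` these laws coincide, so one choice per memory serves them all. -/
theorem computes_choice {κ : α → PMF β} {R' : β → State → Prop} {μ : PMF State}
    (hL : Lifts R ν μ)
    (h' : ∀ a ∈ ν.support, ∀ s', R a s' → Sim Q s' T' (κ a) R') :
    ∃ μ' : State → PMF State, (∀ s' ∈ μ.support, Computes Q s' T' (μ' s')) ∧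
      Lifts R' (ν.bind κ) (μ.bind μ') := by
  have key : ∀ s' ∈ μ.support, ∃ μ', Computes Q s' T' μ' := by
    intro s' hs'
    obtain ⟨a, ha, hR⟩ := hL.exists_left hs'
    obtain ⟨μ', h1, _⟩ := h' a ha s' hR
    exact ⟨μ', h1⟩
  choose! μ' hμ' using key
  refine ⟨μ', hμ', hL.bind fun a ha s' hs' hR => ?_⟩
  obtain ⟨μ'', h1, h2⟩ := h' a ha s' hR
  rwa [(hμ' s' hs').unique h1]

theorem Sim.seq {κ : α → PMF β} {R' : β → State → Prop} (h : Sim P s T ν R)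
    (h' : ∀ a ∈ ν.support, ∀ s', R a s' → Sim Q s' T' (κ a) R') :
    Sim (.seq P Q) s (T + T' + 1) (ν.bind κ) R' := by
  obtain ⟨μ, hP, hL⟩ := h
  obtain ⟨μ', h1, h2⟩ := computes_choice hL h'
  exact ⟨_, hP.seq h1, h2⟩

theorem Sim.loop_pos {b : Test} {κ : α → PMF β} {R' : β → State → Prop} (hb : b.holds s)
    (h : Sim P s T ν R)
    (h' : ∀ a ∈ ν.support, ∀ s', R a s' → Sim (.loop b P) s' T' (κ a) R') :
    Sim (.loop b P) s (T + T' + 1) (ν.bind κ) R' := by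
  obtain ⟨μ, hP, hL⟩ := h
  obtain ⟨μ', h1, h2⟩ := computes_choice hL h'
  exact ⟨_, hP.loop_pos hb h1, h2⟩

theorem Sim.loop_neg {b : Test} {a : α} (hb : ¬ b.holds s) (h : R a s) :
    Sim (.loop b P) s 1 (PMF.pure a) R :=
  ⟨_, Computes.loop_neg hb, Lifts.pure h⟩

theorem Sim.ite_pos {b : Test} (hb : b.holds s) (h : Sim P s T ν R) :
    Sim (.ite b P Q) s (T + 1) ν R :=
  let ⟨μ, h1, h2⟩ := h
  ⟨μ, h1.ite_pos hb, h2⟩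

theorem Sim.ite_neg {b : Test} (hb : ¬ b.holds s) (h : Sim Q s T ν R) :
    Sim (.ite b P Q) s (T + 1) ν R :=
  let ⟨μ, h1, h2⟩ := h
  ⟨μ, h1.ite_neg hb, h2⟩

theorem Sim.ite {b : Test} (h : b.holds s → Sim P s T ν R) (h' : ¬ b.holds s → Sim Q s T ν R) :
    Sim (.ite b P Q) s (T + 1) ν R := by
  by_cases hb : b.holds s
  · exact .ite_pos hb (h hb)
  · exact .ite_neg hb (h' hb)

theorem Sim.skip {a : α} (h : R a s) : Sim .skip s 1 (PMF.pure a) R :=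
  ⟨_, Computes.skip s, Lifts.pure h⟩

theorem Sim.set {i : ℕ} {x : NExpr} {a : α} (h : R a (s.setReg i (x.eval s))) :
    Sim (.act (.set i x)) s 1 (PMF.pure a) R :=
  ⟨_, Computes.act _ s, Lifts.pure h⟩

theorem Sim.write {i : ℕ} {j x : NExpr} {a : α} (h : R a (s.setArr i (j.eval s) (x.eval s))) :
    Sim (.act (.write i j x)) s 1 (PMF.pure a) R :=
  ⟨_, Computes.act _ s, Lifts.pure h⟩

theorem Sim.rset {i : ℕ} {x : RExpr} {a : α} (h : R a (s.setRReg i (x.eval s))) :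
    Sim (.act (.rset i x)) s 1 (PMF.pure a) R :=
  ⟨_, Computes.act _ s, Lifts.pure h⟩

theorem Sim.rwrite {i : ℕ} {j : NExpr} {x : RExpr} {a : α}
    (h : R a (s.setRArr i (j.eval s) (x.eval s))) :
    Sim (.act (.rwrite i j x)) s 1 (PMF.pure a) R :=
  ⟨_, Computes.act _ s, Lifts.pure h⟩

theorem Sim.unif {i : ℕ} {x : NExpr} {R : ℕ → State → Prop}
    (h : ∀ v, R v (s.setReg i v)) :
    Sim (.act (.unif i x)) s 1 (uniformBelow (x.eval s)) R := by
  refine ⟨_, Computes.act _ s, ?_⟩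
  have := Lifts.map (R := R) (uniformBelow (x.eval s)) (f := id) (g := fun v => s.setReg i v) h
  rwa [PMF.map_id] at this

theorem Sim.coin {i : ℕ} {x : RExpr} {R : ℕ → State → Prop}
    (h : ∀ v, R v (s.setReg i v)) :
    Sim (.act (.coin i x)) s 1 (coinFlip (x.eval s)) R := by
  refine ⟨_, Computes.act _ s, ?_⟩
  have := Lifts.map (R := R) (coinFlip (x.eval s)) (f := id) (g := fun v => s.setReg i v) h
  rwa [PMF.map_id] at this

theorem Sim.set_seq {i : ℕ} {x : NExpr} (h : Sim Q (s.setReg i (x.eval s)) T ν R) :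
    Sim (.seq (.act (.set i x)) Q) s (T + 2) ν R := by
  have := Sim.seq (P := .act (.set i x)) (s := s) (Sim.set (a := ()) (R := fun _ s' => s' = _) rfl)
    (κ := fun _ => ν) (Q := Q) (T' := T) (R' := R) (by rintro - - _ rfl; exact h)
  rw [PMF.pure_bind] at this
  exact this.mono (by omega)

theorem Sim.write_seq {i : ℕ} {j x : NExpr}
    (h : Sim Q (s.setArr i (j.eval s) (x.eval s)) T ν R) :
    Sim (.seq (.act (.write i j x)) Q) s (T + 2) ν R := by
  have := Sim.seq (P := .act (.write i j x)) (s := s)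
    (Sim.write (a := ()) (R := fun _ s' => s' = _) rfl)
    (κ := fun _ => ν) (Q := Q) (T' := T) (R' := R) (by rintro - - _ rfl; exact h)
  rw [PMF.pure_bind] at this
  exact this.mono (by omega)

theorem Sim.rset_seq {i : ℕ} {x : RExpr} (h : Sim Q (s.setRReg i (x.eval s)) T ν R) :
    Sim (.seq (.act (.rset i x)) Q) s (T + 2) ν R := by
  have := Sim.seq (P := .act (.rset i x)) (s := s)
    (Sim.rset (a := ()) (R := fun _ s' => s' = _) rfl)
    (κ := fun _ => ν) (Q := Q) (T' := T) (R' := R) (by rintro - - _ rfl; exact h)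
  rw [PMF.pure_bind] at this
  exact this.mono (by omega)

theorem Sim.rwrite_seq {i : ℕ} {j : NExpr} {x : RExpr}
    (h : Sim Q (s.setRArr i (j.eval s) (x.eval s)) T ν R) :
    Sim (.seq (.act (.rwrite i j x)) Q) s (T + 2) ν R := by
  have := Sim.seq (P := .act (.rwrite i j x)) (s := s)
    (Sim.rwrite (a := ()) (R := fun _ s' => s' = _) rfl)
    (κ := fun _ => ν) (Q := Q) (T' := T) (R' := R) (by rintro - - _ rfl; exact h)
  rw [PMF.pure_bind] at this
  exact this.mono (by omega)

/-- A deterministic first part, of which only a property of the resulting memory is known. -/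
theorem Sim.seq_det {I : State → Prop} (h : Sim P s T (PMF.pure ()) fun _ s' => I s')
    (h' : ∀ s', I s' → Sim Q s' T' ν R) : Sim (.seq P Q) s (T + T' + 1) ν R := by
  have := Sim.seq (κ := fun _ => ν) h fun _ _ s' hs' => h' s' hs'
  rwa [PMF.pure_bind] at this

/-- A deterministic second part, which only changes the relation. -/
theorem Sim.then_det {R' : α → State → Prop} (h : Sim P s T ν R)
    (h' : ∀ a ∈ ν.support, ∀ s', R a s' → Sim Q s' T' (PMF.pure a) R') :
    Sim (.seq P Q) s (T + T' + 1) ν R' := by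
  have := Sim.seq (κ := PMF.pure) h h'
  rwa [PMF.bind_pure] at this

end Sim

/-! ### Loops as iterated Markov kernels -/

/-- The distribution after `k` random transitions with the kernels `κ i`, `κ (i + 1)`, … -/
noncomputable def iterKer {α : Type*} (κ : ℕ → α → PMF α) : ℕ → ℕ → α → PMF α
  | _, 0, a => PMF.pure a
  | i, k + 1, a => (κ i a).bind (iterKer κ (i + 1) k)

/-- The definition splits off the first transition, as the execution of a loop does; computing
expectations and moments requires splitting off the last one. -/
theorem iterKer_succ' {α : Type*} (κ : ℕ → α → PMF α) (i k : ℕ) (a : α) :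
    iterKer κ i (k + 1) a = (iterKer κ i k a).bind (κ (i + k)) := by
  induction k generalizing i a with
  | zero => simp [iterKer]
  | succ k ih =>
    rw [iterKer, iterKer, PMF.bind_bind]
    refine PMF.bind_congr_support fun b _ => ?_
    rw [ih, show i + 1 + k = i + (k + 1) by omega]

/-- A loop with exactly `N` rounds simulates `N` random transitions. -/
theorem Sim.loop {α : Type*} {b : Test} {P : Prog} {T : ℕ} (N : ℕ) (κ : ℕ → α → PMF α)
    (I : ℕ → α → State → Prop)
    (hstep : ∀ i < N, ∀ a s, I i a s → b.holds s ∧ Sim P s T (κ i a) (I (i + 1)))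
    (hend : ∀ a s, I N a s → ¬ b.holds s) (a : α) (s : State) (h0 : I 0 a s) :
    Sim (.loop b P) s (N * (T + 1) + 1) (iterKer κ 0 N a) (I N) := by
  suffices h : ∀ k i, i + k = N → ∀ a s, I i a s →
      Sim (.loop b P) s (k * (T + 1) + 1) (iterKer κ i k a) (I N) from h N 0 (by omega) a s h0
  intro k
  induction k with
  | zero =>
    intro i hi a s h
    obtain rfl : i = N := by omega
    exact (Sim.loop_neg (hend a s h) h).mono (by omega)
  | succ k ih =>
    intro i hi a s h
    obtain ⟨hb, hs⟩ := hstep i (by omega) a s h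
    have := Sim.loop_pos hb hs fun a' _ s' h' => ih (i + 1) (by omega) a' s' h'
    exact this.mono (by ring_nf; omega)

theorem iterKer_pure {α : Type*} (i k : ℕ) (a : α) :
    iterKer (fun _ => PMF.pure) i k a = PMF.pure a := by
  induction k generalizing i with
  | zero => rfl
  | succ k ih => rw [iterKer, PMF.pure_bind, ih]

/-- A deterministic loop with exactly `N` rounds and the invariant `I`. -/
theorem Sim.loop_det {b : Test} {P : Prog} {T : ℕ} (N : ℕ) (I : ℕ → State → Prop)
    (hstep : ∀ i < N, ∀ s, I i s →
      b.holds s ∧ Sim P s T (PMF.pure ()) fun _ s' => I (i + 1) s')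
    (hend : ∀ s, I N s → ¬ b.holds s) (s : State) (h0 : I 0 s) :
    Sim (.loop b P) s (N * (T + 1) + 1) (PMF.pure ()) fun _ s' => I N s' := by
  have := Sim.loop N (fun _ => PMF.pure) (fun i (_ : Unit) s => I i s)
    (fun i hi a s h => hstep i hi s h) (fun _ s h => hend s h) () s h0
  rwa [iterKer_pure] at this

theorem Sim.approx {P : Prog} {s : State} {T : ℕ} {ν : PMF ℝ}
    (h : Sim P s T ν fun z s' => s'.rreg 0 = z) (A : Set ℝ) :
    HaltsWithin P s T ∧ ν.toOuterMeasure A ≤ (output P s T).toOuterMeasure A := by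
  obtain ⟨μ, hμ, hL⟩ := h
  have hrun : run P s T = μ.map fun s => ([], s) := hμ.finishes
  constructor
  · intro c hc
    rw [hrun, PMF.mem_support_map_iff] at hc
    obtain ⟨_, _, rfl⟩ := hc
    rfl
  · rw [output, hrun, PMF.map_comp, PMF.toOuterMeasure_map_apply]
    refine hL.toOuterMeasure_le ?_
    rintro a b rfl ha
    exact ha

end PottsFlow

namespace PottsFlow

/-! ## The heat bath chain on the coefficients of flows -/

/-- The `ZMod q`-flow `∑ k, c k • C k`. -/
def flow {m r q : ℕ} (C : Fin r → Fin m → ℤ) (c : Fin r → ZMod q) (e : Fin m) : ZMod q :=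
  ∑ k, c k * (C k e : ZMod q)

/-- The weight of the value `a` on the edge `e`: the edges in `F` are contracted, and any other edge
has weight `y` if `a = 0` and `1` otherwise. -/
noncomputable def edgeWeight {m q : ℕ} (y : ℝ) (F : Finset (Fin m)) (e : Fin m) (a : ZMod q) : ℝ :=
  if e ∈ F then 1 else if a = 0 then y else 1

/-- The weight of `f + t • C k` on the edges of `C k`. -/
noncomputable def localWeight {m r q : ℕ} (y : ℝ) (F : Finset (Fin m)) (C : Fin r → Fin m → ℤ)
    (f : Fin m → ZMod q) (k : Fin r) (t : ZMod q) : ℝ :=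
  ∏ e ∈ edges C k, edgeWeight y F e (f e + t * (C k e : ZMod q))

/-- Replace `c` by `i` with probability `W i / (W 0 + … + W i)`. -/
noncomputable def reservoir (W : ℕ → ℝ) (i c : ℕ) : PMF ℕ :=
  (coinFlip (W i / ∑ j ∈ Finset.range (i + 1), W j)).map fun b => if b = 1 then i else c

/-- The distribution on `{0, …, q - 1}` that is proportional to `W`. -/
noncomputable def heatBath (W : ℕ → ℝ) (q : ℕ) : PMF ℕ :=
  iterKer (reservoir W) 0 q 0

/-- The list of signed edges of the `k`-th even subgraph, empty if there is none. -/
def signedEdgesAt {m r : ℕ} (C : Fin r → Fin m → ℤ) (k : ℕ) : List (Fin m × ℤ) :=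
  if h : k < r then signedEdges C ⟨k, h⟩ else []

/-- The product of the weights of `f + t • χ` over a list of signed edges. -/
noncomputable def listWeight {m q : ℕ} (y : ℝ) (F : Finset (Fin m)) (L : List (Fin m × ℤ))
    (f : Fin m → ZMod q) (t : ZMod q) : ℝ :=
  (L.map fun p => edgeWeight y F p.1 (f p.1 + t * (p.2 : ZMod q))).prod

/-- Adding `t` to the `k`-th coefficient, if there is one. -/
def bump {r q : ℕ} (c : Fin r → ZMod q) (k : ℕ) (t : ZMod q) : Fin r → ZMod q :=
  if h : k < r then c + Pi.single ⟨k, h⟩ t else c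

/-- One transition of the heat bath chain. -/
noncomputable def chainKer {m r q : ℕ} (y : ℝ) (F : Finset (Fin m)) (C : Fin r → Fin m → ℤ)
    (c : Fin r → ZMod q) : PMF (Fin r → ZMod q) :=
  (uniformBelow r).bind fun k =>
    (heatBath (fun t => listWeight y F (signedEdgesAt C k) (flow C c) (t : ZMod q)) q).map
      fun t : ℕ => bump c k (t : ZMod q)

/-! ## The memory -/

@[simp] theorem State.setReg_reg (s : State) (i v j : ℕ) :
    (s.setReg i v).reg j = if j = i then v else s.reg j := by
  simp [State.setReg, Function.update_apply]
@[simp] theorem State.setReg_arr (s : State) (i v : ℕ) : (s.setReg i v).arr = s.arr := rfl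
@[simp] theorem State.setReg_rreg (s : State) (i v : ℕ) : (s.setReg i v).rreg = s.rreg := rfl
@[simp] theorem State.setReg_rarr (s : State) (i v : ℕ) : (s.setReg i v).rarr = s.rarr := rfl
@[simp] theorem State.setArr_arr (s : State) (a i v b j : ℕ) :
    (s.setArr a i v).arr b j = if b = a ∧ j = i then v else s.arr b j := by
  simp only [State.setArr, Function.update_apply]
  by_cases h : b = a <;> simp [h, Function.update_apply]
@[simp] theorem State.setArr_reg (s : State) (a i v : ℕ) : (s.setArr a i v).reg = s.reg := rfl
@[simp] theorem State.setArr_rreg (s : State) (a i v : ℕ) : (s.setArr a i v).rreg = s.rreg := rfl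
@[simp] theorem State.setArr_rarr (s : State) (a i v : ℕ) : (s.setArr a i v).rarr = s.rarr := rfl
@[simp] theorem State.setRReg_rreg (s : State) (i : ℕ) (v : ℝ) (j : ℕ) :
    (s.setRReg i v).rreg j = if j = i then v else s.rreg j := by
  simp [State.setRReg, Function.update_apply]
@[simp] theorem State.setRReg_reg (s : State) (i : ℕ) (v : ℝ) : (s.setRReg i v).reg = s.reg := rfl
@[simp] theorem State.setRReg_arr (s : State) (i : ℕ) (v : ℝ) : (s.setRReg i v).arr = s.arr := rfl
@[simp] theorem State.setRReg_rarr (s : State) (i : ℕ) (v : ℝ) :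
    (s.setRReg i v).rarr = s.rarr := rfl
@[simp] theorem State.setRArr_rarr (s : State) (a i : ℕ) (v : ℝ) (b j : ℕ) :
    (s.setRArr a i v).rarr b j = if b = a ∧ j = i then v else s.rarr b j := by
  simp only [State.setRArr, Function.update_apply]
  by_cases h : b = a <;> simp [h, Function.update_apply]
@[simp] theorem State.setRArr_reg (s : State) (a i : ℕ) (v : ℝ) :
    (s.setRArr a i v).reg = s.reg := rfl
@[simp] theorem State.setRArr_arr (s : State) (a i : ℕ) (v : ℝ) :
    (s.setRArr a i v).arr = s.arr := rfl
@[simp] theorem State.setRArr_rreg (s : State) (a i : ℕ) (v : ℝ) :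
    (s.setRArr a i v).rreg = s.rreg := rfl

attribute [simp] NExpr.eval RExpr.eval Test.holds

/-- The integer registers below `i`, the integer arrays below `a` and the real registers below `j`
agree in the two memories. -/
def Keeps (i a j : ℕ) (s s' : State) : Prop :=
  (∀ x < i, s'.reg x = s.reg x) ∧ (∀ x < a, s'.arr x = s.arr x) ∧ ∀ x < j, s'.rreg x = s.rreg x

section Keeps

variable {i a j : ℕ} {s s' s'' : State}

theorem Keeps.refl (i a j : ℕ) (s : State) : Keeps i a j s s := by simp [Keeps]

theorem Keeps.trans (h : Keeps i a j s s') (h' : Keeps i a j s' s'') : Keeps i a j s s'' :=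
  ⟨fun x hx => (h'.1 x hx).trans (h.1 x hx), fun x hx => (h'.2.1 x hx).trans (h.2.1 x hx),
    fun x hx => (h'.2.2 x hx).trans (h.2.2 x hx)⟩

/-- Registers and arrays are allotted by nesting depth, inner programs writing to higher numbers.
Lowering the thresholds turns what an inner program preserves into what the outer one needs. -/
theorem Keeps.mono {i' a' j' : ℕ} (h : Keeps i a j s s') (hi : i' ≤ i) (ha : a' ≤ a)
    (hj : j' ≤ j) : Keeps i' a' j' s s' :=
  ⟨fun x hx => h.1 x (by omega), fun x hx => h.2.1 x (by omega), fun x hx => h.2.2 x (by omega)⟩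

theorem Keeps.setReg {x v : ℕ} (h : Keeps i a j s s') (hx : i ≤ x) :
    Keeps i a j s (s'.setReg x v) :=
  ⟨fun z hz => by simp [show z ≠ x by omega, h.1 z hz], h.2.1, h.2.2⟩

theorem Keeps.setRReg {x : ℕ} {v : ℝ} (h : Keeps i a j s s') (hx : j ≤ x) :
    Keeps i a j s (s'.setRReg x v) :=
  ⟨h.1, h.2.1, fun z hz => by simp [show z ≠ x by omega, h.2.2 z hz]⟩

theorem Keeps.setArr {x y v : ℕ} (h : Keeps i a j s s') (hx : a ≤ x) :
    Keeps i a j s (s'.setArr x y v) :=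
  ⟨h.1, fun z hz => by ext; simp [show z ≠ x by omega, h.2.1 z hz], h.2.2⟩

theorem Keeps.setRArr {x y : ℕ} {v : ℝ} (h : Keeps i a j s s') :
    Keeps i a j s (s'.setRArr x y v) := h

end Keeps

/-! ## One transition of the chain -/

/-- Increase an integer register by one. -/
def incr (i : ℕ) : Prog := .act (.set i (.add (.reg i) (.lit 1)))

/-- Put `1` into the cells `0, …, q - 1` of the real array `0`. -/
def initWeights (q : ℕ) : Prog :=
  .seq (.act (.set 8 (.lit 0))) <|
  .loop (.nlt (.reg 8) (.lit q)) <|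
    .seq (.act (.rwrite 0 (.reg 8) (.nat (.lit 1)))) (incr 8)

/-- Multiply the weights of the values for which the flow vanishes on the current edge. -/
def weighEdge (q : ℕ) : Prog :=
  .seq (.ite (.and (.neq (.arr 4 (.reg 6)) (.lit 1)) (.not (.neq (.arr 7 (.reg 7)) (.lit 0))))
    (.act (.set 8 (.sub (.lit q) (.arr 7 (.reg 7))))) (.act (.set 8 (.arr 7 (.reg 7))))) <|
  .act (.rwrite 0 (.reg 8) (.mul (.arr 0 (.reg 8)) (.reg 2)))

/-- Compute the weights of all the values that the coefficient of `C k` may be increased by. -/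
def computeWeights (q : ℕ) : Prog :=
  .seq (.act (.set 6 (.arr 2 (.reg 5)))) <|
  .loop (.nlt (.reg 6) (.arr 2 (.add (.reg 5) (.lit 1)))) <|
    .seq (.act (.set 7 (.arr 3 (.reg 6)))) <|
    .seq (.ite (.neq (.arr 6 (.reg 7)) (.lit 0)) (weighEdge q) .skip) (incr 6)

/-- Choose a value according to the weights. -/
def chooseValue (q : ℕ) : Prog :=
  .seq (.act (.set 8 (.lit 0))) <|
  .seq (.act (.set 9 (.lit 0))) <|
  .seq (.act (.rset 7 (.nat (.lit 0)))) <|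
  .loop (.nlt (.reg 8) (.lit q)) <|
    .seq (.act (.rset 7 (.add (.reg 7) (.arr 0 (.reg 8))))) <|
    .seq (.act (.coin 10 (.div (.arr 0 (.reg 8)) (.reg 7)))) <|
    .seq (.ite (.neq (.reg 10) (.lit 1)) (.act (.set 9 (.reg 8))) .skip) (incr 8)

/-- Add the chosen multiple of `C k` to the flow. -/
def updateFlow (q : ℕ) : Prog :=
  .seq (.act (.set 6 (.arr 2 (.reg 5)))) <|
  .loop (.nlt (.reg 6) (.arr 2 (.add (.reg 5) (.lit 1)))) <|
    .seq (.act (.set 7 (.arr 3 (.reg 6)))) <|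
    .seq (.ite (.neq (.arr 4 (.reg 6)) (.lit 1))
      (.act (.set 8 (.add (.arr 7 (.reg 7)) (.reg 9))))
      (.act (.set 8 (.add (.arr 7 (.reg 7)) (.sub (.lit q) (.reg 9)))))) <|
    .seq (.ite (.nlt (.reg 8) (.lit q)) .skip (.act (.set 8 (.sub (.reg 8) (.lit q))))) <|
    .seq (.act (.write 7 (.reg 7) (.reg 8))) (incr 6)

/-- One transition of the heat bath chain. -/
def chainStep (q : ℕ) : Prog :=
  .seq (.act (.unif 5 (.reg 2))) <|
  .seq (initWeights q) <|
  .seq (computeWeights q) <|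
  .seq (chooseValue q) (updateFlow q)

/-- The array `7` holds the flow `f`. -/
def HoldsFlow {m q : ℕ} (f : Fin m → ZMod q) (s : State) : Prop :=
  ∀ e : Fin m, s.arr 7 e = (f e).val

/-- The array `6` holds the indicator function of `F`. -/
def HoldsSet {m : ℕ} (F : Finset (Fin m)) (s : State) : Prop :=
  ∀ e : Fin m, s.arr 6 e = if e ∈ F then 1 else 0

/-- The register `5` holds the number of an element of the generating set whose list of signed edges
is `L`, and that list is found at the right place. -/
def HoldsList {m : ℕ} (L : List (Fin m × ℤ)) (s : State) : Prop :=
  (∀ p ∈ L, p.2 = 1 ∨ p.2 = -1) ∧ s.arr 2 (s.reg 5 + 1) = s.arr 2 (s.reg 5) + L.length ∧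
  ∀ (i : ℕ) (hi : i < L.length), s.arr 3 (s.arr 2 (s.reg 5) + i) = L[i].1 ∧
    s.arr 4 (s.arr 2 (s.reg 5) + i) = if L[i].2 = 1 then 1 else 0

theorem HoldsList.keeps {m : ℕ} {L : List (Fin m × ℤ)} {s s' : State} (h : HoldsList L s)
    (hk : Keeps 6 7 7 s s') : HoldsList L s' := by
  unfold HoldsList
  rw [hk.1 5 (by norm_num), hk.2.1 2 (by norm_num), hk.2.1 3 (by norm_num),
    hk.2.1 4 (by norm_num)]
  exact h

theorem sim_initWeights (q : ℕ) (s : State) :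
    Sim (initWeights q) s (5 * q + 3) (PMF.pure ()) fun _ s' =>
      Keeps 6 8 7 s s' ∧ ∀ t < q, s'.rarr 0 t = 1 := by
  have h := Sim.loop_det (b := .nlt (.reg 8) (.lit q))
    (P := .seq (.act (.rwrite 0 (.reg 8) (.nat (.lit 1)))) (incr 8)) (T := 3) q
    (fun i s' => Keeps 6 8 7 s s' ∧ s'.reg 8 = i ∧ ∀ t < i, s'.rarr 0 t = 1) ?_ ?_
    (s.setReg 8 0) ⟨(Keeps.refl _ _ _ _).setReg (by norm_num), by simp, by simp⟩
  · refine ((Sim.set_seq h).mono (by omega)).weaken fun _ _ s' h => ⟨h.1, h.2.2⟩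
  · rintro i hi s' ⟨hk, h8, hW⟩
    refine ⟨by simpa [h8] using hi, Sim.rwrite_seq (Sim.set ⟨?_, ?_, ?_⟩)⟩
    · exact hk.setRArr.setReg (by norm_num)
    · simp [h8]
    · intro t ht
      by_cases h : t = i
      · simp [h, h8]
      · simp [h, h8, hW t (by omega)]
  · rintro s' ⟨hk, h8, hW⟩
    simp [h8]

/-- As the sign is a unit, the new flow vanishes on a given edge for exactly one value t. So an edge
affects a single cell of the table of weights, and is processed in constant time. -/
theorem zmod_vanish_iff {q : ℕ} {a σ : ZMod q} {t u : ℕ} (hσ : σ = 1 ∨ σ = -1)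
    (ht : t < q) (hu : u < q) (h : (u : ZMod q) = -(σ * a)) :
    a + (t : ZMod q) * σ = 0 ↔ t = u := by
  have h1 : t = u ↔ (t : ZMod q) = (u : ZMod q) := by
    rw [ZMod.natCast_eq_natCast_iff', Nat.mod_eq_of_lt ht, Nat.mod_eq_of_lt hu]
  rw [h1, h]
  rcases hσ with rfl | rfl
  · rw [mul_one, one_mul, add_comm, add_eq_zero_iff_eq_neg]
  · rw [mul_neg_one, neg_one_mul, neg_neg, add_neg_eq_zero, eq_comm]

theorem sim_weighEdge {m q : ℕ} [NeZero q] {y : ℝ} {f : Fin m → ZMod q}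
    {g : Fin m} {σ : ℤ} (hσ : σ = 1 ∨ σ = -1) {s : State} (hf : HoldsFlow f s)
    (hy : s.rreg 2 = y) (h7 : s.reg 7 = g)
    (h4 : s.arr 4 (s.reg 6) = if σ = 1 then 1 else 0) :
    Sim (weighEdge q) s 4 (PMF.pure ()) fun _ s' =>
      Keeps 8 8 8 s s' ∧ ∀ t < q, s'.rarr 0 t =
        s.rarr 0 t * if f g + (t : ZMod q) * (σ : ZMod q) = 0 then y else 1 := by
  have hfg : s.arr 7 (s.reg 7) = (f g).val := by rw [h7]; exact hf g
  have hlt := ZMod.val_lt (f g)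
  have hσ' : (σ : ZMod q) = 1 ∨ (σ : ZMod q) = -1 := by
    rcases hσ with rfl | rfl <;> simp
  have main : ∀ u : ℕ, u < q → (u : ZMod q) = -((σ : ZMod q) * f g) →
      Sim (.act (.rwrite 0 (.reg 8) (.mul (.arr 0 (.reg 8)) (.reg 2)))) (s.setReg 8 u) 1
        (PMF.pure ()) fun _ s' =>
      Keeps 8 8 8 s s' ∧ ∀ t < q, s'.rarr 0 t =
        s.rarr 0 t * if f g + (t : ZMod q) * (σ : ZMod q) = 0 then y else 1 := by
    intro u hu h
    refine Sim.rwrite ⟨((Keeps.refl _ _ _ _).setReg (by norm_num)).setRArr, fun t ht => ?_⟩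
    rw [if_congr (zmod_vanish_iff hσ' ht hu h) rfl rfl]
    by_cases htu : t = u <;> simp [htu, hy]
  have hset : ∀ (b : Test) (x x' : NExpr) (u : ℕ), (b.holds s → x.eval s = u) →
      (¬ b.holds s → x'.eval s = u) →
      Sim (.ite b (.act (.set 8 x)) (.act (.set 8 x'))) s 2 (PMF.pure ())
        fun _ s' => s' = s.setReg 8 u := fun b x x' u h h' =>
    Sim.ite (fun hb => Sim.set (by rw [h hb])) (fun hb => Sim.set (by rw [h' hb]))
  -- The cell is the representative below q of -σ f(g). For σ = 1 this is q - val, except that a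
  -- vanishing flow needs the cell 0 rather than the cell q, which is out of range.
  by_cases hcase : σ = 1 ∧ f g ≠ 0
  · refine (Sim.seq_det (T' := 1) (hset _ _ _ (q - (f g).val) ?_ ?_) ?_).mono le_rfl
    · simp [hfg]
    · simp [h4, hfg, hcase.1, hcase.2]
    · rintro s' rfl
      refine main _ ?_ ?_
      · have : 0 < (f g).val := by rw [Nat.pos_iff_ne_zero, Ne, ZMod.val_eq_zero]; exact hcase.2
        omega
      · rw [Nat.cast_sub hlt.le]; simp [hcase.1]
  · refine (Sim.seq_det (T' := 1) (hset _ _ _ (f g).val ?_ ?_) ?_).mono le_rfl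
    · simp only [Test.holds, NExpr.eval, h4, hfg]
      rcases hσ with rfl | rfl
      · simp at hcase; simp [hcase]
      · simp
    · simp [hfg]
    · rintro s' rfl
      refine main _ hlt ?_
      rcases hσ with rfl | rfl
      · simp at hcase; simp [hcase]
      · simp

theorem edgeWeight_of_mem {m q : ℕ} {y : ℝ} {F : Finset (Fin m)} {e : Fin m} (h : e ∈ F)
    (a : ZMod q) : edgeWeight y F e a = 1 := if_pos h

theorem edgeWeight_of_notMem {m q : ℕ} {y : ℝ} {F : Finset (Fin m)} {e : Fin m} (h : e ∉ F)
    (a : ZMod q) : edgeWeight y F e a = if a = 0 then y else 1 := if_neg h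

theorem sim_computeWeights {m q : ℕ} [NeZero q] {y : ℝ} {F : Finset (Fin m)}
    {f : Fin m → ZMod q} {L : List (Fin m × ℤ)} {s : State} (hf : HoldsFlow f s)
    (hF : HoldsSet F s) (hL : HoldsList L s) (hy : s.rreg 2 = y)
    (hW : ∀ t < q, s.rarr 0 t = 1) :
    Sim (computeWeights q) s (L.length * 11 + 3) (PMF.pure ()) fun _ s' =>
      Keeps 6 8 7 s s' ∧ ∀ t < q, s'.rarr 0 t = listWeight y F L f (t : ZMod q) := by
  set w : ℕ → List ℝ := fun t =>
    L.map fun p => edgeWeight y F p.1 (f p.1 + (t : ZMod q) * (p.2 : ZMod q)) with hw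
  have hlen : ∀ t, (w t).length = L.length := fun t => by simp [hw]
  have h := Sim.loop_det (b := .nlt (.reg 6) (.arr 2 (.add (.reg 5) (.lit 1))))
    (P := .seq (.act (.set 7 (.arr 3 (.reg 6)))) <|
      .seq (.ite (.neq (.arr 6 (.reg 7)) (.lit 0)) (weighEdge q) .skip) (incr 6)) (T := 9) L.length
    (fun i s' => Keeps 6 8 7 s s' ∧ s'.reg 6 = s.arr 2 (s.reg 5) + i ∧
      ∀ t < q, s'.rarr 0 t = ((w t).take i).prod) ?_ ?_
    (s.setReg 6 (s.arr 2 (s.reg 5)))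
    ⟨(Keeps.refl _ _ _ _).setReg (by norm_num), by simp, by simpa using hW⟩
  · refine ((Sim.set_seq h).mono (by omega)).weaken fun _ _ s' h => ⟨h.1, fun t ht => ?_⟩
    rw [h.2.2 t ht, ← hlen t, List.take_length]
    rfl
  · rintro i hi s1 ⟨hk, h6, hW⟩
    have hL1 := hL.keeps (hk.mono le_rfl (by norm_num) le_rfl)
    have e5 : s1.reg 5 = s.reg 5 := hk.1 5 (by norm_num)
    have e2 : s1.arr 2 = s.arr 2 := hk.2.1 2 (by norm_num)
    have h6' : s1.reg 6 = s1.arr 2 (s1.reg 5) + i := by rw [h6, e5, e2]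
    obtain ⟨h3, h4⟩ := hL1.2.2 i hi
    have hσ := hL1.1 _ (List.getElem_mem hi)
    refine ⟨by simp [h6', hL1.2.1, hi], Sim.mono (Sim.set_seq (T := 7) ?_) le_rfl⟩
    have hg : NExpr.eval s1 (.arr 3 (.reg 6)) = L[i].1 := by simp [h6', h3]
    rw [hg]
    refine (Sim.seq_det (T := 5) (T' := 1)
      (I := fun s2 => Keeps 6 8 7 s s2 ∧ s2.reg 6 = s.arr 2 (s.reg 5) + i ∧
        ∀ t < q, s2.rarr 0 t = ((w t).take (i + 1)).prod) (Sim.ite ?_ ?_) ?_)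
    · intro hb
      have hF' : L[i].1 ∉ F := by
        intro hmem
        have : s1.arr 6 L[i].1 = 1 := by
          rw [hk.2.1 6 (by norm_num), hF]; simp [hmem]
        simp [this] at hb
      refine (sim_weighEdge (y := y) (f := f) (g := L[i].1) hσ ?_ ?_ ?_ ?_).weaken ?_
      · intro e
        simp only [State.setReg_arr]
        rw [hk.2.1 7 (by norm_num)]
        exact hf e
      · simp only [State.setReg_rreg]; rw [hk.2.2 2 (by norm_num), hy]
      · simp
      · simp [h6', h4]
      · rintro - - s2 ⟨hk2, hW2⟩
        refine ⟨(hk.setReg (by norm_num)).trans (hk2.mono (by norm_num) le_rfl (by norm_num)), ?_, ?_⟩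
        · rw [hk2.1 6 (by norm_num)]; simp [h6]
        · intro t ht
          rw [hW2 t ht, List.prod_take_succ _ _ (by rw [hlen]; exact hi)]
          simp [hw, hW t ht, edgeWeight_of_notMem hF']
    · intro hb
      have hF' : L[i].1 ∈ F := by
        by_contra hmem
        have : s1.arr 6 L[i].1 = 0 := by
          rw [hk.2.1 6 (by norm_num), hF]; simp [hmem]
        simp [this] at hb
      refine (Sim.skip ⟨hk.setReg (by norm_num), by simp [h6], fun t ht => ?_⟩).mono (by norm_num)
      rw [List.prod_take_succ _ _ (by rw [hlen]; exact hi)]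
      simp [hw, hW t ht, edgeWeight_of_mem hF']
    · rintro s2 ⟨hk2, h62, hW2⟩
      exact Sim.set ⟨hk2.setReg (by norm_num), by simp [h62, add_assoc], hW2⟩
  · rintro s' ⟨hk, h6, hW⟩
    have hL1 := hL.keeps (hk.mono le_rfl (by norm_num) le_rfl)
    have e5 : s'.reg 5 = s.reg 5 := hk.1 5 (by norm_num)
    have e2 : s'.arr 2 = s.arr 2 := hk.2.1 2 (by norm_num)
    simp [h6, e5, e2, hL.2.1]

theorem sim_chooseValue (q : ℕ) {W : ℕ → ℝ} {s : State} (hW : ∀ t < q, s.rarr 0 t = W t) :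
    Sim (chooseValue q) s (q * 10 + 7) (heatBath W q) fun t s' =>
      Keeps 6 8 7 s s' ∧ s'.reg 9 = t := by
  have h := Sim.loop (b := .nlt (.reg 8) (.lit q))
    (P := .seq (.act (.rset 7 (.add (.reg 7) (.arr 0 (.reg 8))))) <|
      .seq (.act (.coin 10 (.div (.arr 0 (.reg 8)) (.reg 7)))) <|
      .seq (.ite (.neq (.reg 10) (.lit 1)) (.act (.set 9 (.reg 8))) .skip) (incr 8)) (T := 8) q
    (reservoir W)
    (fun i t s' => Keeps 6 8 7 s s' ∧ s'.rarr = s.rarr ∧ s'.reg 8 = i ∧ s'.reg 9 = t ∧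
      s'.rreg 7 = ∑ j ∈ Finset.range i, W j) ?_ ?_ 0
    (((s.setReg 8 0).setReg 9 0).setRReg 7 0)
    ⟨(((Keeps.refl _ _ _ _).setReg (by norm_num)).setReg (by norm_num)).setRReg (by norm_num),
      by simp, by simp, by simp, by simp⟩
  · have h' := h.weaken (R' := fun t s' => Keeps 6 8 7 s s' ∧ s'.reg 9 = t)
      fun t _ s' h => ⟨h.1, h.2.2.2.1⟩
    refine Sim.set_seq (Sim.set_seq (Sim.rset_seq (T := q * 10 + 1) ?_))
    simpa [heatBath] using h'.mono (by omega)
  · rintro i hi t s1 ⟨hk, hr, h8, h9, h7⟩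
    refine ⟨by simp [h8, hi], Sim.rset_seq (T := 6) ?_⟩
    have hx : RExpr.eval s1 (.add (.reg 7) (.arr 0 (.reg 8))) =
        ∑ j ∈ Finset.range (i + 1), W j := by
      simp [h8, hr, h7, hW i hi, Finset.sum_range_succ]
    rw [hx, reservoir]
    have hp : RExpr.eval (s1.setRReg 7 (∑ j ∈ Finset.range (i + 1), W j))
        (.div (.arr 0 (.reg 8)) (.reg 7)) = W i / ∑ j ∈ Finset.range (i + 1), W j := by
      simp [h8, hr, hW i hi]
    have hc := Sim.coin (i := 10) (x := .div (.arr 0 (.reg 8)) (.reg 7))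
      (s := s1.setRReg 7 (∑ j ∈ Finset.range (i + 1), W j)) (R := fun v s' => s' = State.setReg
        (s1.setRReg 7 (∑ j ∈ Finset.range (i + 1), W j)) 10 v) fun v => rfl
    rw [hp] at hc
    refine Sim.seq (T' := 4) hc (κ := fun v => PMF.pure (if v = 1 then i else t)) ?_
    · rintro v - s2 rfl
      refine (Sim.seq_det (T := 2) (T' := 1)
        (I := fun s2 => Keeps 6 8 7 s s2 ∧ s2.rarr = s.rarr ∧ s2.reg 8 = i ∧
          s2.reg 9 = (if v = 1 then i else t) ∧
          s2.rreg 7 = ∑ j ∈ Finset.range (i + 1), W j) (Sim.ite ?_ ?_) ?_)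
      · intro hb
        refine Sim.set ⟨((hk.setRReg (by norm_num)).setReg (by norm_num)).setReg (by norm_num), ?_⟩
        simp at hb
        simp [hr, h8, hb]
      · intro hb
        refine Sim.skip ⟨(hk.setRReg (by norm_num)).setReg (by norm_num), ?_⟩
        simp at hb
        simp [hr, h8, hb, h9]
      · rintro s2 ⟨hk2, hr2, h82, h92, h72⟩
        refine Sim.set ⟨hk2.setReg (by norm_num), by simp [hr2], by simp [h82], by simp [h92],
          by simp [h72]⟩
  · rintro t s' ⟨hk, hr, h8, h9, h7⟩
    simp [h8]

theorem sim_updateFlow {m q : ℕ} [NeZero q] {f : Fin m → ZMod q} {L : List (Fin m × ℤ)}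
    {t : ℕ} (ht : t ≤ q) {s : State} (hf : HoldsFlow f s) (hL : HoldsList L s)
    (h9 : s.reg 9 = t) :
    Sim (updateFlow q) s (L.length * 15 + 3) (PMF.pure ()) fun _ s' =>
      Keeps 5 7 7 s s' ∧ HoldsFlow (fun e => f e + (t : ZMod q) *
        (L.map fun p => if p.1 = e then (p.2 : ZMod q) else 0).sum) s' := by
  set w : Fin m → List (ZMod q) := fun e =>
    L.map fun p => if p.1 = e then (p.2 : ZMod q) else 0 with hw
  have hlen : ∀ t, (w t).length = L.length := fun t => by simp [hw]
  have h := Sim.loop_det (b := .nlt (.reg 6) (.arr 2 (.add (.reg 5) (.lit 1))))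
    (P := .seq (.act (.set 7 (.arr 3 (.reg 6)))) <|
    .seq (.ite (.neq (.arr 4 (.reg 6)) (.lit 1))
      (.act (.set 8 (.add (.arr 7 (.reg 7)) (.reg 9))))
      (.act (.set 8 (.add (.arr 7 (.reg 7)) (.sub (.lit q) (.reg 9)))))) <|
    .seq (.ite (.nlt (.reg 8) (.lit q)) .skip (.act (.set 8 (.sub (.reg 8) (.lit q))))) <|
    .seq (.act (.write 7 (.reg 7) (.reg 8))) (incr 6)) (T := 13) L.length
    (fun i s' => Keeps 6 7 7 s s' ∧ s'.reg 6 = s.arr 2 (s.reg 5) + i ∧ s'.reg 9 = t ∧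
      HoldsFlow (fun e => f e + (t : ZMod q) * ((w e).take i).sum) s') ?_ ?_
    (s.setReg 6 (s.arr 2 (s.reg 5)))
    ⟨(Keeps.refl _ _ _ _).setReg (by norm_num), by simp, by simpa using h9, fun e => by simpa using hf e⟩
  · refine ((Sim.set_seq h).mono (by omega)).weaken fun _ _ s' h =>
      ⟨h.1.mono (by norm_num) le_rfl le_rfl, ?_⟩
    have h4 := h.2.2.2
    simp only [show ∀ e, (w e).take L.length = w e from fun e => by
      rw [← hlen e, List.take_length]] at h4
    exact h4
  · rintro i hi s1 ⟨hk, h6, h9, hf1⟩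
    have hL1 := hL.keeps hk
    have e5 : s1.reg 5 = s.reg 5 := hk.1 5 (by norm_num)
    have e2 : s1.arr 2 = s.arr 2 := hk.2.1 2 (by norm_num)
    have h6' : s1.reg 6 = s1.arr 2 (s1.reg 5) + i := by rw [h6, e5, e2]
    obtain ⟨h3, h4⟩ := hL1.2.2 i hi
    have hσ := hL1.1 _ (List.getElem_mem hi)
    refine ⟨by simp [h6', hL1.2.1, hi], Sim.mono (Sim.set_seq (T := 11) ?_) le_rfl⟩
    have hg : NExpr.eval s1 (.arr 3 (.reg 6)) = L[i].1 := by simp [h6', h3]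
    rw [hg]
    set a : ZMod q := f L[i].1 + (t : ZMod q) * ((w L[i].1).take i).sum with ha
    have hfa : s1.arr 7 L[i].1 = a.val := hf1 L[i].1
    have halt := ZMod.val_lt a
    -- Integer subtraction is truncated, so adding -t is replaced by adding q - t.
    set u : ℕ := a.val + if L[i].2 = 1 then t else q - t with hu
    have hu2 : u ≤ a.val + q := by rw [hu]; split_ifs <;> omega
    have hcast : ((u : ℕ) : ZMod q) = a + (t : ZMod q) * (L[i].2 : ZMod q) := by
      rw [hu]
      rcases hσ with h | h
      · simp [h]
      · simp [h, Nat.cast_sub ht]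
    refine Sim.seq_det (T := 2) (T' := 8)
      (I := fun s2 => s2 = (s1.setReg 7 L[i].1).setReg 8 u) (Sim.ite ?_ ?_) ?_
    · intro hb
      have : L[i].2 = 1 := by
        by_contra hne
        simp [h6', h4, hne] at hb
      refine Sim.set ?_
      simp [hfa, h9, hu, this]
    · intro hb
      have : L[i].2 ≠ 1 := by
        intro hne
        simp [h6', h4, hne] at hb
      refine Sim.set ?_
      simp [hfa, h9, hu, this]
    rintro s2 rfl
    -- The machine has no remainder operation, but u ≤ a.val + q < 2q, so one conditional
    -- subtraction reduces u modulo q.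
    set v : ℕ := if u < q then u else u - q with hv
    have hvval : v = (a + (t : ZMod q) * (L[i].2 : ZMod q)).val := by
      have hvq : v < q := by rw [hv]; split_ifs <;> omega
      rw [← hcast, ZMod.val_natCast]
      rw [hv]
      split_ifs with h
      · exact (Nat.mod_eq_of_lt h).symm
      · rw [Nat.mod_eq_sub_mod (by omega), Nat.mod_eq_of_lt (by omega)]
    refine Sim.seq_det (T := 2) (T' := 5)
      (I := fun s2 => Keeps 6 7 7 s s2 ∧ s2.arr = s1.arr ∧ s2.reg 6 = s1.reg 6 ∧ s2.reg 9 = t ∧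
        s2.reg 7 = L[i].1 ∧ s2.reg 8 = v) (Sim.ite ?_ ?_) ?_
    · intro hb
      refine Sim.skip ⟨(hk.setReg (by norm_num)).setReg (by norm_num), ?_⟩
      simp at hb
      simp [h9, hv, hb]
    · intro hb
      refine Sim.set ⟨((hk.setReg (by norm_num)).setReg (by norm_num)).setReg (by norm_num), ?_⟩
      simp at hb
      simp [h9, hv, hb]
    rintro s2 ⟨hk2, ha2, h62, h92, h72, h82⟩
    refine (Sim.write_seq (T := 1) (Sim.set ⟨(hk2.setArr (by norm_num)).setReg (by norm_num),
      ?_, ?_, ?_⟩)).mono (by norm_num)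
    · simp [h62, h6, add_assoc]
    · simp [h92]
    · intro e
      have hs := List.sum_take_succ (w e) i (by rw [hlen]; exact hi)
      beta_reduce
      by_cases he : e = L[i].1
      · rw [hs]
        subst he
        have hwi : (w L[i].1)[i]'(by rw [hlen]; exact hi) = (L[i].2 : ZMod q) := by simp [hw]
        simp only [NExpr.eval, State.setReg_arr, State.setArr_arr, h72, h82, hvval, hwi]
        rw [if_pos (by simp), ha, mul_add, add_assoc]
      · have hwi : (w e)[i]'(by rw [hlen]; exact hi) = 0 := by simp [hw, Ne.symm he]
        rw [hs, hwi, add_zero]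
        have : (e : ℕ) ≠ L[i].1 := fun h => he (Fin.ext h)
        simp only [NExpr.eval, State.setReg_arr, State.setArr_arr, h72, h82, ha2]
        rw [if_neg (by simp [this])]
        exact hf1 e
  · rintro s' ⟨hk, h6, -, -⟩
    have e5 : s'.reg 5 = s.reg 5 := hk.1 5 (by norm_num)
    have e2 : s'.arr 2 = s.arr 2 := hk.2.1 2 (by norm_num)
    simp [h6, e5, e2, hL.2.1]

end PottsFlow

namespace PottsFlow

/-! ### The generating set as lists of signed edges, and its place in the memory -/

section Lists

variable {m r q : ℕ} {C : Fin r → Fin m → ℤ}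

theorem sum_map_signedEdges {M : Type*} [AddCommMonoid M] (k : Fin r) (g : Fin m × ℤ → M) :
    ((signedEdges C k).map g).sum = ∑ e ∈ edges C k, g (e, C k e) := by
  rw [signedEdges, List.map_map, ← List.sum_toFinset _ ((List.nodup_finRange m).filter _)]
  refine Finset.sum_congr ?_ fun _ _ => rfl
  ext e; simp [edges]

theorem prod_map_signedEdges {M : Type*} [CommMonoid M] (k : Fin r) (g : Fin m × ℤ → M) :
    ((signedEdges C k).map g).prod = ∏ e ∈ edges C k, g (e, C k e) := by
  rw [signedEdges, List.map_map, ← List.prod_toFinset _ ((List.nodup_finRange m).filter _)]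
  refine Finset.prod_congr ?_ fun _ _ => rfl
  ext e; simp [edges]

theorem length_signedEdges (k : Fin r) : (signedEdges C k).length = (edges C k).card := by
  have := sum_map_signedEdges (C := C) k (fun _ => 1)
  simpa using this

theorem listWeight_signedEdges (y : ℝ) (F : Finset (Fin m)) (f : Fin m → ZMod q) (k : Fin r)
    (t : ZMod q) : listWeight y F (signedEdges C k) f t = localWeight y F C f k t :=
  prod_map_signedEdges k _

theorem flow_add_single (c : Fin r → ZMod q) (k : Fin r) (t : ZMod q) (e : Fin m) :
    flow C (c + Pi.single k t) e = flow C c e + t * (C k e : ZMod q) := by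
  simp [flow, add_mul, Finset.sum_add_distrib, Pi.single_apply, ite_mul]

theorem flow_bump (c : Fin r → ZMod q) (k : ℕ) (t : ZMod q) :
    flow C (bump c k t) = fun e => flow C c e + t *
      ((signedEdgesAt C k).map fun p => if p.1 = e then (p.2 : ZMod q) else 0).sum := by
  funext e
  unfold bump signedEdgesAt
  split_ifs with h
  · rw [flow_add_single, sum_map_signedEdges]
    congr 2
    simp only [Finset.sum_ite_eq']
    by_cases h0 : C ⟨k, h⟩ e = 0 <;> simp [edges, h0]
  · simp

theorem allSignedEdges_drop (k : ℕ) (hk : k < r) :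
    ∃ A B, allSignedEdges C = A ++ signedEdges C ⟨k, hk⟩ ++ B ∧ A.length = offset C k := by
  refine ⟨((List.finRange r).take k).flatMap (signedEdges C),
    ((List.finRange r).drop (k + 1)).flatMap (signedEdges C), ?_, ?_⟩
  · rw [allSignedEdges]
    conv_lhs => rw [← List.take_append_drop k (List.finRange r)]
    rw [List.flatMap_append, List.drop_eq_getElem_cons (by simpa using hk), List.flatMap_cons]
    simp
  · simp [offset, List.length_flatMap]

theorem offset_succ (k : ℕ) (hk : k < r) :
    offset C (k + 1) = offset C k + (signedEdges C ⟨k, hk⟩).length := by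
  unfold offset
  rw [List.take_add_one, List.map_append, List.sum_append]
  simp [hk]

/-- The second alternative in `hk` is the empty generating set, for which the random index is 0 by
convention. The cells 0 and 1 of the array `2` are then both 0, so the list read there is empty and
the chain stands still. -/
theorem holdsList_input {n : ℕ} {G : Multigraph n m} {w ε : ℝ} {s : State}
    (hs : Keeps 3 5 2 (input G C w ε) s) (hC : ∀ k e, C k e = 0 ∨ C k e = 1 ∨ C k e = -1)
    {k : ℕ} (hk : k < r ∨ r = 0 ∧ k = 0) : HoldsList (signedEdgesAt C k) (s.setReg 5 k) := by
  have h2 := hs.2.1 2 (by norm_num)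
  have h3 := hs.2.1 3 (by norm_num)
  have h4 := hs.2.1 4 (by norm_num)
  rcases hk with hk | ⟨rfl, rfl⟩
  · obtain ⟨A, B, hAB, hA⟩ := allSignedEdges_drop (C := C) k hk
    simp only [signedEdgesAt, dif_pos hk]
    refine ⟨?_, ?_, ?_⟩
    · intro p hp
      rw [signedEdges, List.mem_map] at hp
      obtain ⟨e, he, rfl⟩ := hp
      rcases hC ⟨k, hk⟩ e with h | h
      · simp [h] at he
      · exact h
    · simp only [State.setReg_arr, State.setReg_reg, if_true, h2]
      simp only [input]
      rw [if_pos (by omega), if_pos (by omega), offset_succ k hk]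
    · intro i hi
      have hlen : offset C k + i < (allSignedEdges C).length := by
        rw [hAB]; simp [hA]; omega
      have hget : (allSignedEdges C)[offset C k + i] = (signedEdges C ⟨k, hk⟩)[i] := by
        have : (A ++ signedEdges C ⟨k, hk⟩ ++ B)[offset C k + i]'(by rw [← hAB]; exact hlen) =
            (signedEdges C ⟨k, hk⟩)[i] := by
          rw [List.getElem_append_left (by simp [hA, hi]), List.getElem_append_right (by omega)]
          simp [hA]
        rw [← this]
        congr 1
      simp only [State.setReg_arr, State.setReg_reg, if_true, h2, h3, h4]
      simp only [input]
      rw [if_pos (by omega), dif_pos hlen, dif_pos hlen, hget]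
      exact ⟨rfl, rfl⟩
  · refine ⟨by simp [signedEdgesAt], ?_, by simp [signedEdgesAt]⟩
    simp [h2, input, signedEdgesAt, offset]

end Lists

theorem uniformBelow_succ (t : ℕ) :
    uniformBelow (t + 1) = (PMF.uniformOfFintype (Fin (t + 1))).map Fin.val :=
  PMF.map_id _

theorem mem_support_uniformBelow {t v : ℕ} (h : v ∈ (uniformBelow t).support) :
    v < t ∨ t = 0 ∧ v = 0 := by
  cases t with
  | zero => right; simpa [uniformBelow] using h
  | succ t =>
    left
    rw [uniformBelow_succ, PMF.mem_support_map_iff] at h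
    obtain ⟨_, _, rfl⟩ := h
    exact Fin.is_lt _

theorem mem_support_heatBath {W : ℕ → ℝ} {q t : ℕ} (hq : 0 < q)
    (h : t ∈ (heatBath W q).support) : t < q := by
  suffices H : ∀ k, ∀ t ∈ (iterKer (reservoir W) 0 k 0).support, t < k ∨ t = 0 by
    rcases H q t h with h | h <;> omega
  intro k
  induction k with
  | zero => intro t ht; right; simpa [iterKer] using ht
  | succ k ih =>
    intro t ht
    rw [iterKer_succ', PMF.mem_support_bind_iff] at ht
    obtain ⟨c, hc, ht⟩ := ht
    rw [reservoir, PMF.mem_support_map_iff] at ht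
    obtain ⟨b, _, rfl⟩ := ht
    have := ih c hc
    simp only [zero_add]
    split_ifs <;> omega

/-! ### Simulation of a transition, of a sample and of the estimate of a ratio -/

section Simulation

variable {n m r q : ℕ} [NeZero q] {G : Multigraph n m} {C : Fin r → Fin m → ℤ} {w ε y : ℝ}
  {F : Finset (Fin m)} {ℓ : ℕ} {s : State}

/-- The memory stores only the flow. The coefficients exist only in the abstract chain, which is
possible because the law of the increment depends on them only through `flow C c`. The time is made
up of 11 units per edge for weighing and 15 for updating, and of 5 and 10 units per value for
initialising and choosing. -/
theorem sim_chainStep (hC : ∀ k e, C k e = 0 ∨ C k e = 1 ∨ C k e = -1)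
    (hℓ : ∀ k, (edges C k).card ≤ ℓ) {c : Fin r → ZMod q}
    (hs : Keeps 3 5 2 (input G C w ε) s) (hy : s.rreg 2 = y) (hF : HoldsSet F s)
    (hf : HoldsFlow (flow C c) s) :
    Sim (chainStep q) s (26 * ℓ + 15 * q + 21) (chainKer y F C c) fun c' s' =>
      Keeps 5 7 7 s s' ∧ HoldsFlow (flow C c') s' := by
  have hr : NExpr.eval s (.reg 2) = r := by
    simpa [input] using hs.1 2 (by norm_num)
  have hu := Sim.unif (i := 5) (x := .reg 2) (s := s)
    (R := fun v s' => s' = s.setReg 5 v) fun v => rfl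
  rw [hr] at hu
  refine (Sim.seq (T' := 26 * ℓ + 15 * q + 19) hu fun k hk s1 hs1 => ?_).mono (by omega)
  subst hs1
  have hL := holdsList_input hs hC (mem_support_uniformBelow hk)
  have hlen : (signedEdgesAt C k).length ≤ ℓ := by
    unfold signedEdgesAt
    split_ifs with h
    · rw [length_signedEdges]; exact hℓ _
    · simp
  have keep1 : Keeps 5 7 7 s (s.setReg 5 k) := (Keeps.refl _ _ _ _).setReg le_rfl
  have key : Sim (.seq (initWeights q) (.seq (computeWeights q) (.seq (chooseValue q)
      (updateFlow q)))) (s.setReg 5 k) (26 * ℓ + 15 * q + 19)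
      (heatBath (fun t => listWeight y F (signedEdgesAt C k) (flow C c) (t : ZMod q)) q)
      fun t s' => Keeps 5 7 7 s s' ∧ HoldsFlow (flow C (bump c k (t : ZMod q))) s' := by
    refine (Sim.seq_det (sim_initWeights q _) (T' := 26 * ℓ + 10 * q + 15) ?_).mono (by omega)
    rintro s2 ⟨hk2, hW2⟩
    have flow_of : ∀ {s' : State}, Keeps 6 8 7 (s.setReg 5 k) s' → HoldsFlow (flow C c) s' := by
      intro s' hk' e
      rw [hk'.2.1 7 (by norm_num)]
      exact hf e
    have hF2 : HoldsSet F s2 := by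
      intro e
      rw [hk2.2.1 6 (by norm_num)]
      exact hF e
    have hy2 : s2.rreg 2 = y := by rw [hk2.2.2 2 (by norm_num)]; exact hy
    refine (Sim.seq_det (T' := 15 * ℓ + 10 * q + 11) (sim_computeWeights (flow_of hk2) hF2
      (hL.keeps (hk2.mono le_rfl (by norm_num) le_rfl)) hy2 hW2) ?_).mono (by omega)
    rintro s3 ⟨hk3, hW3⟩
    have hk3' := hk2.trans hk3
    refine (Sim.then_det (T' := 15 * ℓ + 3) (sim_chooseValue q hW3) ?_).mono (by omega)
    rintro t ht s4 ⟨hk4, h9⟩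
    have hk4' := hk3'.trans hk4
    have htq := mem_support_heatBath (Nat.pos_of_ne_zero (NeZero.ne q)) ht
    have hup := ((sim_updateFlow (f := flow C c) htq.le (flow_of hk4')
      (hL.keeps (hk4'.mono le_rfl (by norm_num) le_rfl)) h9).mono
      (T' := 15 * ℓ + 3) (by omega)).map (fun _ => t)
      (R' := fun (t : ℕ) s' => Keeps 5 7 7 s s' ∧ HoldsFlow (flow C (bump c k (t : ZMod q))) s') ?_
    · rwa [PMF.pure_map] at hup
    · rintro _ s5 ⟨hk5, hf5⟩
      refine ⟨keep1.trans ((hk4'.mono (by norm_num) (by norm_num) le_rfl).trans hk5), ?_⟩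
      rw [flow_bump]
      exact hf5
  exact key.map (R' := fun c' s' => Keeps 5 7 7 s s' ∧ HoldsFlow (flow C c') s')
    (fun t : ℕ => bump c k (t : ZMod q)) fun t s' h => h

/-- Run the chain, started at the zero flow, until its distribution is close to equilibrium. -/
def sampleFlow (q D B : ℕ) : Prog :=
  .seq (.act (.set 6 (.lit 0))) <|
  .seq (.loop (.nlt (.reg 6) (.reg 1)) (.seq (.act (.write 7 (.reg 6) (.lit 0))) (incr 6))) <|
  .seq (.act (.rset 6 (.nat (.lit 1)))) <|
  .loop (.rlt (.div (.reg 0) (.mul (.nat (.lit B)) (.mul (.nat (.add (.reg 0) (.lit 1)))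
      (.nat (.add (.reg 2) (.lit 1)))))) (.reg 6)) <|
    .seq (chainStep q) (.act (.rset 6 (.mul (.reg 6) (.sub (.nat (.lit 1))
      (.div (.nat (.lit 1)) (.mul (.nat (.lit D)) (.nat (.add (.reg 2) (.lit 1)))))))))

/-- The rate of contraction of the chain. -/
noncomputable def rate (D r : ℕ) : ℝ := 1 - 1 / (D * (r + 1))

/-- The distribution of the chain after `N` transitions from zero. -/
noncomputable def chainDist {m r : ℕ} (q : ℕ) (y : ℝ) (F : Finset (Fin m)) (C : Fin r → Fin m → ℤ)
    (N : ℕ) : PMF (Fin r → ZMod q) :=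
  iterKer (fun _ => chainKer y F C) 0 N (0 : Fin r → ZMod q)

/-- No logarithm is computed: the current power of `rate D r` is kept in a real register and
compared with the accuracy. By `hN` and `hN'` the comparison first fails after exactly `N` rounds.
-/
theorem sim_sampleFlow (hC : ∀ k e, C k e = 0 ∨ C k e = 1 ∨ C k e = -1)
    (hℓ : ∀ k, (edges C k).card ≤ ℓ) {D B N : ℕ}
    (hN : ∀ i < N, ε / (B * ((n + 1) * (r + 1))) < rate D r ^ i)
    (hN' : rate D r ^ N ≤ ε / (B * ((n + 1) * (r + 1))))
    (hs : Keeps 3 5 2 (input G C w ε) s) (hy : s.rreg 2 = y) (hF : HoldsSet F s) :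
    Sim (sampleFlow q D B) s (4 * m + N * (26 * ℓ + 15 * q + 24) + 7) (chainDist q y F C N)
      fun c s' => Keeps 5 7 6 s s' ∧ HoldsFlow (flow C c) s' := by
  have hreset := Sim.loop_det (b := .nlt (.reg 6) (.reg 1))
    (P := .seq (.act (.write 7 (.reg 6) (.lit 0))) (incr 6)) (T := 3) m
    (fun i s' => Keeps 5 7 6 s s' ∧ s'.reg 6 = i ∧ ∀ j < i, s'.arr 7 j = 0) ?_ ?_
    (s.setReg 6 0) ⟨(Keeps.refl _ _ _ _).setReg (by norm_num), by simp, by simp⟩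
  · refine (Sim.set_seq (Sim.seq_det (T' := N * (26 * ℓ + 15 * q + 24) + 3) hreset ?_)).mono
      (by omega)
    rintro s1 ⟨hk1, -, h7⟩
    refine Sim.rset_seq (T := N * (26 * ℓ + 15 * q + 24) + 1) ?_
    have hloop := Sim.loop (b := .rlt (.div (.reg 0) (.mul (.nat (.lit B))
        (.mul (.nat (.add (.reg 0) (.lit 1))) (.nat (.add (.reg 2) (.lit 1)))))) (.reg 6))
      (P := .seq (chainStep q) (.act (.rset 6 (.mul (.reg 6) (.sub (.nat (.lit 1))
        (.div (.nat (.lit 1)) (.mul (.nat (.lit D)) (.nat (.add (.reg 2) (.lit 1)))))))))) 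
      (T := 26 * ℓ + 15 * q + 23) N
      (fun _ => chainKer y F C)
      (fun i c s' => Keeps 5 7 6 s s' ∧ HoldsFlow (flow C c) s' ∧ s'.rreg 6 = rate D r ^ i)
      ?_ ?_ (0 : Fin r → ZMod q) (s1.setRReg 6 1) ⟨hk1.setRReg le_rfl, ?_, by simp⟩
    · refine Sim.mono ?_ le_rfl
      simpa [chainDist, add_assoc] using hloop.weaken (R' := fun c s' => Keeps 5 7 6 s s' ∧ HoldsFlow (flow C c) s')
        fun c _ s' h => ⟨h.1, h.2.1⟩
    · rintro i hi c s2 ⟨hk, hf, ha⟩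
      have hs2 : Keeps 3 5 2 (input G C w ε) s2 :=
        hs.trans (hk.mono (by norm_num) (by norm_num) (by norm_num))
      have e0 : s2.reg 0 = n := by simpa [input] using hs2.1 0 (by norm_num)
      have e2 : s2.reg 2 = r := by simpa [input] using hs2.1 2 (by norm_num)
      have er : s2.rreg 0 = ε := by simpa [input] using hs2.2.2 0 (by norm_num)
      refine ⟨by simpa [e0, e2, er, ha] using hN i hi, ?_⟩
      have hF2 : HoldsSet F s2 := by
        intro e
        rw [hk.2.1 6 (by norm_num)]
        exact hF e
      refine (Sim.then_det (T' := 1) (sim_chainStep hC hℓ hs2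
        (by rw [hk.2.2 2 (by norm_num), hy]) hF2 hf) ?_).mono (by omega)
      rintro c' - s3 ⟨hk3, hf3⟩
      refine Sim.rset ⟨(hk.trans (hk3.mono le_rfl le_rfl (by norm_num))).setRReg le_rfl, hf3, ?_⟩
      have e2' : s3.reg 2 = r := by rw [hk3.1 2 (by norm_num), e2]
      have ha' : s3.rreg 6 = rate D r ^ i := by rw [hk3.2.2 6 (by norm_num), ha]
      simp [e2', ha', pow_succ, rate]
    · rintro c s2 ⟨hk, hf, ha⟩
      have hs2 : Keeps 3 5 2 (input G C w ε) s2 :=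
        hs.trans (hk.mono (by norm_num) (by norm_num) (by norm_num))
      have e0 : s2.reg 0 = n := by simpa [input] using hs2.1 0 (by norm_num)
      have e2 : s2.reg 2 = r := by simpa [input] using hs2.1 2 (by norm_num)
      have er : s2.rreg 0 = ε := by simpa [input] using hs2.2.2 0 (by norm_num)
      simpa [e0, e2, er, ha] using hN'
    · intro e
      simpa [flow] using h7 e e.2
  · rintro i hi s1 ⟨hk, h6, h7⟩
    have e1 : s1.reg 1 = m := by
      rw [hk.1 1 (by norm_num)]; simpa [input] using hs.1 1 (by norm_num)
    refine ⟨by simp [h6, e1, hi], Sim.write_seq (Sim.set ⟨(hk.setArr le_rfl).setReg (by norm_num),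
      by simp [h6], fun j hj => ?_⟩)⟩
    by_cases h : j = i
    · simp [h, h6]
    · simp [h, h6, h7 j (by omega)]
  · rintro s1 ⟨hk, h6, h7⟩
    have e1 : s1.reg 1 = m := by
      rw [hk.1 1 (by norm_num)]; simpa [input] using hs.1 1 (by norm_num)
    simp [h6, e1]

/-- Sum up the weights of the current edge in independent samples. -/
def estimateRatio (q D B c₀ : ℕ) : Prog :=
  .seq (.act (.set 4 (.lit 0))) <|
  .seq (.act (.rset 5 (.nat (.lit 0)))) <|
  .loop (.rlt (.nat (.reg 4)) (.div (.mul (.nat (.lit c₀)) (.nat (.add (.reg 0) (.lit 1))))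
      (.mul (.reg 0) (.reg 0)))) <|
    .seq (sampleFlow q D B) <|
    .seq (.ite (.neq (.arr 7 (.reg 3)) (.lit 0)) (.act (.rset 5 (.add (.reg 5) (.reg 2))))
      (.act (.rset 5 (.add (.reg 5) (.nat (.lit 1)))))) <|
    incr 4

/-- The sum of `N` independent samples of the distribution `ν`. -/
noncomputable def sumDist (ν : PMF ℝ) (N : ℕ) : PMF ℝ :=
  iterKer (fun _ S => ν.map fun x => S + x) 0 N 0

/-- The distribution of the weight of the edge `e` in the flow after `N` transitions. -/
noncomputable def weightDist {m r : ℕ} (q : ℕ) (y : ℝ) (F : Finset (Fin m))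
    (C : Fin r → Fin m → ℤ) (e : Fin m) (N : ℕ) : PMF ℝ :=
  (chainDist q y F C N).map fun c : Fin r → ZMod q => if flow C c e = 0 then y else 1

theorem sim_estimateRatio (hC : ∀ k e, C k e = 0 ∨ C k e = 1 ∨ C k e = -1)
    (hℓ : ∀ k, (edges C k).card ≤ ℓ) {D B c₀ N M : ℕ} {e : Fin m}
    (hN : ∀ i < N, ε / (B * ((n + 1) * (r + 1))) < rate D r ^ i)
    (hN' : rate D r ^ N ≤ ε / (B * ((n + 1) * (r + 1))))
    (hM : ∀ i < M, (i : ℝ) < c₀ * (n + 1) / (ε * ε)) (hM' : c₀ * (n + 1) / (ε * ε) ≤ M)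
    (hs : Keeps 3 5 2 (input G C w ε) s) (hy : s.rreg 2 = y) (hF : HoldsSet F s)
    (h3 : s.reg 3 = e) :
    Sim (estimateRatio q D B c₀) s
      (M * (4 * m + N * (26 * ℓ + 15 * q + 24) + 13) + 5)
      (sumDist (weightDist q y F C e N) M)
      fun S s' => Keeps 4 7 5 s s' ∧ s'.rreg 5 = S ∧ s'.reg 4 = M := by
  have hloop := Sim.loop (b := .rlt (.nat (.reg 4)) (.div (.mul (.nat (.lit c₀))
      (.nat (.add (.reg 0) (.lit 1)))) (.mul (.reg 0) (.reg 0))))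
    (P := .seq (sampleFlow q D B) <|
      .seq (.ite (.neq (.arr 7 (.reg 3)) (.lit 0)) (.act (.rset 5 (.add (.reg 5) (.reg 2))))
        (.act (.rset 5 (.add (.reg 5) (.nat (.lit 1)))))) <| incr 4)
    (T := 4 * m + N * (26 * ℓ + 15 * q + 24) + 12) M
    (fun _ S => (weightDist q y F C e N).map fun x => S + x)
    (fun i S s' => Keeps 4 7 5 s s' ∧ s'.rreg 5 = S ∧ s'.reg 4 = i)
    ?_ ?_ 0 ((s.setReg 4 0).setRReg 5 0)
    ⟨((Keeps.refl _ _ _ _).setReg le_rfl).setRReg le_rfl, by simp, by simp⟩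
  · refine (Sim.set_seq (Sim.rset_seq (T := M * (4 * m + N * (26 * ℓ + 15 * q + 24) + 13) + 1)
      ?_))
    simpa [sumDist] using hloop
  · rintro i hi S s1 ⟨hk, h5, h4⟩
    have hs1 : Keeps 3 5 2 (input G C w ε) s1 :=
      hs.trans (hk.mono (by norm_num) (by norm_num) (by norm_num))
    have e0 : s1.reg 0 = n := by simpa [input] using hs1.1 0 (by norm_num)
    have er : s1.rreg 0 = ε := by simpa [input] using hs1.2.2 0 (by norm_num)
    refine ⟨by simpa [h4, e0, er] using hM i hi, ?_⟩
    have hF1 : HoldsSet F s1 := by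
      intro e
      rw [hk.2.1 6 (by norm_num)]
      exact hF e
    have hy1 : s1.rreg 2 = y := by rw [hk.2.2 2 (by norm_num), hy]
    have hsum := Sim.seq (Q := .seq (.ite (.neq (.arr 7 (.reg 3)) (.lit 0))
        (.act (.rset 5 (.add (.reg 5) (.reg 2))))
        (.act (.rset 5 (.add (.reg 5) (.nat (.lit 1)))))) (incr 4)) (T' := 4)
      (κ := fun c : Fin r → ZMod q => PMF.pure (S + if flow C c e = 0 then y else 1))
      (R' := fun S s' => Keeps 4 7 5 s s' ∧ s'.rreg 5 = S ∧ s'.reg 4 = i + 1)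
      (sim_sampleFlow hC hℓ hN hN' hs1 hy1 hF1) ?_
    · rw [weightDist, PMF.map_comp]
      exact hsum.mono (by omega)
    · rintro c - s2 ⟨hk2, hf2⟩
      have e3 : s2.reg 3 = e := by
        rw [hk2.1 3 (by norm_num), hk.1 3 (by norm_num), h3]
      have hv : s2.arr 7 (s2.reg 3) = (flow C c e).val := by rw [e3]; exact hf2 e
      have hk2' : Keeps 4 7 5 s s2 := hk.trans (hk2.mono (by norm_num) le_rfl (by norm_num))
      have e5 : s2.rreg 5 = S := by rw [hk2.2.2 5 (by norm_num), h5]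
      have ey : s2.rreg 2 = y := by rw [hk2.2.2 2 (by norm_num), hy1]
      have e4 : s2.reg 4 = i := by rw [hk2.1 4 (by norm_num), h4]
      refine Sim.seq_det (T := 2) (T' := 1) (I := fun s3 => Keeps 4 7 5 s s3 ∧
        s3.rreg 5 = S + (if flow C c e = 0 then y else 1) ∧ s3.reg 4 = i) (Sim.ite ?_ ?_) ?_
      · intro hb
        have : flow C c e = 0 := by simpa [hv] using hb
        exact Sim.rset ⟨hk2'.setRReg le_rfl, by simp [e5, ey, this], by simp [e4]⟩
      · intro hb
        have : flow C c e ≠ 0 := by simpa [hv] using hb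
        exact Sim.rset ⟨hk2'.setRReg le_rfl, by simp [e5, this], by simp [e4]⟩
      · rintro s3 ⟨hk3, h5, h4⟩
        exact Sim.set ⟨hk3.setReg le_rfl, by simp [h5], by simp [h4]⟩
  · rintro S s1 ⟨hk, h5, h4⟩
    have hs1 : Keeps 3 5 2 (input G C w ε) s1 :=
      hs.trans (hk.mono (by norm_num) (by norm_num) (by norm_num))
    have e0 : s1.reg 0 = n := by simpa [input] using hs1.1 0 (by norm_num)
    have er : s1.rreg 0 = ε := by simpa [input] using hs1.2.2 0 (by norm_num)
    simpa [h4, e0, er] using hM'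

end Simulation

end PottsFlow

namespace PottsFlow

/-! ## Expectations -/

/-- The expectation of a nonnegative function. -/
noncomputable def expect {α : Type*} (μ : PMF α) (g : α → ℝ≥0∞) : ℝ≥0∞ := ∑' a, μ a * g a

section Expect

variable {α β : Type*}

theorem expect_pure (a : α) (g : α → ℝ≥0∞) : expect (PMF.pure a) g = g a := by
  classical
  rw [expect, tsum_eq_single a]
  · simp
  · intro b hb
    simp [PMF.pure_apply, hb]

theorem expect_bind (μ : PMF α) (κ : α → PMF β) (g : β → ℝ≥0∞) :
    expect (μ.bind κ) g = expect μ fun a => expect (κ a) g := by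
  simp only [expect, PMF.bind_apply, ← ENNReal.tsum_mul_right, ← ENNReal.tsum_mul_left]
  rw [ENNReal.tsum_comm]
  simp only [mul_assoc]

theorem expect_map (μ : PMF α) (f : α → β) (g : β → ℝ≥0∞) :
    expect (μ.map f) g = expect μ fun a => g (f a) := by
  rw [PMF.map, expect_bind]
  simp [expect_pure]

theorem expect_congr {μ : PMF α} {g h : α → ℝ≥0∞} (H : ∀ a ∈ μ.support, g a = h a) :
    expect μ g = expect μ h := by
  refine tsum_congr fun a => ?_
  by_cases ha : μ a = 0
  · simp [ha]
  · rw [H a ((PMF.mem_support_iff _ _).2 ha)]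

theorem expect_mono {μ : PMF α} {g h : α → ℝ≥0∞} (H : ∀ a ∈ μ.support, g a ≤ h a) :
    expect μ g ≤ expect μ h := by
  refine ENNReal.tsum_le_tsum fun a => ?_
  by_cases ha : μ a = 0
  · simp [ha]
  · gcongr
    exact H a ((PMF.mem_support_iff _ _).2 ha)

theorem expect_add (μ : PMF α) (g h : α → ℝ≥0∞) :
    expect μ (fun a => g a + h a) = expect μ g + expect μ h := by
  simp only [expect, mul_add, ENNReal.tsum_add]

theorem expect_const_mul (μ : PMF α) (x : ℝ≥0∞) (g : α → ℝ≥0∞) :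
    expect μ (fun a => x * g a) = x * expect μ g := by
  simp only [expect, ← ENNReal.tsum_mul_left, mul_left_comm x]

theorem expect_const (μ : PMF α) (x : ℝ≥0∞) : expect μ (fun _ => x) = x := by
  simp [expect, ENNReal.tsum_mul_right, μ.tsum_coe]

theorem expect_coinFlip {p : ℝ} (hp : 0 ≤ p) (hp' : p ≤ 1) (g : ℕ → ℝ≥0∞) :
    expect (coinFlip p) g = ENNReal.ofReal p * g 1 + ENNReal.ofReal (1 - p) * g 0 := by
  rw [coinFlip, expect_map, expect, tsum_fintype]
  have h1 : ENNReal.ofReal p ≤ 1 := by simpa using hp'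
  rw [ENNReal.ofReal_sub 1 hp]
  simp [PMF.ofFintype_apply, min_eq_left h1]

theorem expect_uniformBelow (t : ℕ) (g : ℕ → ℝ≥0∞) :
    expect (uniformBelow (t + 1)) g = (∑ i : Fin (t + 1), g i) / ((t + 1 : ℕ) : ℝ≥0∞) := by
  rw [uniformBelow_succ, expect_map, expect, tsum_fintype]
  simp [PMF.uniformOfFintype_apply, ENNReal.div_eq_inv_mul, Finset.mul_sum]

/-- Reservoir sampling: after each round the current value is distributed proportionally to the
weights seen so far. A new value enters with its share of the new total, and the older ones are
scaled down by the complementary factor. In the first round the bias is 1, so the initial value is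
irrelevant. -/
theorem expect_reservoir {W : ℕ → ℝ} {g : ℕ → ℝ} (hW : ∀ t, 0 < W t) (hg : ∀ t, 0 ≤ g t)
    (k : ℕ) : expect (iterKer (reservoir W) 0 (k + 1) 0) (fun t => ENNReal.ofReal (g t)) =
      ENNReal.ofReal ((∑ t ∈ Finset.range (k + 1), W t * g t) /
        ∑ t ∈ Finset.range (k + 1), W t) := by
  have hpos : ∀ k, 0 < ∑ t ∈ Finset.range (k + 1), W t := fun k =>
    Finset.sum_pos (fun t _ => hW t) (by simp)
  have hstep : ∀ i c, expect (reservoir W i c) (fun t => ENNReal.ofReal (g t)) =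
      ENNReal.ofReal (W i / ∑ j ∈ Finset.range (i + 1), W j) * ENNReal.ofReal (g i) +
      ENNReal.ofReal (1 - W i / ∑ j ∈ Finset.range (i + 1), W j) * ENNReal.ofReal (g c) := by
    intro i c
    have hle : W i / ∑ j ∈ Finset.range (i + 1), W j ≤ 1 := by
      rw [div_le_one (hpos i)]
      exact Finset.single_le_sum (f := W) (fun t _ => (hW t).le) (by simp)
    rw [reservoir, expect_map, expect_coinFlip (by have := hW i; have := hpos i; positivity) hle]
    simp
  induction k with
  | zero =>
    rw [iterKer_succ']
    simp only [iterKer, PMF.pure_bind, hstep]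
    have := (hW 0).ne'
    simp [this]
  | succ k ih =>
    rw [iterKer_succ', expect_bind]
    simp only [hstep, zero_add]
    rw [expect_add, expect_const, expect_const_mul, ih]
    have h1 := hpos k
    have h2 := hpos (k + 1)
    have h3 : ∑ t ∈ Finset.range (k + 1 + 1), W t =
      ∑ t ∈ Finset.range (k + 1), W t + W (k + 1) := Finset.sum_range_succ _ _
    have h4 : 1 - W (k + 1) / ∑ j ∈ Finset.range (k + 1 + 1), W j =
        (∑ t ∈ Finset.range (k + 1), W t) / ∑ j ∈ Finset.range (k + 1 + 1), W j := by
      rw [eq_div_iff h2.ne', sub_mul, div_mul_cancel₀ _ h2.ne', h3]; ring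
    have h5 : 0 ≤ ∑ t ∈ Finset.range (k + 1), W t * g t :=
      Finset.sum_nonneg fun t _ => mul_nonneg (hW t).le (hg t)
    have hWk := hW (k + 1)
    have hgk := hg (k + 1)
    rw [h4, ← ENNReal.ofReal_mul (by positivity), ← ENNReal.ofReal_mul (by positivity),
      ← ENNReal.ofReal_add (by positivity) (by positivity),
      Finset.sum_range_succ (fun t => W t * g t) (k + 1)]
    congr 1
    field_simp
    ring

theorem sum_range_zmod {q : ℕ} [NeZero q] {M : Type*} [AddCommMonoid M] (g : ZMod q → M) :
    ∑ t ∈ Finset.range q, g (t : ZMod q) = ∑ t : ZMod q, g t := by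
  refine Finset.sum_bij (fun t _ => (t : ZMod q)) (fun _ _ => Finset.mem_univ _) ?_ ?_
    fun _ _ => rfl
  · intro a ha b hb h
    rw [ZMod.natCast_eq_natCast_iff', Nat.mod_eq_of_lt (by simpa using ha),
      Nat.mod_eq_of_lt (by simpa using hb)] at h
    exact h
  · intro b _
    exact ⟨b.val, by simpa using ZMod.val_lt b, by simp⟩

theorem expect_heatBath {q : ℕ} [NeZero q] {W g : ZMod q → ℝ} (hW : ∀ t, 0 < W t)
    (hg : ∀ t, 0 ≤ g t) :
    expect (heatBath (fun t => W (t : ZMod q)) q) (fun t => ENNReal.ofReal (g (t : ZMod q))) =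
      ENNReal.ofReal ((∑ t, W t * g t) / ∑ t, W t) := by
  obtain ⟨k, rfl⟩ : ∃ k, q = k + 1 := ⟨q - 1, by have := NeZero.pos q; omega⟩
  rw [heatBath, expect_reservoir (g := fun t => g (t : ZMod (k + 1))) (fun t => hW _)
    (fun t => hg _), sum_range_zmod, sum_range_zmod fun t => W t * g t]

end Expect

/-! ## The transition operator -/

section Operator

variable {m r q : ℕ} {y : ℝ} {F : Finset (Fin m)} {C : Fin r → Fin m → ℤ}

theorem one_le_edgeWeight (hy : 1 ≤ y) (e : Fin m) (a : ZMod q) : 1 ≤ edgeWeight y F e a := by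
  unfold edgeWeight; split_ifs <;> simp [hy]

theorem edgeWeight_le (hy : 1 ≤ y) (e : Fin m) (a : ZMod q) : edgeWeight y F e a ≤ y := by
  unfold edgeWeight; split_ifs <;> simp [hy]

theorem edgeWeight_pos (hy : 1 ≤ y) (e : Fin m) (a : ZMod q) : 0 < edgeWeight y F e a :=
  one_pos.trans_le (one_le_edgeWeight hy e a)

/-- Coefficients are changed one at a time; the Hamming diameter is r. -/
theorem abs_sub_le_of_lipschitz {L : ℝ} {h : (Fin r → ZMod q) → ℝ}
    (hL : ∀ c k t, |h (c + Pi.single k t) - h c| ≤ L) (c c' : Fin r → ZMod q) :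
    |h c' - h c| ≤ r * L := by
  have key : ∀ S : Finset (Fin r),
      |h (c + ∑ k ∈ S, Pi.single k ((c' - c) k)) - h c| ≤ S.card * L := by
    intro S
    induction S using Finset.induction_on with
    | empty => simp
    | insert k S hk ih =>
      rw [Finset.sum_insert hk, add_comm (Pi.single k _), ← add_assoc,
        Finset.card_insert_of_notMem hk]
      have h1 := hL (c + ∑ k ∈ S, Pi.single k ((c' - c) k)) k ((c' - c) k)
      have h2 := abs_sub_le (h (c + ∑ k ∈ S, Pi.single k ((c' - c) k) +
        Pi.single k ((c' - c) k))) (h (c + ∑ k ∈ S, Pi.single k ((c' - c) k))) (h c)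
      push_cast
      linarith
  have := key Finset.univ
  rw [Finset.univ_sum_single] at this
  simpa using this

theorem localWeight_pos (hy : 1 ≤ y) (f : Fin m → ZMod q) (k : Fin r) (t : ZMod q) :
    0 < localWeight y F C f k t :=
  Finset.prod_pos fun _ _ => edgeWeight_pos hy _ _

/-- Edge weights lie in [1, y], and only an edge common to both subgraphs can change its weight, by
a factor of at most y. -/
theorem localWeight_le_mul (hy : 1 ≤ y) {j k : Fin r} {c c' : Fin r → ZMod q}
    (hc : ∀ e ∉ edges C k, flow C c' e = flow C c e) (t : ZMod q) :
    y⁻¹ ^ (edges C k ∩ edges C j).card * localWeight y F C (flow C c) j t ≤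
      localWeight y F C (flow C c') j t := by
  have : y⁻¹ ^ (edges C k ∩ edges C j).card =
      ∏ e ∈ edges C j, if e ∈ edges C k then y⁻¹ else 1 := by
    rw [Finset.prod_ite, Finset.prod_const_one, mul_one, Finset.prod_const,
      Finset.inter_comm, Finset.filter_mem_eq_inter]
  have y0 : 0 < y := by linarith
  rw [this, localWeight, ← Finset.prod_mul_distrib]
  refine Finset.prod_le_prod (fun e _ => ?_) fun e _ => ?_
  · have := edgeWeight_pos (F := F) hy e (flow C c e + t * (C j e : ZMod q))
    split_ifs <;> positivity
  · split_ifs with he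
    · rw [inv_mul_le_iff₀ y0]
      have h1 := edgeWeight_le (F := F) hy e (flow C c e + t * (C j e : ZMod q))
      have h2 := one_le_edgeWeight (F := F) hy e (flow C c' e + t * (C j e : ZMod q))
      nlinarith
    · rw [one_mul, hc e he]

/-- The weight of the flow with coefficients `c`. -/
noncomputable def flowWeight (y : ℝ) (F : Finset (Fin m)) (C : Fin r → Fin m → ℤ)
    (c : Fin r → ZMod q) : ℝ :=
  ∏ e, edgeWeight y F e (flow C c e)

theorem flowWeight_pos (hy : 1 ≤ y) (c : Fin r → ZMod q) : 0 < flowWeight y F C c :=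
  Finset.prod_pos fun _ _ => edgeWeight_pos hy _ _

variable [NeZero q]

/-- The expectation of `h` after resampling the coefficient `k`. -/
noncomputable def siteOp (y : ℝ) (F : Finset (Fin m)) (C : Fin r → Fin m → ℤ) (k : Fin r)
    (h : (Fin r → ZMod q) → ℝ) (c : Fin r → ZMod q) : ℝ :=
  (∑ t, localWeight y F C (flow C c) k t * h (c + Pi.single k t)) /
    ∑ t, localWeight y F C (flow C c) k t

/-- The expectation of `h` after one transition. -/
noncomputable def chainOp (y : ℝ) (F : Finset (Fin m)) (C : Fin r → Fin m → ℤ)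
    (h : (Fin r → ZMod q) → ℝ) (c : Fin r → ZMod q) : ℝ :=
  if r = 0 then h c else (∑ k, siteOp y F C k h c) / r

theorem sum_localWeight_pos (hy : 1 ≤ y) (f : Fin m → ZMod q) (k : Fin r) :
    0 < ∑ t, localWeight y F C f k t :=
  Finset.sum_pos (fun t _ => localWeight_pos hy f k t) Finset.univ_nonempty

theorem siteOp_nonneg (hy : 1 ≤ y) {h : (Fin r → ZMod q) → ℝ} (hh : ∀ c, 0 ≤ h c) (k : Fin r)
    (c : Fin r → ZMod q) : 0 ≤ siteOp y F C k h c :=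
  div_nonneg (Finset.sum_nonneg fun t _ => mul_nonneg (localWeight_pos hy _ k t).le (hh _))
    (sum_localWeight_pos hy _ k).le

theorem chainOp_nonneg (hy : 1 ≤ y) {h : (Fin r → ZMod q) → ℝ} (hh : ∀ c, 0 ≤ h c)
    (c : Fin r → ZMod q) : 0 ≤ chainOp y F C h c := by
  unfold chainOp
  split_ifs
  · exact hh c
  · exact div_nonneg (Finset.sum_nonneg fun k _ => siteOp_nonneg hy hh k c) (Nat.cast_nonneg _)

theorem expect_chainKer (hy : 1 ≤ y) {h : (Fin r → ZMod q) → ℝ} (hh : ∀ c, 0 ≤ h c)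
    (c : Fin r → ZMod q) :
    expect (chainKer y F C c) (fun c => ENNReal.ofReal (h c)) =
      ENNReal.ofReal (chainOp y F C h c) := by
  rw [chainKer, expect_bind]
  simp only [expect_map]
  rcases Nat.eq_zero_or_pos r with rfl | hr
  · simp [uniformBelow, bump, chainOp, expect_const]
  · obtain ⟨k, rfl⟩ : ∃ k, r = k + 1 := ⟨r - 1, by omega⟩
    rw [expect_uniformBelow, chainOp, if_neg (by omega), ENNReal.ofReal_div_of_pos (by positivity),
      ENNReal.ofReal_sum_of_nonneg fun k _ => siteOp_nonneg hy hh k c, ENNReal.ofReal_natCast]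
    congr 1
    refine Finset.sum_congr rfl fun i _ => ?_
    simp only [bump, signedEdgesAt, dif_pos i.2, listWeight_signedEdges]
    exact expect_heatBath (W := localWeight y F C (flow C c) i)
      (g := fun t => h (c + Pi.single i t)) (fun t => localWeight_pos hy _ _ t) fun t => hh _

/-- Kernels act on measures and operators on functions, so the last transition of the chain is the
first application of `chainOp`. -/
theorem expect_chainDist (hy : 1 ≤ y) (N : ℕ) {h : (Fin r → ZMod q) → ℝ} (hh : ∀ c, 0 ≤ h c) :
    expect (chainDist q y F C N) (fun c => ENNReal.ofReal (h c)) =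
      ENNReal.ofReal ((chainOp y F C)^[N] h 0) := by
  unfold chainDist
  induction N generalizing h with
  | zero => simp [iterKer, expect_pure]
  | succ N ih =>
    rw [iterKer_succ', expect_bind, Function.iterate_succ_apply]
    simp only [expect_chainKer hy hh]
    exact ih (chainOp_nonneg hy hh)

/-! ## Contraction -/

/-- The constant bounds the total variation distance of the two normalised weights. Although their
densities may differ by a factor z², because the normalisations differ too, the distance is at most
(1 - z)/(1 + z). -/
theorem weighted_average_sub_le {α : Type*} [Fintype α] [Nonempty α] {u v h : α → ℝ} {z L : ℝ}
    (hu : ∀ a, 0 < u a) (hv : ∀ a, 0 < v a) (hz : 0 < z) (hz1 : z ≤ 1)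
    (huv : ∀ a, z * u a ≤ v a) (hvu : ∀ a, z * v a ≤ u a) (hh : ∀ a b, |h a - h b| ≤ L) :
    (∑ a, u a * h a) / ∑ a, u a - (∑ a, v a * h a) / ∑ a, v a ≤ (1 - z) / (1 + z) * L := by
  classical
  obtain ⟨a₀, -, ha₀⟩ := Finset.exists_min_image Finset.univ h Finset.univ_nonempty
  have hU : 0 < ∑ a, u a := Finset.sum_pos (fun a _ => hu a) Finset.univ_nonempty
  have hV : 0 < ∑ a, v a := Finset.sum_pos (fun a _ => hv a) Finset.univ_nonempty
  have hL : 0 ≤ L := (abs_nonneg _).trans (hh a₀ a₀)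
  set U := ∑ a, u a
  set V := ∑ a, v a
  -- Both normalised weights have total 1, so the minimum of h can be subtracted. Then h - h(a₀)
  -- lies in [0, L], and only the set where the first density is larger contributes positively.
  have h1 : (∑ a, u a * h a) / U - (∑ a, v a * h a) / V =
      ∑ a, (u a / U - v a / V) * (h a - h a₀) := by
    have e1 : ∑ a, u a / U = 1 := by rw [← Finset.sum_div, div_self hU.ne']
    have e2 : ∑ a, v a / V = 1 := by rw [← Finset.sum_div, div_self hV.ne']
    have : ∑ a, (u a / U - v a / V) * (h a - h a₀) =
        ∑ a, (u a * h a) / U - ∑ a, (v a * h a) / V -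
          (∑ a, u a / U - ∑ a, v a / V) * h a₀ := by
      rw [sub_mul, Finset.sum_mul, Finset.sum_mul, ← Finset.sum_sub_distrib,
        ← Finset.sum_sub_distrib, ← Finset.sum_sub_distrib]
      exact Finset.sum_congr rfl fun a _ => by ring
    rw [this, e1, e2, Finset.sum_div, Finset.sum_div]
    ring
  set A := Finset.univ.filter fun a => v a / V < u a / U with hA
  have h2 : ∑ a, (u a / U - v a / V) * (h a - h a₀) ≤ ∑ a ∈ A, (u a / U - v a / V) * L := by
    rw [← Finset.sum_filter_add_sum_filter_not Finset.univ fun a => v a / V < u a / U]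
    have : ∑ a ∈ Finset.univ.filter (fun a => ¬ v a / V < u a / U),
        (u a / U - v a / V) * (h a - h a₀) ≤ 0 := by
      refine Finset.sum_nonpos fun a ha => mul_nonpos_of_nonpos_of_nonneg ?_ ?_
      · have := (Finset.mem_filter.1 ha).2
        linarith
      · linarith [ha₀ a (Finset.mem_univ a)]
    have h3 : ∑ a ∈ A, (u a / U - v a / V) * (h a - h a₀) ≤ ∑ a ∈ A, (u a / U - v a / V) * L := by
      refine Finset.sum_le_sum fun a ha => mul_le_mul_of_nonneg_left ?_ ?_
      · exact (le_abs_self _).trans (hh a a₀)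
      · have := (Finset.mem_filter.1 ha).2
        linarith
    linarith
  rw [h1]
  refine h2.trans ?_
  rw [← Finset.sum_mul]
  refine mul_le_mul_of_nonneg_right ?_ hL
  rw [Finset.sum_sub_distrib, ← Finset.sum_div, ← Finset.sum_div]
  set a := ∑ i ∈ A, u i
  set a' := ∑ i ∈ A, v i
  set b := ∑ i ∈ Aᶜ, u i
  set b' := ∑ i ∈ Aᶜ, v i
  have eU : U = a + b := (Finset.sum_add_sum_compl A u).symm
  have eV : V = a' + b' := (Finset.sum_add_sum_compl A v).symm
  have ha : 0 ≤ a := Finset.sum_nonneg fun i _ => (hu i).le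
  have hb' : 0 ≤ b' := Finset.sum_nonneg fun i _ => (hv i).le
  have haa : z * a ≤ a' := by rw [Finset.mul_sum]; exact Finset.sum_le_sum fun i _ => huv i
  have hbb : z * b' ≤ b := by rw [Finset.mul_sum]; exact Finset.sum_le_sum fun i _ => hvu i
  rw [eU] at hU ⊢
  rw [eV] at hV ⊢
  rw [div_sub_div _ _ hU.ne' hV.ne', div_le_div_iff₀ (mul_pos hU hV) (by linarith)]
  -- With a, b the masses of u on A and its complement, and a', b' those of v, the right side minus
  -- the left side is k1 + k2 + 2 k3 + 2 k4 + k5. All the terms vanish when a' = z a, b = z b' and a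
  -- = b'.
  have k1 := mul_nonneg (mul_nonneg (sub_nonneg.2 hz1) ha) (sub_nonneg.2 haa)
  have k2 := mul_nonneg (mul_nonneg (sub_nonneg.2 hz1) hb') (sub_nonneg.2 hbb)
  have k3 := mul_nonneg ((mul_nonneg hz.le ha).trans haa) (sub_nonneg.2 hbb)
  have k4 := mul_nonneg (mul_nonneg hz.le hb') (sub_nonneg.2 haa)
  have k5 := mul_nonneg (mul_nonneg (sub_nonneg.2 hz1) hz.le) (sq_nonneg (a - b'))
  nlinarith [k1, k2, k3, k4, k5]

theorem abs_weighted_average_sub_le {α : Type*} [Fintype α] [Nonempty α] {u v h : α → ℝ}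
    {z L : ℝ} (hu : ∀ a, 0 < u a) (hv : ∀ a, 0 < v a) (hz : 0 < z) (hz1 : z ≤ 1)
    (huv : ∀ a, z * u a ≤ v a) (hvu : ∀ a, z * v a ≤ u a) (hh : ∀ a b, |h a - h b| ≤ L) :
    |(∑ a, u a * h a) / ∑ a, u a - (∑ a, v a * h a) / ∑ a, v a| ≤ (1 - z) / (1 + z) * L := by
  rw [abs_le]
  constructor
  · linarith [weighted_average_sub_le hv hu hz hz1 hvu huv hh]
  · exact weighted_average_sub_le hu hv hz hz1 huv hvu hh

/-- The influence on each other of two even subgraphs with `i` common edges. -/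
noncomputable def influence (y : ℝ) (i : ℕ) : ℝ := (1 - y⁻¹ ^ i) / (1 + y⁻¹ ^ i)

/-- Resampling a coefficient forgets its old value: translating it merely permutes the summands.
Hence a disagreement at k disappears when k is resampled, and `siteOp` is constant along the lines
in direction k. -/
theorem siteOp_add_single_self (k : Fin r) (h : (Fin r → ZMod q) → ℝ) (c : Fin r → ZMod q)
    (a : ZMod q) : siteOp y F C k h (c + Pi.single k a) = siteOp y F C k h c := by
  have hw : ∀ t, localWeight y F C (flow C (c + Pi.single k a)) k t =
      localWeight y F C (flow C c) k (a + t) := by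
    intro t
    refine Finset.prod_congr rfl fun e _ => ?_
    rw [flow_add_single]
    congr 1
    ring
  unfold siteOp
  simp only [hw, add_assoc, ← Pi.single_add]
  congr 1
  · exact Equiv.sum_comp (Equiv.addLeft a) fun t => localWeight y F C (flow C c) k t *
      h (c + Pi.single k t)
  · exact Equiv.sum_comp (Equiv.addLeft a) fun t => localWeight y F C (flow C c) k t

/-- The comparison goes through the average of h around c with the weights of c'. The disagreement
at k that persists costs L, and the change of the weights costs the influence times L. -/
theorem abs_siteOp_sub_le (hy : 1 ≤ y) {L : ℝ} {h : (Fin r → ZMod q) → ℝ}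
    (hL : ∀ c k t, |h (c + Pi.single k t) - h c| ≤ L) (j k : Fin r)
    (c : Fin r → ZMod q) (a : ZMod q) :
    |siteOp y F C j h (c + Pi.single k a) - siteOp y F C j h c| ≤
      (1 + influence y (edges C k ∩ edges C j).card) * L := by
  set c' := c + Pi.single k a with hc'
  have y0 : 0 < y := by linarith
  have hout : ∀ e ∉ edges C k, flow C c' e = flow C c e := by
    intro e he
    have : C k e = 0 := by simpa [edges] using he
    rw [hc', flow_add_single, this]
    simp
  have hu := fun t => localWeight_pos (F := F) (C := C) hy (flow C c) j t
  have hv := fun t => localWeight_pos (F := F) (C := C) hy (flow C c') j t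
  have hV := sum_localWeight_pos (F := F) (C := C) hy (flow C c') j
  have h1 := abs_weighted_average_sub_le hv hu
    (z := y⁻¹ ^ (edges C k ∩ edges C j).card) (by positivity)
    (pow_le_one₀ (by positivity) (inv_le_one_of_one_le₀ hy))
    (localWeight_le_mul hy fun e he => (hout e he).symm) (localWeight_le_mul hy hout)
    (h := fun t => h (c + Pi.single j t)) (L := L) fun s t => by
      have := hL (c + Pi.single j t) j (s - t)
      rwa [add_assoc, ← Pi.single_add, add_sub_cancel] at this
  have h2 : |siteOp y F C j h c' - (∑ t, localWeight y F C (flow C c') j t *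
      h (c + Pi.single j t)) / ∑ t, localWeight y F C (flow C c') j t| ≤ L := by
    rw [siteOp, ← sub_div, ← Finset.sum_sub_distrib, abs_div, abs_of_pos hV, div_le_iff₀ hV,
      Finset.mul_sum]
    refine (Finset.abs_sum_le_sum_abs _ _).trans (Finset.sum_le_sum fun t _ => ?_)
    rw [← mul_sub, abs_mul, abs_of_pos (hv t), mul_comm]
    refine mul_le_mul_of_nonneg_right ?_ (hv t).le
    have := hL (c + Pi.single j t) k a
    rwa [add_right_comm] at this
  have h3 := abs_sub_le (siteOp y F C j h c') ((∑ t, localWeight y F C (flow C c') j t *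
      h (c + Pi.single j t)) / ∑ t, localWeight y F C (flow C c') j t) (siteOp y F C j h c)
  unfold influence
  refine h3.trans ?_
  rw [add_mul, one_mul]
  exact add_le_add h2 h1

/-- Among the r choices of the resampled site, k itself contributes 0 and each of the r - 1 others
contributes 1 plus its influence. The total is at most r - 1/D, and dividing by r gives the
contraction. -/
theorem abs_chainOp_sub_le (hy : 1 ≤ y) {D : ℕ}
    (hC : ∀ k : Fin r, ∑ j ∈ Finset.univ.erase k,
      influence y (edges C k ∩ edges C j).card ≤ 1 - 1 / D)
    {L : ℝ} {h : (Fin r → ZMod q) → ℝ}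
    (hL : ∀ c k t, |h (c + Pi.single k t) - h c| ≤ L) (c : Fin r → ZMod q) (k : Fin r)
    (t : ZMod q) :
    |chainOp y F C h (c + Pi.single k t) - chainOp y F C h c| ≤ rate D r * L := by
  have hr : 0 < r := k.pos
  have hr' : (0 : ℝ) < r := by exact_mod_cast hr
  have hL0 : 0 ≤ L := (abs_nonneg _).trans (hL c k t)
  unfold chainOp
  rw [if_neg hr.ne', if_neg hr.ne', ← sub_div, ← Finset.sum_sub_distrib, abs_div,
    abs_of_pos hr', div_le_iff₀ hr', ← Finset.add_sum_erase _ _ (Finset.mem_univ k),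
    siteOp_add_single_self, sub_self, zero_add]
  have h1 : |∑ j ∈ Finset.univ.erase k,
      (siteOp y F C j h (c + Pi.single k t) - siteOp y F C j h c)| ≤
      ∑ j ∈ Finset.univ.erase k, (1 + influence y (edges C k ∩ edges C j).card) * L :=
    (Finset.abs_sum_le_sum_abs _ _).trans
      (Finset.sum_le_sum fun j _ => abs_siteOp_sub_le hy hL j k c t)
  have h2 : (∑ j ∈ Finset.univ.erase k, (1 : ℝ)) = r - 1 := by
    rw [Finset.sum_const, Finset.card_erase_of_mem (Finset.mem_univ k), Finset.card_univ,
      Fintype.card_fin, nsmul_eq_mul, mul_one, Nat.cast_sub hr, Nat.cast_one]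
  rw [← Finset.sum_mul, Finset.sum_add_distrib, h2] at h1
  have h3 : (r - 1 + ∑ j ∈ Finset.univ.erase k, influence y (edges C k ∩ edges C j).card) * L ≤
      (r - 1 / D) * L := mul_le_mul_of_nonneg_right (by linarith [hC k]) hL0
  refine h1.trans (h3.trans ?_)
  rw [mul_right_comm]
  refine mul_le_mul_of_nonneg_right ?_ hL0
  unfold rate
  rw [sub_mul, one_mul]
  -- The contraction obtained is 1 - 1/(Dr); `rate` uses r + 1 so that it also makes sense for an
  -- empty generating set.
  have : 1 / (D * ((r : ℝ) + 1)) * r ≤ 1 / D := by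
    rcases Nat.eq_zero_or_pos D with rfl | hD
    · simp
    · have hD' : (0 : ℝ) < D := by exact_mod_cast hD
      rw [div_mul_eq_mul_div, one_mul, div_le_div_iff₀ (by positivity) hD']
      nlinarith
  linarith

theorem abs_chainOp_iterate_sub_le (hy : 1 ≤ y) {D : ℕ}
    (hC : ∀ k : Fin r, ∑ j ∈ Finset.univ.erase k,
      influence y (edges C k ∩ edges C j).card ≤ 1 - 1 / D)
    {L : ℝ} {h : (Fin r → ZMod q) → ℝ} (hL : ∀ c k t, |h (c + Pi.single k t) - h c| ≤ L)
    (N : ℕ) (c : Fin r → ZMod q) (k : Fin r) (t : ZMod q) :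
    |(chainOp y F C)^[N] h (c + Pi.single k t) - (chainOp y F C)^[N] h c| ≤ rate D r ^ N * L := by
  induction N generalizing c k t with
  | zero => simpa using hL c k t
  | succ N ih =>
    rw [Function.iterate_succ_apply', pow_succ', mul_assoc]
    exact abs_chainOp_sub_le hy hC ih c k t

/-! ## The stationary distribution -/

/-- The edges outside C_k contribute the same factor for all t, which cancels. So `siteOp` is a
conditional expectation under `flowWeight`. -/
theorem siteOp_eq (hy : 1 ≤ y) (k : Fin r) (h : (Fin r → ZMod q) → ℝ) (c : Fin r → ZMod q) :
    siteOp y F C k h c = (∑ t, flowWeight y F C (c + Pi.single k t) * h (c + Pi.single k t)) /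
      ∑ t, flowWeight y F C (c + Pi.single k t) := by
  set R := ∏ e ∈ (edges C k)ᶜ, edgeWeight y F e (flow C c e) with hR
  have hR0 : 0 < R := Finset.prod_pos fun _ _ => edgeWeight_pos hy _ _
  have hw : ∀ t, flowWeight y F C (c + Pi.single k t) =
      R * localWeight y F C (flow C c) k t := by
    intro t
    rw [flowWeight, ← Finset.prod_mul_prod_compl (edges C k), mul_comm, hR, localWeight]
    congr 1
    · refine Finset.prod_congr rfl fun e he => ?_
      have : C k e = 0 := by simpa [edges] using he
      rw [flow_add_single, this]
      simp
    · exact Finset.prod_congr rfl fun e _ => by rw [flow_add_single]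
  simp only [hw, mul_assoc, ← Finset.mul_sum]
  rw [mul_div_mul_left _ _ hR0.ne', siteOp]

theorem sum_translate (k : Fin r) (g : (Fin r → ZMod q) → ℝ) :
    ∑ c : Fin r → ZMod q, ∑ t : ZMod q, g (c + Pi.single k t) = q * ∑ c, g c := by
  rw [Finset.sum_comm]
  have : ∀ t : ZMod q, ∑ c : Fin r → ZMod q, g (c + Pi.single k t) = ∑ c, g c := fun t =>
    Equiv.sum_comp (Equiv.addRight (Pi.single k t : Fin r → ZMod q)) g
  simp [this, ZMod.card]

/-- On every line in direction k, a conditional expectation preserves the weighted sum. Summing over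
the lines through all points counts each point q times on both sides. -/
theorem sum_flowWeight_mul_siteOp (hy : 1 ≤ y) (k : Fin r) (h : (Fin r → ZMod q) → ℝ) :
    ∑ c, flowWeight y F C c * siteOp y F C k h c = ∑ c, flowWeight y F C c * h c := by
  have hq : (q : ℝ) ≠ 0 := Nat.cast_ne_zero.2 (NeZero.ne q)
  refine mul_left_cancel₀ hq ?_
  rw [← sum_translate k fun c => flowWeight y F C c * siteOp y F C k h c,
    ← sum_translate k fun c => flowWeight y F C c * h c]
  refine Finset.sum_congr rfl fun c _ => ?_
  simp only [siteOp_add_single_self]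
  rw [← Finset.sum_mul, siteOp_eq hy, mul_div_cancel₀]
  exact (Finset.sum_pos (fun t _ => flowWeight_pos hy _) Finset.univ_nonempty).ne'

theorem sum_flowWeight_mul_chainOp (hy : 1 ≤ y) (h : (Fin r → ZMod q) → ℝ) :
    ∑ c, flowWeight y F C c * chainOp y F C h c = ∑ c, flowWeight y F C c * h c := by
  unfold chainOp
  split_ifs with hr
  · rfl
  · have hr' : (r : ℝ) ≠ 0 := Nat.cast_ne_zero.2 hr
    simp only [← mul_div_assoc, Finset.mul_sum]
    rw [← Finset.sum_div, Finset.sum_comm]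
    simp only [sum_flowWeight_mul_siteOp hy]
    simp [hr']

theorem sum_flowWeight_mul_chainOp_iterate (hy : 1 ≤ y) (h : (Fin r → ZMod q) → ℝ) (N : ℕ) :
    ∑ c, flowWeight y F C c * (chainOp y F C)^[N] h c = ∑ c, flowWeight y F C c * h c := by
  induction N with
  | zero => rfl
  | succ N ih =>
    simp only [Function.iterate_succ_apply', sum_flowWeight_mul_chainOp hy, ih]

/-- The chain converges to its stationary distribution. -/
theorem abs_chainOp_iterate_sub_average_le (hy : 1 ≤ y) {D : ℕ}
    (hC : ∀ k : Fin r, ∑ j ∈ Finset.univ.erase k,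
      influence y (edges C k ∩ edges C j).card ≤ 1 - 1 / D)
    {L : ℝ} {h : (Fin r → ZMod q) → ℝ} (hL : ∀ c k t, |h (c + Pi.single k t) - h c| ≤ L)
    (N : ℕ) (c₀ : Fin r → ZMod q) :
    |(chainOp y F C)^[N] h c₀ -
      (∑ c, flowWeight y F C c * h c) / ∑ c : Fin r → ZMod q, flowWeight y F C c| ≤
      r * (rate D r ^ N * L) := by
  have hpos : 0 < ∑ c : Fin r → ZMod q, flowWeight y F C c :=
    Finset.sum_pos (fun c _ => flowWeight_pos hy c) Finset.univ_nonempty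
  rw [← sum_flowWeight_mul_chainOp_iterate hy h N, sub_div' hpos.ne', abs_div, abs_of_pos hpos,
    div_le_iff₀ hpos, Finset.mul_sum, Finset.mul_sum, ← Finset.sum_sub_distrib]
  refine (Finset.abs_sum_le_sum_abs _ _).trans (Finset.sum_le_sum fun c _ => ?_)
  rw [mul_comm, ← mul_sub, abs_mul, abs_of_pos (flowWeight_pos hy c), mul_comm]
  exact mul_le_mul_of_nonneg_right
    (abs_sub_le_of_lipschitz (abs_chainOp_iterate_sub_le hy hC hL N) c c₀) (flowWeight_pos hy c).le

end Operator

end PottsFlow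

namespace PottsFlow

/-! ## Flows modulo `q` -/

namespace Multigraph

variable {n m : ℕ} (G : Multigraph n m)

/-- The boundary of a chain: the inflow minus the outflow. -/
def boundary {R : Type*} [CommRing R] : (Fin m → R) →ₗ[R] (Fin n → R) where
  toFun f v := ∑ e, (if G.tgt e = v then f e else 0) - ∑ e, if G.src e = v then f e else 0
  map_add' f g := by
    ext v
    simp only [Pi.add_apply, ← Finset.sum_sub_distrib, ← Finset.sum_add_distrib]
    refine Finset.sum_congr rfl fun e _ => ?_
    split_ifs <;> ring
  map_smul' c f := by
    ext v
    simp only [Pi.smul_apply, smul_eq_mul, ← Finset.sum_sub_distrib, RingHom.id_apply,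
      Finset.mul_sum]
    refine Finset.sum_congr rfl fun e _ => ?_
    split_ifs <;> ring

theorem boundary_apply {R : Type*} [CommRing R] (f : Fin m → R) (v : Fin n) :
    G.boundary f v = ∑ e, (if G.tgt e = v then f e else 0) - ∑ e, if G.src e = v then f e else 0 :=
  rfl

theorem isFlow_iff (f : Fin m → ℤ) : G.IsFlow f ↔ G.boundary f = 0 := by
  rw [funext_iff]
  refine forall_congr' fun v => ?_
  rw [boundary_apply, Pi.zero_apply, sub_eq_zero, ← Finset.sum_filter, ← Finset.sum_filter]

theorem sum_mul_boundary {R : Type*} [CommRing R] (x : Fin n → R) (f : Fin m → R) :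
    ∑ v, x v * G.boundary f v = ∑ e, f e * (x (G.tgt e) - x (G.src e)) := by
  simp only [boundary_apply, mul_sub, Finset.sum_sub_distrib, Finset.mul_sum, mul_ite, mul_zero]
  congr 1 <;>
  · rw [Finset.sum_comm]
    simp [mul_comm]

theorem boundary_single {R : Type*} [CommRing R] (e : Fin m) :
    G.boundary (Pi.single e (1 : R)) = Pi.single (G.tgt e) 1 - Pi.single (G.src e) 1 := by
  ext v
  simp only [boundary_apply, Pi.single_apply, Pi.sub_apply]
  congr 1 <;>
  · rw [Finset.sum_eq_single e]
    · simp [eq_comm]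
    · intro b _ hb; simp [hb]
    · simp

/-- The equivalence relation of lying in the same component. -/
def sameComponent : Setoid (Fin n) :=
  Relation.EqvGen.setoid fun u v => ∃ e, G.src e = u ∧ G.tgt e = v

theorem single_sub_single_mem {u v : Fin n} (h : G.sameComponent u v) :
    (Pi.single v 1 - Pi.single u 1 : Fin n → ℤ) ∈ LinearMap.range G.boundary := by
  change Relation.EqvGen _ u v at h
  induction h with
  | rel u v h =>
    obtain ⟨e, rfl, rfl⟩ := h
    exact ⟨_, G.boundary_single e⟩
  | refl u => simp
  | symm u v _ ih =>
    rw [← neg_sub]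
    exact Submodule.neg_mem _ ih
  | trans u v w _ _ ih ih' =>
    rw [← sub_add_sub_cancel]
    exact Submodule.add_mem _ ih' ih

/-- The zeroth homology is torsion-free. -/
theorem mem_range_boundary_of_smul {b : Fin n → ℤ} {k : ℤ} (hk : k ≠ 0)
    (h : k • b ∈ LinearMap.range G.boundary) : b ∈ LinearMap.range G.boundary := by
  classical
  set root : Fin n → Fin n := fun v => (Quotient.mk G.sameComponent v).out with hroot
  have hrel : ∀ v, G.sameComponent (root v) v := fun v => Quotient.mk_out v
  have hedge : ∀ e, root (G.tgt e) = root (G.src e) := by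
    intro e
    have : Quotient.mk G.sameComponent (G.tgt e) = Quotient.mk G.sameComponent (G.src e) :=
      (Quotient.sound (Relation.EqvGen.rel _ _ ⟨e, rfl, rfl⟩)).symm
    simp only [hroot, this]
  obtain ⟨g, hg⟩ := h
  -- Pairing the boundary k • b with the indicator of a component gives 0. As k ≠ 0 can be
  -- cancelled, b has total 0 on every component.
  have hzero : ∑ v, b v • (Pi.single (root v) 1 : Fin n → ℤ) = 0 := by
    ext u
    have h1 := G.sum_mul_boundary (fun v => if root v = u then (1 : ℤ) else 0) g
    simp only [hedge, sub_self, mul_zero, Finset.sum_const_zero, hg, Pi.smul_apply, smul_eq_mul,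
      mul_left_comm _ k, ← Finset.mul_sum] at h1
    have h2 := (mul_eq_zero.1 h1).resolve_left hk
    rw [Finset.sum_apply, Pi.zero_apply, ← h2]
    refine Finset.sum_congr rfl fun v _ => ?_
    simp [Pi.single_apply, eq_comm]
  -- So b is a combination of differences of a vertex and the root of its component, and each such
  -- difference is the boundary of a path.
  have hb : b = ∑ v, b v • (Pi.single v 1 - Pi.single (root v) 1 : Fin n → ℤ) := by
    simp only [smul_sub, Finset.sum_sub_distrib, hzero, sub_zero]
    ext u
    simp [Finset.sum_apply, Pi.single_apply]
  rw [hb]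
  exact Submodule.sum_mem _ fun v _ => Submodule.smul_mem _ _ (G.single_sub_single_mem (hrel v))

theorem boundary_intCast {q : ℕ} (f : Fin m → ℤ) (v : Fin n) :
    G.boundary (fun e => (f e : ZMod q)) v = ((G.boundary f v : ℤ) : ZMod q) := by
  simp only [boundary_apply]
  push_cast
  rfl

/-- Every flow modulo `q` is the reduction of an integral flow. -/
theorem exists_isFlow_lift {q : ℕ} [NeZero q] {f : Fin m → ZMod q} (hf : G.boundary f = 0) :
    ∃ g : Fin m → ℤ, G.IsFlow g ∧ ∀ e, (g e : ZMod q) = f e := by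
  set f₀ : Fin m → ℤ := fun e => ((f e).val : ℤ) with hf₀
  have hcast : ∀ e, (f₀ e : ZMod q) = f e := fun e => by simp [hf₀]
  have hdvd : ∀ v, (q : ℤ) ∣ G.boundary f₀ v := by
    intro v
    rw [← ZMod.intCast_zmod_eq_zero_iff_dvd, ← boundary_intCast]
    simp only [hcast]
    exact congrFun hf v
  choose b hb using hdvd
  have hq : (q : ℤ) ≠ 0 := Nat.cast_ne_zero.2 (NeZero.ne q)
  -- The boundary of an arbitrary lift is q • b. As b itself is the boundary of some g, subtracting
  -- q • g corrects the lift without changing its residues.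
  obtain ⟨g, hg⟩ := G.mem_range_boundary_of_smul (b := b) hq
    ⟨f₀, by ext v; simp [hb v]⟩
  refine ⟨f₀ - (q : ℤ) • g, ?_, fun e => by simp [hcast]⟩
  rw [isFlow_iff, map_sub, map_smul, hg]
  ext v
  simp [hb v]

end Multigraph

/-! ### Fourier duality between colourings and flows modulo `q` -/

section Duality

variable {n m r q : ℕ} {G : Multigraph n m} {C : Fin r → Fin m → ℤ}

theorem boundary_flow (hC : G.IsEvenGeneratingSet C) (c : Fin r → ZMod q) :
    G.boundary (flow C c) = 0 := by
  have h : flow C c = ∑ k, c k • (fun e => (C k e : ZMod q)) := by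
    ext e; simp [flow]
  rw [h, map_sum]
  refine Finset.sum_eq_zero fun k _ => ?_
  rw [map_smul]
  obtain ⟨S, -, -, -, hfl⟩ := hC.2.1 k
  have : G.boundary (fun e => (C k e : ZMod q)) = 0 := by
    ext v
    rw [G.boundary_intCast, (G.isFlow_iff _).1 hfl]
    simp
  rw [this, smul_zero]

theorem flow_add (c c' : Fin r → ZMod q) : flow C (c + c') = flow C c + flow C c' := by
  ext e; simp [flow, add_mul, Finset.sum_add_distrib]

theorem flow_sub (c c' : Fin r → ZMod q) : flow C (c - c') = flow C c - flow C c' := by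
  ext e; simp [flow, sub_mul, Finset.sum_sub_distrib]

variable [NeZero q]

/-- This is where the generation over ℤ is used: the flow is lifted to an integral one, expanded in
the generating set, and the coefficients are reduced modulo q. -/
theorem exists_flow_eq (hC : G.IsEvenGeneratingSet C) {f : Fin m → ZMod q}
    (hf : G.boundary f = 0) : ∃ c, flow C c = f := by
  obtain ⟨g, hg, hgf⟩ := G.exists_isFlow_lift hf
  have hmem : g ∈ Submodule.span ℤ (Set.range C) := by rw [hC.2.2]; exact hg
  obtain ⟨a, ha⟩ := (Submodule.mem_span_range_iff_exists_fun ℤ).1 hmem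
  refine ⟨fun k => (a k : ZMod q), ?_⟩
  ext e
  rw [← hgf, ← ha]
  simp [flow]

open Classical in
/-- Sums over coefficients are sums over flows. -/
theorem exists_sum_flow (hC : G.IsEvenGeneratingSet C) (q : ℕ) [NeZero q] :
    ∃ κ : ℕ, 0 < κ ∧ ∀ Φ : (Fin m → ZMod q) → ℝ, ∑ c : Fin r → ZMod q, Φ (flow C c) =
      κ * ∑ f ∈ Finset.univ.filter (fun f : Fin m → ZMod q => G.boundary f = 0), Φ f := by
  -- The factor κ is the size of the kernel of the homomorphism from coefficients to flows; all its
  -- nonempty fibres are cosets of the kernel.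
  refine ⟨(Finset.univ.filter fun c : Fin r → ZMod q => flow C c = 0).card,
    Finset.card_pos.2 ⟨0, by simp [funext_iff, flow]⟩, fun Φ => ?_⟩
  rw [← Finset.sum_fiberwise_of_maps_to (g := flow C)
    (t := Finset.univ.filter (fun f : Fin m → ZMod q => G.boundary f = 0))
    (fun c _ => by simpa using boundary_flow hC c), Finset.mul_sum]
  refine Finset.sum_congr rfl fun f hf => ?_
  obtain ⟨c₀, rfl⟩ := exists_flow_eq hC (Finset.mem_filter.1 hf).2
  rw [Finset.sum_congr rfl fun c hc => by rw [(Finset.mem_filter.1 hc).2], Finset.sum_const,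
    nsmul_eq_mul]
  congr 2
  refine Finset.card_bij' (fun c _ => c - c₀) (fun c _ => c + c₀) ?_ ?_ ?_ ?_
  · intro c hc
    simp only [Finset.mem_filter, Finset.mem_univ, true_and] at hc ⊢
    rw [flow_sub, hc, sub_self]
  · intro c hc
    simp only [Finset.mem_filter, Finset.mem_univ, true_and] at hc ⊢
    rw [flow_add, hc, zero_add]
  · intro c _; simp
  · intro c _; simp

theorem _root_.AddChar.map_finset_sum {ι A M : Type*} [AddCommMonoid A] [CommMonoid M]
    (ψ : AddChar A M) (s : Finset ι) (g : ι → A) : ψ (∑ i ∈ s, g i) = ∏ i ∈ s, ψ (g i) := by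
  classical
  induction s using Finset.induction_on with
  | empty => simp
  | insert i s hi ih =>
    rw [Finset.sum_insert hi, Finset.prod_insert hi, AddChar.map_add_eq_mul, ih]

-- After expanding the product over the edges, summation by parts turns the characters into a
-- product over the vertices of characters of the boundary. By orthogonality the sum over σ is q^n
-- if the boundary vanishes and 0 otherwise.
open Classical in
theorem sum_prod_sum_stdAddChar (φ : Fin m → ZMod q → ℂ) :
    ∑ σ : Fin n → ZMod q, ∏ e, ∑ a, φ e a *
      ZMod.stdAddChar (a * (σ (G.tgt e) - σ (G.src e))) =
    (q : ℂ) ^ n * ∑ f ∈ Finset.univ.filter (fun f : Fin m → ZMod q => G.boundary f = 0),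
      ∏ e, φ e (f e) := by
  have h1 : ∀ f : Fin m → ZMod q,
      ∑ σ : Fin n → ZMod q, ∏ e, ZMod.stdAddChar (f e * (σ (G.tgt e) - σ (G.src e))) =
        if G.boundary f = 0 then (q : ℂ) ^ n else 0 := by
    intro f
    have : ∀ σ : Fin n → ZMod q,
        ∏ e, ZMod.stdAddChar (f e * (σ (G.tgt e) - σ (G.src e))) =
          ∏ v, ZMod.stdAddChar (N := q) (σ v * G.boundary f v) := by
      intro σ
      rw [← AddChar.map_finset_sum, ← AddChar.map_finset_sum, G.sum_mul_boundary]
    simp only [this]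
    have h2 := (Finset.prod_univ_sum (fun _ : Fin n => (Finset.univ : Finset (ZMod q)))
      (fun v s => ZMod.stdAddChar (N := q) (s * G.boundary f v))).symm
    rw [Fintype.piFinset_univ] at h2
    rw [h2]
    simp only [AddChar.sum_mulShift _ (ZMod.isPrimitive_stdAddChar q), ZMod.card]
    split_ifs with hf
    · simp [hf]
    · obtain ⟨v, hv⟩ := Function.ne_iff.1 hf
      exact Finset.prod_eq_zero (Finset.mem_univ v) (by
        rw [if_neg (by simpa using hv), Nat.cast_zero])
  have h3 : ∀ σ : Fin n → ZMod q, ∏ e, ∑ a, φ e a *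
      ZMod.stdAddChar (a * (σ (G.tgt e) - σ (G.src e))) =
      ∑ f : Fin m → ZMod q, (∏ e, φ e (f e)) *
        ∏ e, ZMod.stdAddChar (f e * (σ (G.tgt e) - σ (G.src e))) := by
    intro σ
    rw [Finset.prod_univ_sum, Fintype.piFinset_univ]
    simp only [Finset.prod_mul_distrib]
  simp only [h3]
  rw [Finset.sum_comm]
  simp only [← Finset.mul_sum, h1]
  rw [Finset.mul_sum, Finset.sum_filter]
  refine Finset.sum_congr rfl fun f _ => ?_
  split_ifs <;> ring

/-- The sum of the weights of all flows modulo `q`. -/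
noncomputable def flowSum (G : Multigraph n m) (q : ℕ) [NeZero q] (y : ℝ) (F : Finset (Fin m)) :
    ℝ :=
  open Classical in ∑ f ∈ Finset.univ.filter (fun f : Fin m → ZMod q => G.boundary f = 0),
    ∏ e, edgeWeight y F e (f e)

/-- The duality between colourings and flows. -/
theorem pow_mul_flowSum (y : ℝ) (F : Finset (Fin m)) :
    (q : ℝ) ^ n * flowSum G q y F = ∑ σ : Fin n → ZMod q,
      ∏ e, ((if σ (G.src e) = σ (G.tgt e) then (q : ℝ) else 0) + if e ∈ F then 0 else y - 1) := by
  classical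
  have h := sum_prod_sum_stdAddChar (G := G) (q := q)
    (fun e a => ((edgeWeight y F e a : ℝ) : ℂ))
  have key : ∀ (σ : Fin n → ZMod q) (e : Fin m), ∑ a, ((edgeWeight y F e a : ℝ) : ℂ) *
      ZMod.stdAddChar (a * (σ (G.tgt e) - σ (G.src e))) =
      (((if σ (G.src e) = σ (G.tgt e) then (q : ℝ) else 0) +
        if e ∈ F then 0 else y - 1 : ℝ) : ℂ) := by
    intro σ e
    have hs := AddChar.sum_mulShift (σ (G.tgt e) - σ (G.src e)) (ZMod.isPrimitive_stdAddChar q)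
    simp only [ZMod.card, sub_eq_zero] at hs
    -- The weight is the constant 1 plus a multiple of the indicator of 0. Its Fourier transform is
    -- q times the indicator of 0 plus the constant y - 1, or plus 0 on contracted edges.
    have hw : ∀ a : ZMod q, ((edgeWeight y F e a : ℝ) : ℂ) =
        1 + if a = 0 then (if e ∈ F then 0 else (y : ℂ) - 1) else 0 := by
      intro a
      unfold edgeWeight
      split_ifs <;> simp
    simp only [hw, add_mul, one_mul, Finset.sum_add_distrib, hs, ite_mul, zero_mul,
      Finset.sum_ite_eq', Finset.mem_univ, if_true, AddChar.map_zero_eq_one, mul_one]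
    by_cases h1 : σ (G.src e) = σ (G.tgt e)
    · rw [if_pos h1.symm, if_pos h1]; split_ifs <;> simp
    · rw [if_neg (Ne.symm h1), if_neg h1]; split_ifs <;> simp
  simp only [key] at h
  unfold flowSum
  exact_mod_cast h.symm

theorem zPotts_eq_sum (q : ℕ) [NeZero q] (w : ℝ) : G.zPotts q w = ∑ σ : Fin n → ZMod q,
    ∏ e, if σ (G.src e) = σ (G.tgt e) then w else 1 := by
  rw [Multigraph.zPotts]
  refine Fintype.sum_equiv (Equiv.arrowCongr (Equiv.refl _) (ZMod.finEquiv q).toEquiv) _ _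
    fun σ => ?_
  rw [Multigraph.mono, Finset.prod_ite, Finset.prod_const_one, mul_one, Finset.prod_const]
  congr 2
  ext e
  simp

/-- The value of y is chosen so that the factor q + q/(w - 1) of a monochromatic edge and the factor
q/(w - 1) of any other one become w and 1 after multiplication by (w - 1)/q. -/
theorem zPotts_eq_flowSum {w : ℝ} (hw : 1 < w) :
    G.zPotts q w = ((w - 1) / q) ^ m * (q ^ n * flowSum G q (1 + q / (w - 1)) ∅) := by
  have hq : (q : ℝ) ≠ 0 := Nat.cast_ne_zero.2 (NeZero.ne q)
  have hw' : w - 1 ≠ 0 := by linarith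
  rw [pow_mul_flowSum, zPotts_eq_sum, Finset.mul_sum]
  refine Finset.sum_congr rfl fun σ _ => ?_
  have : ((w - 1) / q) ^ m = ∏ _e : Fin m, (w - 1) / (q : ℝ) := by
    rw [Finset.prod_const, Finset.card_univ, Fintype.card_fin]
  rw [this, ← Finset.prod_mul_distrib]
  refine Finset.prod_congr rfl fun e _ => ?_
  split_ifs
  · exact absurd ‹_› (Finset.notMem_empty e)
  · field_simp; ring
  · exact absurd ‹_› (Finset.notMem_empty e)
  · field_simp; ring

end Duality

/-! ## Spanning forests -/

section Forest

variable {n m q : ℕ} [NeZero q]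

/-- The colourings that are constant on the classes of equal labels. -/
def constColourings (q : ℕ) [NeZero q] (lab : Fin n → ℕ) : Finset (Fin n → ZMod q) :=
  Finset.univ.filter fun σ => ∀ u v, lab u = lab v → σ u = σ v

theorem mem_constColourings {lab : Fin n → ℕ} {σ : Fin n → ZMod q} :
    σ ∈ constColourings q lab ↔ ∀ u v, lab u = lab v → σ u = σ v := by
  simp [constColourings]

/-- The labels that result from merging the classes of the ends of `e`. -/
def mergeLabels (G : Multigraph n m) (lab : Fin n → ℕ) (e : Fin m) (v : Fin n) : ℕ :=
  if lab v = lab (G.src e) then lab (G.tgt e) else lab v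

/-- `F` is a forest whose components are the classes of equal labels. -/
structure IsForest (G : Multigraph n m) (q : ℕ) [NeZero q] (F : Finset (Fin m))
    (lab : Fin n → ℕ) : Prop where
  mem_iff : ∀ σ : Fin n → ZMod q, σ ∈ constColourings q lab ↔ ∀ e ∈ F, σ (G.src e) = σ (G.tgt e)
  card_mul : (constColourings q lab).card * q ^ F.card = q ^ n

variable {G : Multigraph n m} {F : Finset (Fin m)} {lab : Fin n → ℕ} {e : Fin m}

theorem isForest_empty (G : Multigraph n m) (q : ℕ) [NeZero q] :
    IsForest G q ∅ (fun v => (v : ℕ)) := by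
  have : constColourings q (fun v : Fin n => (v : ℕ)) = Finset.univ := by
    ext σ
    simp only [constColourings, Finset.mem_filter, Finset.mem_univ, true_and, iff_true]
    intro u v h
    rw [Fin.ext h]
  exact ⟨fun σ => by simp [this], by simp [this, ZMod.card]⟩

theorem mem_constColourings_mergeLabels (σ : Fin n → ZMod q) :
    σ ∈ constColourings q (mergeLabels G lab e) ↔
      σ ∈ constColourings q lab ∧ σ (G.src e) = σ (G.tgt e) := by
  simp only [mem_constColourings, mergeLabels]
  constructor
  · intro h
    refine ⟨fun u v huv => h u v (by rw [huv]), h _ _ ?_⟩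
    simp
  · rintro ⟨h, he⟩ u v huv
    split_ifs at huv with h1 h2 h2
    · exact h u v (h1.trans h2.symm)
    · rw [h u _ h1, he, h _ _ huv]
    · rw [h v _ h2, he, h _ _ huv]
    · exact h u v huv

/-- A colouring constant on the old classes is, uniquely, one whose values at the ends of e agree
plus a multiple of the indicator of the class of the source. This gives a bijection with pairs of a
merged colouring and a residue. -/
theorem card_constColourings_mergeLabels (h : lab (G.src e) ≠ lab (G.tgt e)) :
    (constColourings q (mergeLabels G lab e)).card * q = (constColourings q lab).card := by
  have : (constColourings q (mergeLabels G lab e)).card * q =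
      (constColourings q (mergeLabels G lab e) ×ˢ (Finset.univ : Finset (ZMod q))).card := by
    rw [Finset.card_product, Finset.card_univ, ZMod.card]
  rw [this]
  set A : Fin n → ZMod q := fun v => if lab v = lab (G.src e) then 1 else 0 with hA
  have hAs : A (G.src e) = 1 := by simp [hA]
  have hAt : A (G.tgt e) = 0 := by simp [hA, Ne.symm h]
  have hAc : ∀ u v, lab u = lab v → A u = A v := fun u v huv => by simp only [hA, huv]
  refine Finset.card_bij' (fun p _ => p.1 + p.2 • A)
    (fun σ _ => (σ - (σ (G.src e) - σ (G.tgt e)) • A, σ (G.src e) - σ (G.tgt e))) ?_ ?_ ?_ ?_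
  · rintro ⟨σ, t⟩ hp
    rw [Finset.mem_product, mem_constColourings_mergeLabels] at hp
    have hσ : ∀ u v, lab u = lab v → σ u = σ v := mem_constColourings.1 hp.1.1
    refine mem_constColourings.2 fun u v huv => ?_
    simp [hσ u v huv, hAc u v huv]
  · intro σ hσ
    have hσ' := mem_constColourings.1 hσ
    rw [Finset.mem_product, mem_constColourings_mergeLabels]
    refine ⟨⟨mem_constColourings.2 fun u v huv => ?_, ?_⟩, Finset.mem_univ _⟩
    · simp [hσ' u v huv, hAc u v huv]
    · simp [hAs, hAt]
  · rintro ⟨σ, t⟩ hp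
    rw [Finset.mem_product, mem_constColourings_mergeLabels] at hp
    have he : σ (G.src e) = σ (G.tgt e) := hp.1.2
    simp [hAs, hAt, he]
  · intro σ _
    simp

/-- Acyclicity is encoded by the number q^(n - |F|) of colourings constant on the components, the
only form in which it is used. Every merge of two classes divides this number by q. -/
theorem IsForest.insert (hF : IsForest G q F lab) (he : e ∉ F)
    (h : lab (G.src e) ≠ lab (G.tgt e)) : IsForest G q (insert e F) (mergeLabels G lab e) := by
  refine ⟨fun σ => ?_, ?_⟩
  · rw [mem_constColourings_mergeLabels, hF.mem_iff]
    simp [and_comm]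
  · rw [Finset.card_insert_of_notMem he, pow_succ', ← mul_assoc,
      card_constColourings_mergeLabels h, hF.card_mul]

theorem IsForest.card_le (hF : IsForest G q F lab) (hq : 2 ≤ q) : F.card ≤ n := by
  have h1 : 0 < (constColourings q lab).card :=
    Finset.card_pos.2 ⟨0, by simp [constColourings]⟩
  have h2 : q ^ F.card ≤ q ^ n := by
    rw [← hF.card_mul]
    exact Nat.le_mul_of_pos_left _ h1
  exact (Nat.pow_le_pow_iff_right (by omega)).1 h2

/-- The flow sum when a spanning forest is contracted. -/
theorem IsForest.flowSum_eq {w : ℝ} (hw : 1 < w) (hF : IsForest G q F lab)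
    (hspan : ∀ e, lab (G.src e) = lab (G.tgt e)) :
    ((w - 1) / q) ^ (m - F.card) * flowSum G q (1 + q / (w - 1)) F = w ^ (m - F.card) := by
  have hq : (q : ℝ) ≠ 0 := Nat.cast_ne_zero.2 (NeZero.ne q)
  have hw' : w - 1 ≠ 0 := by linarith
  have hcard : (Finset.univ.filter fun e => e ∉ F).card = m - F.card := by
    rw [Finset.filter_not, Finset.filter_mem_eq_inter, Finset.univ_inter, ← Finset.compl_eq_univ_sdiff,
      Finset.card_compl, Fintype.card_fin]
  -- A colouring that is not constant on the components meets a factor 0 at an edge of F. For any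
  -- other one, all the edges outside F behave as loops.
  have hterm : ∀ σ : Fin n → ZMod q, ∏ e, ((if σ (G.src e) = σ (G.tgt e) then (q : ℝ) else 0) +
      if e ∈ F then 0 else 1 + (q : ℝ) / (w - 1) - 1) =
      if σ ∈ constColourings q lab then
        (q : ℝ) ^ F.card * (q + q / (w - 1)) ^ (m - F.card) else 0 := by
    intro σ
    split_ifs with hσ
    · have hc := mem_constColourings.1 hσ
      have : ∀ e, ((if σ (G.src e) = σ (G.tgt e) then (q : ℝ) else 0) +
          if e ∈ F then 0 else 1 + (q : ℝ) / (w - 1) - 1) =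
          if e ∈ F then (q : ℝ) else q + q / (w - 1) := by
        intro e
        rw [if_pos (hc _ _ (hspan e))]
        split_ifs <;> ring
      simp only [this]
      rw [Finset.prod_ite, Finset.prod_const, Finset.prod_const, hcard,
        Finset.filter_mem_eq_inter, Finset.univ_inter]
    · rw [hF.mem_iff] at hσ
      push Not at hσ
      obtain ⟨e, he, hne⟩ := hσ
      exact Finset.prod_eq_zero (Finset.mem_univ e) (by simp [he, hne])
  have h := pow_mul_flowSum (G := G) (q := q) (1 + q / (w - 1)) F
  simp only [hterm] at h
  rw [Finset.sum_ite_mem, Finset.univ_inter, Finset.sum_const, nsmul_eq_mul, ← mul_assoc] at h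
  have hc : ((constColourings q lab).card : ℝ) * (q : ℝ) ^ F.card = q ^ n := by
    exact_mod_cast hF.card_mul
  rw [hc] at h
  rw [mul_left_cancel₀ (pow_ne_zero n hq) h, ← mul_pow]
  congr 1
  field_simp
  ring

end Forest

end PottsFlow

namespace PottsFlow

/-! ## Moments -/

/-- The distribution `ν` on the nonnegative reals has expectation `a` and second moment at
most `b`. -/
structure HasMoments (ν : PMF ℝ) (a b : ℝ) : Prop where
  nonneg : ∀ z ∈ ν.support, 0 ≤ z
  fst : expect ν ENNReal.ofReal = ENNReal.ofReal a
  snd : expect ν (fun z => ENNReal.ofReal (z ^ 2)) ≤ ENNReal.ofReal b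

theorem hasMoments_pure {z : ℝ} (hz : 0 ≤ z) : HasMoments (PMF.pure z) z (z ^ 2) :=
  ⟨by simpa using hz, expect_pure _ _, (expect_pure _ _).le⟩

theorem HasMoments.add {μ ν : PMF ℝ} {a b p p₂ : ℝ} (hμ : HasMoments μ a b)
    (hν : HasMoments ν p p₂) (ha : 0 ≤ a) (hb : 0 ≤ b) (hp : 0 ≤ p) (hp₂ : 0 ≤ p₂) :
    HasMoments (μ.bind fun S => ν.map fun x => S + x) (a + p) (b + 2 * a * p + p₂) := by
  refine ⟨?_, ?_, ?_⟩
  · intro z hz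
    rw [PMF.mem_support_bind_iff] at hz
    obtain ⟨S, hS, hz⟩ := hz
    rw [PMF.mem_support_map_iff] at hz
    obtain ⟨x, hx, rfl⟩ := hz
    exact add_nonneg (hμ.nonneg S hS) (hν.nonneg x hx)
  · rw [expect_bind, ENNReal.ofReal_add ha hp, ← hμ.fst]
    have : ∀ S ∈ μ.support, expect (ν.map fun x => S + x) ENNReal.ofReal =
        ENNReal.ofReal S + ENNReal.ofReal p := by
      intro S hS
      rw [expect_map, expect_congr fun x hx =>
        ENNReal.ofReal_add (hμ.nonneg S hS) (hν.nonneg x hx), expect_add, expect_const, hν.fst]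
    rw [expect_congr this, expect_add, expect_const]
  · rw [expect_bind]
    have : ∀ S ∈ μ.support, expect (ν.map fun x => S + x) (fun z => ENNReal.ofReal (z ^ 2)) ≤
        ENNReal.ofReal (S ^ 2) + (ENNReal.ofReal (2 * p) * ENNReal.ofReal S +
          ENNReal.ofReal p₂) := by
      intro S hS
      have hS0 := hμ.nonneg S hS
      have h : ∀ x ∈ ν.support, ENNReal.ofReal ((S + x) ^ 2) = ENNReal.ofReal (S ^ 2) +
          (ENNReal.ofReal (2 * S) * ENNReal.ofReal x + ENNReal.ofReal (x ^ 2)) := by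
        intro x hx
        have hx0 := hν.nonneg x hx
        rw [← ENNReal.ofReal_mul (by positivity), ← ENNReal.ofReal_add (by positivity)
          (by positivity), ← ENNReal.ofReal_add (by positivity) (by positivity)]
        congr 1; ring
      rw [expect_map, expect_congr h, expect_add, expect_const, expect_add, expect_const_mul,
        hν.fst, ← ENNReal.ofReal_mul (by positivity), ← ENNReal.ofReal_mul (by positivity),
        show 2 * S * p = 2 * p * S by ring]
      gcongr
      exact hν.snd
    refine (expect_mono this).trans ?_
    rw [expect_add, expect_add, expect_const, expect_const_mul, hμ.fst,
      ← ENNReal.ofReal_mul (by positivity), ENNReal.ofReal_add (by positivity) hp₂,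
      ENNReal.ofReal_add hb (by positivity), show 2 * a * p = 2 * p * a by ring, add_assoc]
    gcongr
    exact hμ.snd

theorem HasMoments.mono {ν : PMF ℝ} {a b b' : ℝ} (h : HasMoments ν a b) (hb : b ≤ b') :
    HasMoments ν a b' :=
  ⟨h.nonneg, h.fst, h.snd.trans (ENNReal.ofReal_le_ofReal hb)⟩

/-- The exact second moment is N p₂ + N(N - 1) p² for independent samples with second moment p₂; the
bound drops -N p². -/
theorem HasMoments.sumDist {ν : PMF ℝ} {p p₂ : ℝ} (h : HasMoments ν p p₂) (hp : 0 ≤ p)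
    (hp₂ : 0 ≤ p₂) (N : ℕ) :
    HasMoments (sumDist ν N) (N * p) (N * p₂ + (N : ℝ) ^ 2 * p ^ 2) := by
  induction N with
  | zero => simpa [PottsFlow.sumDist, iterKer] using hasMoments_pure le_rfl
  | succ N ih =>
    have := (ih.add h (by positivity) (by positivity) hp hp₂).mono
      (b' := (N + 1 : ℕ) * p₂ + ((N + 1 : ℕ) : ℝ) ^ 2 * p ^ 2) (by
        push_cast; nlinarith [sq_nonneg p])
    unfold PottsFlow.sumDist at this ⊢
    rw [iterKer_succ']
    convert this using 1
    push_cast; ring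

/-- Since the moments of `κ z` scale with z, the relative moments of successive estimates multiply
although the accumulator is passed on at random. -/
theorem HasMoments.bind {ν : PMF ℝ} {κ : ℝ → PMF ℝ} {a b a' b' : ℝ} (h : HasMoments ν a b)
    (h' : ∀ z ∈ ν.support, HasMoments (κ z) (z * a') (z ^ 2 * b')) (ha' : 0 ≤ a')
    (hb' : 0 ≤ b') : HasMoments (ν.bind κ) (a * a') (b * b') := by
  refine ⟨?_, ?_, ?_⟩
  · intro z hz
    rw [PMF.mem_support_bind_iff] at hz
    obtain ⟨S, hS, hz⟩ := hz
    exact (h' S hS).nonneg z hz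
  · have : ∀ z ∈ ν.support, expect (κ z) ENNReal.ofReal =
        ENNReal.ofReal a' * ENNReal.ofReal z := by
      intro z hz
      rw [(h' z hz).fst, ← ENNReal.ofReal_mul ha', mul_comm]
    rw [expect_bind, expect_congr this, expect_const_mul, h.fst, ← ENNReal.ofReal_mul ha', mul_comm]
  · have : ∀ z ∈ ν.support, expect (κ z) (fun z => ENNReal.ofReal (z ^ 2)) ≤
        ENNReal.ofReal b' * ENNReal.ofReal (z ^ 2) := by
      intro z hz
      rw [← ENNReal.ofReal_mul hb', mul_comm]
      exact (h' z hz).snd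
    rw [expect_bind]
    refine (expect_mono this).trans ?_
    rw [expect_const_mul, mul_comm b, ENNReal.ofReal_mul hb']
    gcongr
    exact h.snd

/-- Chebyshev's inequality. -/
theorem HasMoments.chebyshev {ν : PMF ℝ} {a v t : ℝ} (h : HasMoments ν a (a ^ 2 * (1 + v)))
    (ha : 0 < a) (hv : 0 ≤ v) (ht : 0 < t) (hvt : v ≤ t ^ 2 / 4) :
    3 / 4 ≤ ν.toOuterMeasure {z | |z - a| < t * a} := by
  -- Subtraction is truncated in `ℝ≥0∞`, so the cross term 2az is added to both sides and cancelled
  -- at the end.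
  have h1 : expect ν (fun z => ENNReal.ofReal ((z - a) ^ 2)) ≤ ENNReal.ofReal (a ^ 2 * v) := by
    have hpt : ∀ z ∈ ν.support, ENNReal.ofReal ((z - a) ^ 2) + ENNReal.ofReal (2 * a) *
        ENNReal.ofReal z = ENNReal.ofReal (z ^ 2) + ENNReal.ofReal (a ^ 2) := by
      intro z hz
      have hz0 := h.nonneg z hz
      rw [← ENNReal.ofReal_mul (by positivity), ← ENNReal.ofReal_add (by positivity)
        (by positivity), ← ENNReal.ofReal_add (by positivity) (by positivity)]
      congr 1; ring
    have h2 := expect_congr hpt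
    rw [expect_add, expect_add, expect_const_mul, expect_const, h.fst,
      ← ENNReal.ofReal_mul (by positivity)] at h2
    have h3 : expect ν (fun z => ENNReal.ofReal ((z - a) ^ 2)) + ENNReal.ofReal (2 * a * a) ≤
        ENNReal.ofReal (a ^ 2 * v) + ENNReal.ofReal (2 * a * a) := by
      rw [h2, ← ENNReal.ofReal_add (by positivity) (by positivity)]
      refine (add_le_add_left h.snd _).trans ?_
      rw [← ENNReal.ofReal_add (by positivity) (by positivity)]
      exact ENNReal.ofReal_le_ofReal (by ring_nf; exact le_rfl)
    exact (ENNReal.add_le_add_iff_right ENNReal.ofReal_ne_top).1 h3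
  set A : Set ℝ := {z | |z - a| < t * a} with hA
  have h4 : ∀ z ∈ ν.support, (1 : ℝ≥0∞) ≤ A.indicator 1 z +
      ENNReal.ofReal (1 / (t * a) ^ 2) * ENNReal.ofReal ((z - a) ^ 2) := by
    intro z _
    by_cases hz : z ∈ A
    · simp [hz]
    · have hz' : t * a ≤ |z - a| := not_lt.1 hz
      rw [Set.indicator_of_notMem hz, zero_add, ← ENNReal.ofReal_mul (by positivity),
        ← ENNReal.ofReal_one]
      refine ENNReal.ofReal_le_ofReal ?_
      rw [div_mul_eq_mul_div, one_mul, le_div_iff₀ (by positivity), one_mul, ← sq_abs (z - a)]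
      exact pow_le_pow_left₀ (by positivity) hz' 2
  have h5 := expect_mono h4
  rw [expect_const, expect_add, expect_const_mul] at h5
  have h6 : expect ν (A.indicator 1) = ν.toOuterMeasure A := by
    rw [expect, PMF.toOuterMeasure_apply]
    refine tsum_congr fun z => ?_
    by_cases hz : z ∈ A <;> simp [hz]
  have h7 : ENNReal.ofReal (1 / (t * a) ^ 2) * expect ν (fun z => ENNReal.ofReal ((z - a) ^ 2)) ≤
      ENNReal.ofReal (1 / 4) := by
    refine (mul_le_mul_right h1 _).trans ?_
    rw [← ENNReal.ofReal_mul (by positivity)]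
    refine ENNReal.ofReal_le_ofReal ?_
    rw [div_mul_eq_mul_div, one_mul, div_le_iff₀ (by positivity)]
    nlinarith [mul_le_mul_of_nonneg_left hvt (sq_nonneg a)]
  rw [h6] at h5
  have h8 : ENNReal.ofReal (3 / 4) + ENNReal.ofReal (1 / 4) ≤
      ν.toOuterMeasure A + ENNReal.ofReal (1 / 4) := by
    rw [← ENNReal.ofReal_add (by norm_num) (by norm_num)]
    refine le_trans ?_ (h5.trans (add_le_add_right h7 _))
    norm_num
  have h9 := (ENNReal.add_le_add_iff_right ENNReal.ofReal_ne_top).1 h8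
  rw [ENNReal.ofReal_div_of_pos (by norm_num)] at h9
  simpa using h9

/-! ## The estimates of the ratios -/

/-- The requirements on the parameters of the algorithm: `N` transitions of the chain for each of
the `M` samples per ratio. -/
structure Suitable {n m r : ℕ} (q D B c₀ N M ℓ : ℕ) (G : Multigraph n m) (C : Fin r → Fin m → ℤ)
    (w ε : ℝ) : Prop where
  two_le : 2 ≤ q
  one_lt : 1 < w
  eps_pos : 0 < ε
  eps_lt : ε < 1
  gen : G.IsEvenGeneratingSet C
  card_le : ∀ k, (edges C k).card ≤ ℓ
  influence_le : ∀ k, ∑ j ∈ Finset.univ.erase k,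
    influence (1 + q / (w - 1)) (edges C k ∩ edges C j).card ≤ 1 - 1 / D
  hB : 16 * (q / (w - 1)) ≤ B
  hc₀ : 128 * (1 + q / (w - 1)) ≤ c₀
  lt_rate : ∀ i < N, ε / (B * ((n + 1) * (r + 1))) < rate D r ^ i
  rate_le : rate D r ^ N ≤ ε / (B * ((n + 1) * (r + 1)))
  lt_samples : ∀ i < M, (i : ℝ) < c₀ * (n + 1) / (ε * ε)
  samples_le : c₀ * (n + 1) / (ε * ε) ≤ M

section Ratio

variable {n m r q D B c₀ N M ℓ : ℕ} {G : Multigraph n m} {C : Fin r → Fin m → ℤ} {w ε : ℝ}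

theorem Suitable.one_le (h : Suitable q D B c₀ N M ℓ G C w ε) : 1 ≤ 1 + q / (w - 1) := by
  have : 0 ≤ q / (w - 1) := div_nonneg (Nat.cast_nonneg _) (by linarith [h.one_lt])
  linarith

theorem Suitable.samples_pos (h : Suitable q D B c₀ N M ℓ G C w ε) : (0 : ℝ) < M := by
  have h1 := h.one_le
  have h2 := h.hc₀
  have h3 := h.eps_pos
  have : (0 : ℝ) < c₀ := by linarith
  exact lt_of_lt_of_le (by positivity) h.samples_le

theorem Suitable.signs (h : Suitable q D B c₀ N M ℓ G C w ε) (k : Fin r) (e : Fin m) :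
    C k e = 0 ∨ C k e = 1 ∨ C k e = -1 := by
  obtain ⟨S, -, h0, h1, -⟩ := h.gen.2.1 k
  by_cases he : e ∈ S
  · exact Or.inr (h1 e he)
  · exact Or.inl (h0 e he)

variable [NeZero q]

/-- Multiplying the weight for `insert e F` by the weight of e restores the weight for F, and the
multiplicity of the coefficients cancels. -/
theorem sum_flowWeight_ratio {y : ℝ} (hC : G.IsEvenGeneratingSet C) (hy : 1 ≤ y)
    {F : Finset (Fin m)} {e : Fin m} (he : e ∉ F) :
    0 < flowSum G q y F ∧ (∑ c : Fin r → ZMod q, flowWeight y (insert e F) C c *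
      if flow C c e = 0 then y else 1) / ∑ c : Fin r → ZMod q, flowWeight y (insert e F) C c =
      flowSum G q y F / flowSum G q y (insert e F) := by
  classical
  obtain ⟨κ, hκ, hsum⟩ := exists_sum_flow hC q
  have hκ' : (0 : ℝ) < κ := by exact_mod_cast hκ
  have key : ∀ F : Finset (Fin m), ∑ c : Fin r → ZMod q, flowWeight y F C c =
      κ * flowSum G q y F := fun F => hsum fun f => ∏ e, edgeWeight y F e (f e)
  have hw : ∀ c : Fin r → ZMod q, (flowWeight y (insert e F) C c *
      if flow C c e = 0 then y else 1) = flowWeight y F C c := by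
    intro c
    rw [flowWeight, flowWeight, ← Finset.mul_prod_erase _ _ (Finset.mem_univ e),
      ← Finset.mul_prod_erase _ (fun e => edgeWeight y F e (flow C c e)) (Finset.mem_univ e),
      edgeWeight_of_mem (Finset.mem_insert_self _ _), edgeWeight_of_notMem he, one_mul, mul_comm]
    congr 1
    refine Finset.prod_congr rfl fun e' he' => ?_
    simp [edgeWeight, (Finset.mem_erase.1 he').1]
  refine ⟨?_, ?_⟩
  · have : 0 < ∑ c : Fin r → ZMod q, flowWeight y F C c :=
      Finset.sum_pos (fun c _ => flowWeight_pos hy c) Finset.univ_nonempty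
    rw [key] at this
    exact pos_of_mul_pos_right this hκ'.le
  · simp only [hw]
    rw [key, key, mul_div_mul_left _ _ hκ'.ne']

/-- The moments of the sum of the samples. -/
theorem Suitable.exists_moments (h : Suitable q D B c₀ N M ℓ G C w ε) {F : Finset (Fin m)}
    {e : Fin m} (he : e ∉ F) :
    ∃ p : ℝ, 0 < p ∧
      (1 - ε / (16 * (n + 1))) * flowSum G q (1 + q / (w - 1)) F ≤
        p * flowSum G q (1 + q / (w - 1)) (insert e F) ∧
      p * flowSum G q (1 + q / (w - 1)) (insert e F) ≤
        (1 + ε / (16 * (n + 1))) * flowSum G q (1 + q / (w - 1)) F ∧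
      HasMoments (sumDist (weightDist q (1 + q / (w - 1)) (insert e F) C e N) M) (M * p)
        ((M * p) ^ 2 * (1 + ε ^ 2 / (128 * (n + 1)))) := by
  have hy := h.one_le
  set y : ℝ := 1 + q / (w - 1) with hydef
  have hε := h.eps_pos
  set φ : (Fin r → ZMod q) → ℝ := fun c => if flow C c e = 0 then y else 1 with hφ
  have hφ1 : ∀ c, 1 ≤ φ c := fun c => by simp only [hφ]; split_ifs <;> simp [hy]
  have hφy : ∀ c, φ c ≤ y := fun c => by simp only [hφ]; split_ifs <;> simp [hy]
  have hφ0 : ∀ c, 0 ≤ φ c := fun c => zero_le_one.trans (hφ1 c)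
  set p := (chainOp y (insert e F) C)^[N] φ 0 with hp
  have hE : expect (chainDist q y (insert e F) C N) (fun c => ENNReal.ofReal (φ c)) =
      ENNReal.ofReal p := expect_chainDist hy N hφ0
  have hp1 : 1 ≤ p := by
    have := expect_mono (μ := chainDist q y (insert e F) C N) (g := fun _ => ENNReal.ofReal 1)
      (h := fun c => ENNReal.ofReal (φ c)) fun c _ => ENNReal.ofReal_le_ofReal (hφ1 c)
    rw [expect_const, hE] at this
    by_contra hlt
    exact absurd this (not_le.2 ((ENNReal.ofReal_lt_ofReal_iff one_pos).2 (not_le.1 hlt)))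
  have hdist := abs_chainOp_iterate_sub_average_le (F := insert e F) hy h.influence_le
    (L := y - 1) (h := φ) (fun c k t => by
      rw [abs_le]
      constructor <;> linarith [hφ1 c, hφy c, hφ1 (c + Pi.single k t), hφy (c + Pi.single k t)])
    N 0
  obtain ⟨hpos, hratio⟩ := sum_flowWeight_ratio (q := q) h.gen hy he
  have hpos' : 0 < flowSum G q y (insert e F) := by
    obtain ⟨κ, hκ, hsum⟩ := exists_sum_flow h.gen q
    have h1 : ∑ c : Fin r → ZMod q, flowWeight y (insert e F) C c =
      κ * flowSum G q y (insert e F) := hsum fun f => ∏ e', edgeWeight y (insert e F) e' (f e')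
    have h2 : 0 < ∑ c : Fin r → ZMod q, flowWeight y (insert e F) C c :=
      Finset.sum_pos (fun c _ => flowWeight_pos hy c) Finset.univ_nonempty
    rw [h1] at h2
    exact pos_of_mul_pos_right h2 (Nat.cast_nonneg _)
  -- Since the true ratio is at least 1, an additive error of the chain is also a relative error.
  have hR1 : 1 ≤ flowSum G q y F / flowSum G q y (insert e F) := by
    rw [← hratio, le_div_iff₀ (Finset.sum_pos (fun c _ => flowWeight_pos hy c)
      Finset.univ_nonempty), one_mul]
    exact Finset.sum_le_sum fun c _ => le_mul_of_one_le_right (flowWeight_pos hy c).le (hφ1 c)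
  rw [hratio] at hdist
  set R := flowSum G q y F / flowSum G q y (insert e F) with hR
  -- The factor r is the Hamming diameter and y - 1 the Lipschitz constant of the edge weight; they
  -- are absorbed by r + 1 and by B ≥ 16(y - 1) in the accuracy.
  have hη : r * (rate D r ^ N * (y - 1)) ≤ ε / (16 * (n + 1)) := by
    have hb : 16 * (y - 1) ≤ B := by
      have := h.hB
      rw [hydef]; linarith
    have hy1 : 0 ≤ y - 1 := by linarith
    have hq0 : (0 : ℝ) < q := Nat.cast_pos.2 (NeZero.pos q)
    have hB0 : (0 : ℝ) < B :=
      lt_of_lt_of_le (by have := h.one_lt; have : 0 < w - 1 := by linarith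
                         positivity) h.hB
    have h1 : rate D r ^ N * (y - 1) ≤ ε / (B * ((n + 1) * (r + 1))) * (y - 1) :=
      mul_le_mul_of_nonneg_right h.rate_le hy1
    refine (mul_le_mul_of_nonneg_left h1 (Nat.cast_nonneg r)).trans ?_
    rw [div_mul_eq_mul_div, mul_div_assoc', div_le_div_iff₀ (by positivity) (by positivity)]
    have h2 : (r : ℝ) * (16 * (y - 1)) ≤ (r + 1) * B :=
      mul_le_mul (by linarith) hb (by linarith) (by positivity)
    have h3 : 0 ≤ ε * (n + 1) := by positivity
    nlinarith [mul_le_mul_of_nonneg_left h2 h3]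
  have hη0 : 0 ≤ ε / (16 * ((n : ℝ) + 1)) := by positivity
  have hRF : R * flowSum G q y (insert e F) = flowSum G q y F := div_mul_cancel₀ _ hpos'.ne'
  obtain ⟨hd1, hd2⟩ := abs_le.1 (hdist.trans hη)
  refine ⟨p, by linarith, ?_, ?_, ?_⟩
  · rw [← hRF, ← mul_assoc]
    refine mul_le_mul_of_nonneg_right ?_ hpos'.le
    nlinarith [mul_le_mul_of_nonneg_left hR1 hη0]
  · rw [← hRF, ← mul_assoc]
    refine mul_le_mul_of_nonneg_right ?_ hpos'.le
    nlinarith [mul_le_mul_of_nonneg_left hR1 hη0]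
  · have hmom : HasMoments (weightDist q y (insert e F) C e N) p (y * p) := by
      refine ⟨?_, ?_, ?_⟩
      · intro z hz
        rw [weightDist, PMF.mem_support_map_iff] at hz
        obtain ⟨c, -, rfl⟩ := hz
        exact hφ0 c
      · rw [weightDist, expect_map]
        exact hE
      -- A sample lies in [0, y], so its square is at most y times itself.
      · rw [weightDist, expect_map, ENNReal.ofReal_mul (by linarith), ← hE, ← expect_const_mul]
        refine expect_mono fun c _ => ?_
        rw [← ENNReal.ofReal_mul (by linarith)]
        refine ENNReal.ofReal_le_ofReal ?_
        have := mul_le_mul_of_nonneg_right (hφy c) (hφ0 c)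
        rw [sq]
        exact this
    refine (hmom.sumDist (by linarith) (by nlinarith) M).mono ?_
    have hM := h.samples_pos
    have hMc : 128 * y * (n + 1) ≤ M * (ε * ε) := by
      have h1 := h.samples_le
      rw [div_le_iff₀ (by positivity)] at h1
      have h2 : 128 * y * ((n : ℝ) + 1) ≤ c₀ * (n + 1) :=
        mul_le_mul_of_nonneg_right h.hc₀ (by positivity)
      linarith
    -- The relative variance is at most y/(Mp) ≤ y/M, because p ≥ 1; the choice of c₀ makes this at
    -- most ε²/(128(n + 1)).
    have h3 : M * (y * p) ≤ (M * p) ^ 2 * (ε ^ 2 / (128 * (n + 1))) := by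
      rw [mul_div_assoc', le_div_iff₀ (by positivity)]
      have h4 : (M * p) * (128 * y * (n + 1)) ≤ (M * p) * (M * (ε * ε)) :=
        mul_le_mul_of_nonneg_left hMc (by positivity)
      have h5 : (M * p) * (M * (ε * ε)) ≤ (M * p) * (M * (ε * ε)) * p :=
        le_mul_of_one_le_right (by positivity) hp1
      nlinarith
    nlinarith

end Ratio

end PottsFlow

namespace PottsFlow

/-! ## The algorithm -/

/-- Give the vertices distinct labels, and compute the parameters of the chain and `q ^ n`. -/
def initialise (q : ℕ) : Prog :=
  .seq (.act (.rset 2 (.add (.nat (.lit 1)) (.div (.nat (.lit q))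
    (.sub (.reg 1) (.nat (.lit 1))))))) <|
  .seq (.act (.rset 3 (.div (.sub (.reg 1) (.nat (.lit 1))) (.nat (.lit q))))) <|
  .seq (.act (.rset 4 (.nat (.lit 1)))) <|
  .loop (.nlt (.reg 6) (.reg 0)) <|
    .seq (.act (.rset 4 (.mul (.reg 4) (.nat (.lit q))))) <|
    .seq (.act (.write 5 (.reg 6) (.reg 6))) (incr 6)

/-- Merge the classes of labels of the ends of the current edge. -/
def relabel : Prog :=
  .seq (.act (.set 7 (.arr 5 (.arr 0 (.reg 3))))) <|
  .seq (.act (.set 8 (.arr 5 (.arr 1 (.reg 3))))) <|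
  .seq (.act (.set 6 (.lit 0))) <|
  .loop (.nlt (.reg 6) (.reg 0)) <|
    .seq (.ite (.neq (.arr 5 (.reg 6)) (.reg 7)) (.act (.write 5 (.reg 6) (.reg 8))) .skip) <|
    incr 6

/-- Contract the current edge and estimate the resulting ratio of partition functions. -/
def contractEdge (q D B c₀ : ℕ) : Prog :=
  .seq relabel <|
  .seq (.act (.write 6 (.reg 3) (.lit 1))) <|
  .seq (estimateRatio q D B c₀) <|
  .act (.rset 4 (.mul (.mul (.reg 4) (.reg 3)) (.div (.reg 5) (.nat (.reg 4)))))

/-- Go through all edges. -/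
def mainLoop (q D B c₀ : ℕ) : Prog :=
  .loop (.nlt (.reg 3) (.reg 1)) <|
    .seq (.ite (.neq (.arr 5 (.arr 0 (.reg 3))) (.arr 5 (.arr 1 (.reg 3))))
      (.act (.rset 4 (.mul (.reg 4) (.reg 1)))) (contractEdge q D B c₀)) <|
    incr 3

/-- The approximation algorithm. -/
def pottsProgram (q D B c₀ : ℕ) : Prog :=
  .seq (initialise q) <| .seq (mainLoop q D B c₀) <| .act (.rset 0 (.reg 4))

/-- The array `5` holds the labels `lab`. -/
def HoldsLabels {n : ℕ} (lab : Fin n → ℕ) (s : State) : Prop := ∀ v : Fin n, s.arr 5 v = lab v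

/-! ### Simulation of the whole algorithm -/

section Simulation

variable {n m r q D B c₀ N M ℓ : ℕ} {G : Multigraph n m} {C : Fin r → Fin m → ℤ} {w ε : ℝ}
  {F : Finset (Fin m)} {lab : Fin n → ℕ} {e : Fin m} {s : State}

theorem src_of_keeps (hs : Keeps 3 5 2 (input G C w ε) s) (e : Fin m) : s.arr 0 e = G.src e := by
  rw [hs.2.1 0 (by norm_num)]; simp [input]

theorem tgt_of_keeps (hs : Keeps 3 5 2 (input G C w ε) s) (e : Fin m) : s.arr 1 e = G.tgt e := by
  rw [hs.2.1 1 (by norm_num)]; simp [input]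

theorem sim_relabel (hs : Keeps 3 5 2 (input G C w ε) s) (h3 : s.reg 3 = e)
    (hlab : HoldsLabels lab s) :
    Sim relabel s (n * 5 + 7) (PMF.pure ()) fun _ s' => Keeps 4 5 5 s s' ∧
      s'.arr 6 = s.arr 6 ∧ HoldsLabels (mergeLabels G lab e) s' := by
  have e0 : s.reg 0 = n := by simpa [input] using hs.1 0 (by norm_num)
  have hsrc : s.arr 5 (s.arr 0 (s.reg 3)) = lab (G.src e) := by
    rw [h3, src_of_keeps hs]; exact hlab _
  have htgt : s.arr 5 (s.arr 1 (s.reg 3)) = lab (G.tgt e) := by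
    rw [h3, tgt_of_keeps hs]; exact hlab _
  have h := Sim.loop_det (b := .nlt (.reg 6) (.reg 0))
    (P := .seq (.ite (.neq (.arr 5 (.reg 6)) (.reg 7)) (.act (.write 5 (.reg 6) (.reg 8))) .skip)
      (incr 6)) (T := 4) n
    (fun i s' => Keeps 4 5 5 s s' ∧ s'.arr 6 = s.arr 6 ∧ s'.reg 6 = i ∧
      s'.reg 7 = lab (G.src e) ∧ s'.reg 8 = lab (G.tgt e) ∧
      ∀ v : Fin n, s'.arr 5 v = if (v : ℕ) < i then mergeLabels G lab e v else lab v) ?_ ?_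
    (((s.setReg 7 (lab (G.src e))).setReg 8 (lab (G.tgt e))).setReg 6 0)
    ⟨(((Keeps.refl _ _ _ _).setReg (by norm_num)).setReg (by norm_num)).setReg (by norm_num),
      by simp, by simp, by simp, by simp, fun v => by simpa using hlab v⟩
  · refine Sim.set_seq (Sim.set_seq (Sim.set_seq (T := n * 5 + 1) ?_))
    have h' := h.weaken (R' := fun _ s' => Keeps 4 5 5 s s' ∧
      s'.arr 6 = s.arr 6 ∧ HoldsLabels (mergeLabels G lab e) s')
      fun _ _ s' h => ⟨h.1, h.2.1, fun v => by simpa using h.2.2.2.2.2 v⟩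
    simpa [hsrc, htgt] using h'
  · rintro i hi s1 ⟨hk, h6, hi6, h7, h8, h5⟩
    have e01 : s1.reg 0 = n := by rw [hk.1 0 (by norm_num), e0]
    refine ⟨by simp [hi6, e01, hi], ?_⟩
    have hcur : s1.arr 5 i = lab ⟨i, hi⟩ := by simpa using h5 ⟨i, hi⟩
    refine Sim.seq_det (T := 2) (T' := 1) (I := fun s' => Keeps 4 5 5 s s' ∧
      s'.arr 6 = s.arr 6 ∧ s'.reg 6 = i ∧
      s'.reg 7 = lab (G.src e) ∧ s'.reg 8 = lab (G.tgt e) ∧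
      ∀ v : Fin n, s'.arr 5 v = if (v : ℕ) < i + 1 then mergeLabels G lab e v else lab v)
      (Sim.ite ?_ ?_) ?_
    · intro hb
      have hb' : lab ⟨i, hi⟩ = lab (G.src e) := by simpa [hi6, hcur, h7] using hb
      refine Sim.write ⟨hk.setArr le_rfl, ?_, by simp [hi6], by simp [h7], by simp [h8], ?_⟩
      · ext x; simp [h6]
      · intro v
        by_cases hv : (v : ℕ) = i
        · obtain rfl : v = ⟨i, hi⟩ := Fin.ext hv
          simp [hi6, h8, mergeLabels, hb']
        · have : ((v : ℕ) < i + 1) ↔ (v : ℕ) < i := by omega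
          simp [hi6, hv, h5 v, this]
    · intro hb
      have hb' : lab ⟨i, hi⟩ ≠ lab (G.src e) := by simpa [hi6, hcur, h7] using hb
      refine Sim.skip ⟨hk, h6, hi6, h7, h8, fun v => ?_⟩
      by_cases hv : (v : ℕ) = i
      · obtain rfl : v = ⟨i, hi⟩ := Fin.ext hv
        simp [hcur, mergeLabels, hb']
      · have : ((v : ℕ) < i + 1) ↔ (v : ℕ) < i := by omega
        simp [h5 v, this]
    · rintro s2 ⟨hk, h6, hi6, h7, h8, h5⟩
      exact Sim.set ⟨hk.setReg (by norm_num), by simp [h6], by simp [hi6], by simp [h7],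
        by simp [h8], by simpa using h5⟩
  · rintro s1 ⟨hk, -, hi6, -⟩
    have e01 : s1.reg 0 = n := by rw [hk.1 0 (by norm_num), e0]
    simp [hi6, e01]

/-- The invariant of the main loop. -/
structure MainInv (G : Multigraph n m) (C : Fin r → Fin m → ℤ) (w ε : ℝ) (q : ℕ) (i : ℕ)
    (F : Finset (Fin m)) (lab : Fin n → ℕ) (z : ℝ) (s : State) : Prop where
  keeps : Keeps 3 5 2 (input G C w ε) s
  pos : s.reg 3 = i
  wt : s.rreg 2 = 1 + q / (w - 1)
  scale : s.rreg 3 = (w - 1) / q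
  acc : s.rreg 4 = z
  set : HoldsSet F s
  labels : HoldsLabels lab s

theorem sim_initialise [NeZero q] :
    Sim (initialise q) (input G C w ε) (n * 6 + 7) (PMF.pure ()) fun _ s' =>
      MainInv G C w ε q 0 ∅ (fun v => (v : ℕ)) ((q : ℝ) ^ n) s' := by
  have h := Sim.loop_det (b := .nlt (.reg 6) (.reg 0))
    (P := .seq (.act (.rset 4 (.mul (.reg 4) (.nat (.lit q))))) <|
      .seq (.act (.write 5 (.reg 6) (.reg 6))) (incr 6)) (T := 5) n
    (fun i s' => Keeps 4 5 2 (input G C w ε) s' ∧ s'.arr 6 = (input G C w ε).arr 6 ∧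
      s'.rreg 2 = 1 + q / (w - 1) ∧ s'.rreg 3 = (w - 1) / q ∧ s'.rreg 4 = (q : ℝ) ^ i ∧
      s'.reg 6 = i ∧ ∀ v < i, s'.arr 5 v = v) ?_ ?_
    ((((input G C w ε).setRReg 2 (1 + q / (w - 1))).setRReg 3 ((w - 1) / q)).setRReg 4 1)
    ⟨(((Keeps.refl _ _ _ _).setRReg (by norm_num)).setRReg (by norm_num)).setRReg (by norm_num),
      by simp, by simp, by simp, by simp, by simp [input], by simp⟩
  · refine Sim.rset_seq (Sim.rset_seq (Sim.rset_seq (T := n * 6 + 1) ?_))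
    have h' := h.weaken (R' := fun _ s' =>
      MainInv G C w ε q 0 ∅ (fun v => (v : ℕ)) ((q : ℝ) ^ n) s') ?_
    · simpa [input] using h'
    · rintro - - s' ⟨hk, h6, h2, h3, h4, -, h5⟩
      refine ⟨hk.mono (by norm_num) le_rfl le_rfl, ?_, h2, h3, h4, ?_, fun v => h5 v v.2⟩
      · simpa [input] using hk.1 3 (by norm_num)
      · intro e
        simp [h6, input]
  · rintro i hi s1 ⟨hk, h6, h2, h3, h4, hi6, h5⟩
    have e0 : s1.reg 0 = n := by simpa [input] using hk.1 0 (by norm_num)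
    refine ⟨by simp [hi6, e0, hi], Sim.rset_seq (Sim.write_seq (Sim.set
      ⟨((hk.setRReg (by norm_num)).setArr le_rfl).setReg (by norm_num), ?_, by simp [h2],
        by simp [h3], by simp [h4, pow_succ], by simp [hi6], fun v hv => ?_⟩))⟩
    · ext x; simp [h6]
    · by_cases h : v = i
      · simp [h, hi6]
      · simp [h, hi6, h5 v (by omega)]
  · rintro s1 ⟨hk, -, -, -, -, hi6, -⟩
    have e0 : s1.reg 0 = n := by simpa [input] using hk.1 0 (by norm_num)
    simp [hi6, e0]

/-- A bound on the time for the estimation of a ratio. -/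
def ratioTime (m q N M ℓ : ℕ) : ℕ := M * (4 * m + N * (26 * ℓ + 15 * q + 24) + 13) + 5

theorem sim_contractEdge [NeZero q] (h : Suitable q D B c₀ N M ℓ G C w ε) {z : ℝ}
    (hs : MainInv G C w ε q e F lab z s) :
    Sim (contractEdge q D B c₀) s (n * 5 + ratioTime m q N M ℓ + 12)
      (sumDist (weightDist q (1 + q / (w - 1)) (insert e F) C e N) M) fun S s' =>
        MainInv G C w ε q e (insert e F) (mergeLabels G lab e) (z * ((w - 1) / q) * (S / M)) s' := by
  refine (Sim.seq_det (T' := ratioTime m q N M ℓ + 4)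
    (sim_relabel hs.keeps hs.pos hs.labels) ?_).mono (by omega)
  rintro s1 ⟨hk1, h61, hlab1⟩
  refine Sim.write_seq (T := ratioTime m q N M ℓ + 2) ?_
  have hpos1 : s1.reg 3 = e := by rw [hk1.1 3 (by norm_num), hs.pos]
  set s2 := s1.setArr 6 (NExpr.eval s1 (.reg 3)) (NExpr.eval s1 (.lit 1)) with hs2
  have hk2 : Keeps 4 5 5 s s2 := hk1.setArr (by norm_num)
  have hin2 : Keeps 3 5 2 (input G C w ε) s2 :=
    hs.keeps.trans (hk2.mono (by norm_num) le_rfl (by norm_num))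
  have hF2 : HoldsSet (insert e F) s2 := by
    intro e'
    by_cases h' : e' = e
    · simp [hs2, h', hpos1]
    · have h'' : (e' : ℕ) ≠ e := fun hh => h' (Fin.ext hh)
      have := hs.set e'
      simp [hs2, hpos1, h'', h', h61, this]
  have hlab2 : HoldsLabels (mergeLabels G lab e) s2 := by
    intro v
    simpa [hs2] using hlab1 v
  refine (Sim.then_det (T' := 1) (sim_estimateRatio h.signs h.card_le h.lt_rate h.rate_le
    h.lt_samples h.samples_le hin2
    (by rw [hk2.2.2 2 (by norm_num), hs.wt]) hF2 (e := e)
    (by rw [hk2.1 3 (by norm_num), hs.pos])) ?_).mono (by rw [ratioTime])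
  rintro S - s3 ⟨hk3, h5, h4⟩
  refine Sim.rset ⟨?_, ?_, ?_, ?_, ?_, ?_, ?_⟩
  · exact (hin2.trans (hk3.mono (by norm_num) (by norm_num) (by norm_num))).setRReg (by norm_num)
  · simp only [State.setRReg_reg]
    rw [hk3.1 3 (by norm_num), hk2.1 3 (by norm_num), hs.pos]
  · have : s3.rreg 2 = 1 + q / (w - 1) := by
      rw [hk3.2.2 2 (by norm_num), hk2.2.2 2 (by norm_num), hs.wt]
    simpa using this
  · have : s3.rreg 3 = (w - 1) / q := by
      rw [hk3.2.2 3 (by norm_num), hk2.2.2 3 (by norm_num), hs.scale]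
    simpa using this
  · have hl : s3.rreg 3 = (w - 1) / q := by
      rw [hk3.2.2 3 (by norm_num), hk2.2.2 3 (by norm_num), hs.scale]
    have hz : s3.rreg 4 = z := by
      rw [hk3.2.2 4 (by norm_num), hk2.2.2 4 (by norm_num), hs.acc]
    simp [hl, hz, h5, h4]
  · intro e'
    simp only [State.setRReg_arr]
    rw [hk3.2.1 6 (by norm_num)]
    exact hF2 e'
  · intro v
    simp only [State.setRReg_arr]
    rw [hk3.2.1 5 (by norm_num)]
    exact hlab2 v

/-- The factor by which the accumulator still has to be multiplied after `i` edges. -/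
noncomputable def remaining (G : Multigraph n m) (q : ℕ) [NeZero q] (w : ℝ) (i : ℕ)
    (F : Finset (Fin m)) : ℝ :=
  ((w - 1) / q) ^ (m - F.card) * flowSum G q (1 + q / (w - 1)) F * w ^ F.card / w ^ i

/-- Induction on the number k of edges still to be examined. F and the labels do not depend on the
random choices, so the rest of the run multiplies the accumulator by a random factor with mean a and
second moment at most b, whatever has happened before. At most n - |F| estimates remain, each
distorting the mean by 1 ± ε/(16(n + 1)) and the second moment by 1 + ε²/(128(n + 1)). In
`remaining`, the quotient w^|F| / w^i removes the loops that are already in the accumulator. -/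
theorem sim_mainLoop [NeZero q] (h : Suitable q D B c₀ N M ℓ G C w ε) (k i : ℕ)
    (hi : i + k = m) (hF : IsForest G q F lab) (hFi : ∀ e ∈ F, (e : ℕ) < i)
    (hlab : ∀ e : Fin m, (e : ℕ) < i → lab (G.src e) = lab (G.tgt e)) :
    ∃ a b : ℝ, 0 < a ∧
      (1 - ε / (16 * (n + 1))) ^ (n - F.card) * remaining G q w i F ≤ a ∧
      a ≤ (1 + ε / (16 * (n + 1))) ^ (n - F.card) * remaining G q w i F ∧
      0 ≤ b ∧ b ≤ a ^ 2 * (1 + ε ^ 2 / (128 * (n + 1))) ^ (n - F.card) ∧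
      ∀ z : ℝ, 0 ≤ z → ∃ ν : PMF ℝ, HasMoments ν (z * a) (z ^ 2 * b) ∧
        ∀ s, MainInv G C w ε q i F lab z s → Sim (mainLoop q D B c₀) s
          (k * 5 + (n - F.card) * (n * 5 + ratioTime m q N M ℓ + 20) + 1) ν
          fun z' s' => s'.rreg 4 = z' := by
  have hw := h.one_lt
  have hε := h.eps_pos
  have hq : (0 : ℝ) < q := Nat.cast_pos.2 (NeZero.pos q)
  have hlam : 0 < (w - 1) / q := div_pos (by linarith) hq
  have hw0 : 0 < w := by linarith
  induction k generalizing i F lab with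
  | zero =>
    obtain rfl : i = m := by omega
    have hcard : F.card ≤ i := by simpa using F.card_le_univ
    -- All edges have been examined, so F spans and its flow sum is explicit; nothing is left to
    -- multiply.
    have hrem : remaining G q w i F = 1 := by
      rw [remaining, hF.flowSum_eq hw fun e => hlab e e.2, ← pow_add, Nat.sub_add_cancel hcard,
        div_self (pow_ne_zero _ hw0.ne')]
    have hη : 0 ≤ ε / (16 * ((n : ℝ) + 1)) := by positivity
    have hη1 : ε / (16 * ((n : ℝ) + 1)) ≤ 1 := by
      rw [div_le_one (by positivity)]
      have := h.eps_lt
      have : (0 : ℝ) ≤ n := Nat.cast_nonneg n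
      linarith
    refine ⟨1, 1, one_pos, ?_, ?_, zero_le_one, ?_, ?_⟩
    · rw [hrem, mul_one]
      exact pow_le_one₀ (by linarith) (by linarith)
    · rw [hrem, mul_one]
      exact one_le_pow₀ (by linarith)
    · rw [one_pow, one_mul]
      exact one_le_pow₀ (le_add_of_nonneg_right (by positivity))
    · intro z hz
      refine ⟨PMF.pure z, by simpa using hasMoments_pure hz, fun s hs => ?_⟩
      refine (Sim.loop_neg ?_ hs.acc).mono (by omega)
      have e1 : s.reg 1 = i := by simpa [input] using hs.keeps.1 1 (by norm_num)
      simp [e1, hs.pos]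
  | succ k ih =>
    have him : i < m := by omega
    set e : Fin m := ⟨i, him⟩ with he
    have heF : e ∉ F := fun hmem => lt_irrefl _ (hFi e hmem)
    have hcard : F.card < m := by
      simpa using Finset.card_lt_univ_of_notMem heF
    have htest : ∀ {z : ℝ} {s : State}, MainInv G C w ε q i F lab z s →
        Test.holds s (.nlt (.reg 3) (.reg 1)) ∧
        (Test.holds s (.neq (.arr 5 (.arr 0 (.reg 3))) (.arr 5 (.arr 1 (.reg 3)))) ↔
          lab (G.src e) = lab (G.tgt e)) := by
      intro z s hs
      have e1 : s.reg 1 = m := by simpa [input] using hs.keeps.1 1 (by norm_num)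
      have es : s.arr 0 i = G.src e := src_of_keeps hs.keeps e
      have et : s.arr 1 i = G.tgt e := tgt_of_keeps hs.keeps e
      refine ⟨by simp [e1, hs.pos, him], ?_⟩
      simp [hs.pos, es, et, hs.labels _]
    have hincr : ∀ {F' : Finset (Fin m)} {lab' : Fin n → ℕ} {z : ℝ} {s : State},
        MainInv G C w ε q i F' lab' z s →
        MainInv G C w ε q (i + 1) F' lab' z (s.setReg 3 (NExpr.eval s (.add (.reg 3) (.lit 1)))) :=
      fun hs => ⟨hs.keeps.setReg le_rfl, by simp [hs.pos], by simpa using hs.wt,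
        by simpa using hs.scale, by simpa using hs.acc, fun e => by simpa using hs.set e,
        fun v => by simpa using hs.labels v⟩
    by_cases hm : lab (G.src e) = lab (G.tgt e)
    · obtain ⟨a, b, ha, h1, h2, hb, h3, h4⟩ := ih (i + 1) (by omega) hF
        (fun e he => (hFi e he).trans (by omega)) fun e' he' => by
          rcases Nat.lt_succ_iff_lt_or_eq.1 he' with hlt | heq
          · exact hlab e' hlt
          · obtain rfl : e' = e := Fin.ext heq
            exact hm
      have hrem : remaining G q w i F = w * remaining G q w (i + 1) F := by
        rw [remaining, remaining, pow_succ]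
        field_simp
      refine ⟨w * a, w ^ 2 * b, by positivity, ?_, ?_, by positivity, ?_, ?_⟩
      · rw [hrem, mul_left_comm]
        exact mul_le_mul_of_nonneg_left h1 hw0.le
      · rw [hrem, mul_left_comm]
        exact mul_le_mul_of_nonneg_left h2 hw0.le
      · rw [mul_pow, mul_assoc]
        exact mul_le_mul_of_nonneg_left h3 (by positivity)
      · intro z hz
        obtain ⟨ν, hν, hsim⟩ := h4 (z * w) (by positivity)
        refine ⟨ν, by convert hν using 1 <;> ring, fun s hs => ?_⟩
        obtain ⟨ht1, ht2⟩ := htest hs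
        have hbody : Sim (.seq (.ite (.neq (.arr 5 (.arr 0 (.reg 3))) (.arr 5 (.arr 1 (.reg 3))))
            (.act (.rset 4 (.mul (.reg 4) (.reg 1)))) (contractEdge q D B c₀)) (incr 3)) s 4
            (PMF.pure ()) fun _ s' => MainInv G C w ε q (i + 1) F lab (z * w) s' := by
          refine Sim.seq_det (T := 2) (T' := 1) (I := MainInv G C w ε q i F lab (z * w))
            (Sim.ite_pos (ht2.2 hm) (Sim.rset ⟨hs.keeps.setRReg (by norm_num), by simp [hs.pos],
              by simp [hs.wt], by simp [hs.scale], ?_, fun e => by simpa using hs.set e,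
              fun v => by simpa using hs.labels v⟩)) fun s' hs' => Sim.set (hincr hs')
          have ew : s.rreg 1 = w := by simpa [input] using hs.keeps.2.2 1 (by norm_num)
          simp [hs.acc, ew]
        have := Sim.loop_pos ht1 hbody (κ := fun _ => ν) fun _ _ s' hs' => hsim s' hs'
        rw [PMF.pure_bind] at this
        exact this.mono (by ring_nf; omega)
    · have hF' : IsForest G q (insert e F) (mergeLabels G lab e) := hF.insert heF hm
      have hcard' : (insert e F).card = F.card + 1 := Finset.card_insert_of_notMem heF
      have hn : F.card + 1 ≤ n := hcard' ▸ hF'.card_le h.two_le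
      obtain ⟨a, b, ha, h1, h2, hb, h3, h4⟩ := ih (i + 1) (by omega) hF'
        (fun e' he' => by
          rcases Finset.mem_insert.1 he' with rfl | he'
          · exact Nat.lt_succ_self i
          · exact (hFi e' he').trans (by omega))
        fun e' he' => by
          rcases Nat.lt_succ_iff_lt_or_eq.1 he' with hlt | heq
          · simp only [mergeLabels, hlab e' hlt]
          · obtain rfl : e' = e := Fin.ext heq
            simp [mergeLabels]
      obtain ⟨p, hp, hp1, hp2, hmom⟩ := h.exists_moments heF
      have hM := h.samples_pos
      set y := 1 + (q : ℝ) / (w - 1) with hy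
      set lam := (w - 1) / (q : ℝ) with hlamdef
      set η := ε / (16 * ((n : ℝ) + 1)) with hη
      set β := ε ^ 2 / (128 * ((n : ℝ) + 1)) with hβ
      have hη0 : 0 ≤ η := by positivity
      have hη1 : η ≤ 1 := by
        rw [hη, div_le_one (by positivity)]
        have := h.eps_lt
        have : (0 : ℝ) ≤ n := Nat.cast_nonneg n
        linarith
      have hβ0 : 0 ≤ β := by positivity
      set Q := lam ^ (m - F.card) * w ^ F.card / w ^ i with hQ
      have hQ0 : 0 < Q := by positivity
      -- Up to the common factor Q, the old and the new remaining factors are the flow sums of F and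
      -- `insert e F`, whose ratio is what the samples estimate.
      have hrem : remaining G q w i F = Q * flowSum G q y F := by
        rw [remaining, hQ]; ring
      have hrem' : lam * remaining G q w (i + 1) (insert e F) =
          Q * flowSum G q y (insert e F) := by
        rw [remaining, hcard', hQ, show m - F.card = m - (F.card + 1) + 1 by omega,
          ← hlamdef, ← hy, pow_succ lam, pow_succ w F.card, pow_succ w i]
        field_simp
      have hnk : n - F.card = n - (insert e F).card + 1 := by omega
      rw [hnk, pow_succ, pow_succ, pow_succ]
      set k' := n - (insert e F).card with hk'
      refine ⟨lam * p * a, (lam / M) ^ 2 * ((M * p) ^ 2 * (1 + β)) * b, by positivity, ?_, ?_,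
        by positivity, ?_, ?_⟩
      · calc (1 - η) ^ k' * (1 - η) * remaining G q w i F
            = (1 - η) ^ k' * Q * ((1 - η) * flowSum G q y F) := by rw [hrem]; ring
          _ ≤ (1 - η) ^ k' * Q * (p * flowSum G q y (insert e F)) :=
              mul_le_mul_of_nonneg_left hp1
                (mul_nonneg (pow_nonneg (by linarith) _) hQ0.le)
          _ = lam * p * ((1 - η) ^ k' * remaining G q w (i + 1) (insert e F)) := by
              linear_combination (-(1 - η) ^ k' * p) * hrem'
          _ ≤ lam * p * a := mul_le_mul_of_nonneg_left h1 (by positivity)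
      · calc lam * p * a
            ≤ lam * p * ((1 + η) ^ k' * remaining G q w (i + 1) (insert e F)) :=
              mul_le_mul_of_nonneg_left h2 (by positivity)
          _ = (1 + η) ^ k' * Q * (p * flowSum G q y (insert e F)) := by
              linear_combination ((1 + η) ^ k' * p) * hrem'
          _ ≤ (1 + η) ^ k' * Q * ((1 + η) * flowSum G q y F) :=
              mul_le_mul_of_nonneg_left hp2 (by positivity)
          _ = (1 + η) ^ k' * (1 + η) * remaining G q w i F := by rw [hrem]; ring
      · calc (lam / M) ^ 2 * ((M * p) ^ 2 * (1 + β)) * b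
            ≤ (lam / M) ^ 2 * ((M * p) ^ 2 * (1 + β)) * (a ^ 2 * (1 + β) ^ k') :=
              mul_le_mul_of_nonneg_left h3 (by positivity)
          _ = (lam * p * a) ^ 2 * ((1 + β) ^ k' * (1 + β)) := by
              field_simp
      · intro z hz
        choose! κ hκ hκsim using h4
        have hnn : ∀ S ∈ (sumDist (weightDist q y (insert e F) C e N) M).support,
            0 ≤ z * lam * (S / M) := fun S hS =>
          mul_nonneg (by positivity) (div_nonneg (hmom.nonneg S hS) hM.le)
        refine ⟨(sumDist (weightDist q y (insert e F) C e N) M).bind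
          fun S => κ (z * lam * (S / M)), ?_, fun s hs => ?_⟩
        · have := hmom.bind (κ := fun S => κ (z * lam * (S / M))) (a' := z * lam / M * a)
            (b' := (z * lam / M) ^ 2 * b) (fun S hS => by
              convert hκ _ (hnn S hS) using 1 <;> ring) (by positivity) (by positivity)
          convert this using 1
          · field_simp
          · field_simp
        · obtain ⟨ht1, ht2⟩ := htest hs
          have hbody := Sim.then_det (T' := 1) (Q := incr 3)
            (R' := fun S s' => MainInv G C w ε q (i + 1) (insert e F) (mergeLabels G lab e)
              (z * lam * (S / M)) s')
            (Sim.ite_neg (P := .act (.rset 4 (.mul (.reg 4) (.reg 1)))) (fun hb => hm (ht2.1 hb))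
              (sim_contractEdge h (e := e) hs))
            fun S _ s' hs' => Sim.set (hincr hs')
          have := Sim.loop_pos ht1 hbody (κ := fun S => κ (z * lam * (S / M)))
            fun S hS s' hs' => hκsim _ (hnn S hS) s' hs'
          exact this.mono (by ring_nf; omega)

end Simulation

end PottsFlow

namespace PottsFlow

/-! ## Correctness -/

/-- By the exponential: (1 + x)^n ≤ e^u ≤ 1 + u + u² ≤ 1 + 2u for 0 ≤ u ≤ 1. -/
theorem one_add_pow_le {x u : ℝ} {n : ℕ} (hx : 0 ≤ x) (hu : n * x ≤ u) (hu1 : u ≤ 1) :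
    (1 + x) ^ n ≤ 1 + 2 * u := by
  have hu0 : 0 ≤ u := le_trans (by positivity) hu
  have h1 : (1 + x) ^ n ≤ Real.exp u := by
    calc (1 + x) ^ n ≤ Real.exp x ^ n :=
          pow_le_pow_left₀ (by linarith) (by linarith [Real.add_one_le_exp x]) n
      _ = Real.exp (n * x) := (Real.exp_nat_mul x n).symm
      _ ≤ Real.exp u := Real.exp_le_exp.2 hu
  have h2 := (abs_le.1 (Real.abs_exp_sub_one_sub_id_le (x := u) (by rwa [abs_of_nonneg hu0]))).2
  nlinarith

theorem ratio_bounds {T A z ε : ℝ} (hε : 0 < ε) (hε1 : ε < 1) (hT : 0 < T)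
    (h1 : (1 - ε / 16) * T ≤ A) (h2 : A ≤ (1 + ε / 8) * T) (hz : |z - A| < ε / 4 * A) :
    1 - ε ≤ T / z ∧ T / z ≤ 1 + ε := by
  obtain ⟨hz1, hz2⟩ := abs_lt.1 hz
  have hA1 : (1 - ε / 4) * ((1 - ε / 16) * T) ≤ (1 - ε / 4) * A :=
    mul_le_mul_of_nonneg_left h1 (by linarith)
  have hA2 : (1 + ε / 4) * A ≤ (1 + ε / 4) * ((1 + ε / 8) * T) :=
    mul_le_mul_of_nonneg_left h2 (by linarith)
  have hpos : 0 < (1 - ε / 4) * ((1 - ε / 16) * T) :=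
    mul_pos (by linarith) (mul_pos (by linarith) hT)
  have hz0 : 0 < z := by linarith
  constructor
  · rw [le_div_iff₀ hz0]
    have h3 : (1 - ε) * z ≤ (1 - ε) * ((1 + ε / 4) * ((1 + ε / 8) * T)) :=
      mul_le_mul_of_nonneg_left (by linarith) (by linarith)
    have h4 : (1 - ε) * ((1 + ε / 4) * (1 + ε / 8)) ≤ 1 := by nlinarith [pow_pos hε 3]
    nlinarith [mul_le_mul_of_nonneg_right h4 hT.le]
  · rw [div_le_iff₀ hz0]
    have h3 : (1 + ε) * ((1 - ε / 4) * ((1 - ε / 16) * T)) ≤ (1 + ε) * z :=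
      mul_le_mul_of_nonneg_left (by linarith) (by linarith)
    have h4 : 1 ≤ (1 + ε) * ((1 - ε / 4) * (1 - ε / 16)) := by nlinarith [pow_pos hε 3]
    nlinarith [mul_le_mul_of_nonneg_right h4 hT.le]

/-- A bound on the running time of the algorithm. -/
def totalTime (n m q N M ℓ : ℕ) : ℕ :=
  n * 6 + 7 + (m * 5 + n * (n * 5 + ratioTime m q N M ℓ + 20) + 1) + 3

section Correctness

variable {n m r q D B c₀ N M ℓ : ℕ} {G : Multigraph n m} {C : Fin r → Fin m → ℤ} {w ε : ℝ}

theorem Suitable.approxCounts (h : Suitable q D B c₀ N M ℓ G C w ε) :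
    ApproxCounts (pottsProgram q D B c₀) q G C w ε (totalTime n m q N M ℓ) := by
  have : NeZero q := ⟨by have := h.two_le; omega⟩
  have hε := h.eps_pos
  have hε1 := h.eps_lt
  have hw := h.one_lt
  have hq : (0 : ℝ) < q := Nat.cast_pos.2 (NeZero.pos q)
  obtain ⟨a, b, ha, h1, h2, hb, h3, h4⟩ := sim_mainLoop h m 0 (zero_add m)
    (isForest_empty G q) (by simp) (by simp)
  simp only [Finset.card_empty, Nat.sub_zero] at h1 h2 h3 h4
  obtain ⟨ν, hν, hsim⟩ := h4 ((q : ℝ) ^ n) (by positivity)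
  have hT : G.zPotts q w = q ^ n * remaining G q w 0 ∅ := by
    rw [zPotts_eq_flowSum hw, remaining]
    simp
    ring
  have hT0 : 0 < G.zPotts q w := by
    rw [zPotts_eq_sum]
    refine Finset.sum_pos (fun σ _ => Finset.prod_pos fun e _ => ?_) Finset.univ_nonempty
    split_ifs <;> linarith
  have hn : (n : ℝ) / (n + 1) ≤ 1 := by
    rw [div_le_one (by positivity)]; linarith
  have hη : n * (ε / (16 * ((n : ℝ) + 1))) ≤ ε / 16 := by
    have : n * (ε / (16 * ((n : ℝ) + 1))) = ε / 16 * (n / (n + 1)) := by field_simp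
    rw [this]
    exact mul_le_of_le_one_right (by positivity) hn
  have hβ : n * (ε ^ 2 / (128 * ((n : ℝ) + 1))) ≤ ε ^ 2 / 128 := by
    have : n * (ε ^ 2 / (128 * ((n : ℝ) + 1))) = ε ^ 2 / 128 * (n / (n + 1)) := by field_simp
    rw [this]
    exact mul_le_of_le_one_right (by positivity) hn
  have hrem : 0 < remaining G q w 0 ∅ := by
    rw [hT] at hT0
    exact pos_of_mul_pos_right hT0 (by positivity)
  have hη1 : ε / (16 * ((n : ℝ) + 1)) ≤ 1 := by
    rw [div_le_one (by positivity)]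
    have : (0 : ℝ) ≤ n := Nat.cast_nonneg n
    linarith
  have e1 : 1 - ε / 16 ≤ (1 - ε / (16 * ((n : ℝ) + 1))) ^ n := by
    have := one_add_mul_le_pow (a := -(ε / (16 * ((n : ℝ) + 1)))) (by linarith) n
    rw [← sub_eq_add_neg] at this
    linarith
  have e2 : (1 + ε / (16 * ((n : ℝ) + 1))) ^ n ≤ 1 + ε / 8 := by
    have := one_add_pow_le (by positivity) hη (by linarith)
    linarith
  have e3 : (1 + ε ^ 2 / (128 * ((n : ℝ) + 1))) ^ n ≤ 1 + ε ^ 2 / 64 := by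
    have := one_add_pow_le (by positivity) hβ (by nlinarith)
    linarith
  have hA1 : (1 - ε / 16) * G.zPotts q w ≤ q ^ n * a := by
    rw [hT, mul_left_comm]
    exact mul_le_mul_of_nonneg_left ((mul_le_mul_of_nonneg_right e1 hrem.le).trans h1)
      (by positivity)
  have hA2 : q ^ n * a ≤ (1 + ε / 8) * G.zPotts q w := by
    rw [hT, mul_left_comm]
    exact mul_le_mul_of_nonneg_left (h2.trans (mul_le_mul_of_nonneg_right e2 hrem.le))
      (by positivity)
  have hν' := hν.mono (b' := (q ^ n * a) ^ 2 * (1 + ε ^ 2 / 64)) (by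
    rw [mul_pow, mul_assoc]
    exact mul_le_mul_of_nonneg_left
      (h3.trans (mul_le_mul_of_nonneg_left e3 (by positivity))) (by positivity))
  -- With t = ε/4, Chebyshev's inequality tolerates the relative variance t²/4 = ε²/64, which is
  -- exactly the bound in `e3`.
  have hcheb := hν'.chebyshev (t := ε / 4) (by positivity) (by positivity) (by positivity)
    (by ring_nf; exact le_rfl)
  have hprog : Sim (pottsProgram q D B c₀) (input G C w ε) (totalTime n m q N M ℓ) ν
      fun z s => s.rreg 0 = z := by
    refine (Sim.seq_det (T' := m * 5 + n * (n * 5 + ratioTime m q N M ℓ + 20) + 3)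
      sim_initialise fun s hs => ?_).mono (by unfold totalTime; omega)
    refine (Sim.then_det (T' := 1) (hsim s hs) fun z _ s' hs' => Sim.rset ?_).mono (by omega)
    simpa using hs'
  obtain ⟨hhalt, hout⟩ := hprog.approx
    {z : ℝ | 1 - ε ≤ G.zPotts q w / z ∧ G.zPotts q w / z ≤ 1 + ε}
  refine ⟨hhalt, (hcheb.trans (MeasureTheory.measure_mono ?_)).trans hout⟩
  intro z hz
  exact ratio_bounds hε hε1 hT0 hA1 hA2 hz

end Correctness

/-! ## The running time -/

theorem rate_nonneg {D : ℕ} (hD : 1 ≤ D) (r : ℕ) : 0 ≤ rate D r := by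
  have hD' : (1 : ℝ) ≤ D := by exact_mod_cast hD
  rw [rate, sub_nonneg, div_le_one (by positivity)]
  nlinarith [Nat.cast_nonneg (α := ℝ) r]

theorem rate_lt_one {D : ℕ} (hD : 1 ≤ D) (r : ℕ) : rate D r < 1 := by
  have hD' : (1 : ℝ) ≤ D := by exact_mod_cast hD
  have : 0 < 1 / (D * ((r : ℝ) + 1)) := by positivity
  rw [rate]; linarith

/-- N is the first exponent that reaches the accuracy θ. The bound comes from the failure at N - 1
together with 1 - x ≤ e^(-x). -/
theorem exists_steps {D : ℕ} (hD : 1 ≤ D) (r : ℕ) {θ : ℝ} (hθ : 0 < θ) (hθ1 : θ ≤ 1) :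
    ∃ N : ℕ, (∀ i < N, θ < rate D r ^ i) ∧ rate D r ^ N ≤ θ ∧
      (N : ℝ) ≤ D * (r + 1) * Real.log (1 / θ) + 1 := by
  classical
  have hD' : (1 : ℝ) ≤ D := by exact_mod_cast hD
  have hex : ∃ N, rate D r ^ N ≤ θ := by
    obtain ⟨N, hN⟩ := exists_pow_lt_of_lt_one hθ (rate_lt_one hD r)
    exact ⟨N, hN.le⟩
  have hlt : ∀ i < Nat.find hex, θ < rate D r ^ i := fun i hi => not_le.1 (Nat.find_min hex hi)
  refine ⟨Nat.find hex, hlt, Nat.find_spec hex, ?_⟩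
  have hlog : 0 ≤ Real.log (1 / θ) := Real.log_nonneg (by rwa [le_div_iff₀ hθ, one_mul])
  rcases Nat.eq_zero_or_pos (Nat.find hex) with h0 | hpos
  · rw [h0, Nat.cast_zero]; positivity
  · obtain ⟨i, hi⟩ : ∃ i, Nat.find hex = i + 1 := ⟨Nat.find hex - 1, by omega⟩
    have h1 := hlt i (by omega)
    have h2 : rate D r ^ i ≤ Real.exp (-(i / (D * (r + 1)))) := by
      calc rate D r ^ i ≤ Real.exp (-(1 / (D * (r + 1)))) ^ i :=
            pow_le_pow_left₀ (rate_nonneg hD r) (by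
              have := Real.add_one_le_exp (-(1 / (D * ((r : ℝ) + 1))))
              rw [rate]; linarith) i
        _ = Real.exp (-(i / (D * (r + 1)))) := by
            rw [← Real.exp_nat_mul]; congr 1; ring
    have h3 : Real.log θ < -(i / (D * (r + 1))) := by
      rw [Real.log_lt_iff_lt_exp hθ]
      exact h1.trans_le h2
    have h4 : (i : ℝ) / (D * (r + 1)) < Real.log (1 / θ) := by
      rw [one_div, Real.log_inv]; linarith
    rw [div_lt_iff₀ (by positivity)] at h4
    rw [hi]; push_cast
    linarith

theorem exists_samples {x : ℝ} (hx : 0 ≤ x) :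
    ∃ M : ℕ, (∀ i < M, (i : ℝ) < x) ∧ x ≤ M ∧ (M : ℝ) ≤ x + 1 :=
  ⟨⌈x⌉₊, fun _ hi => Nat.lt_ceil.1 hi, Nat.le_ceil x, (Nat.ceil_lt_add_one hx).le⟩

/-- The accuracy is polynomial in ε, 1/n and 1/m because r ≤ κm. The additive constant log(4Bκ) is
absorbed since the logarithm of nm/ε is at least 1/2. -/
theorem log_inv_accuracy_le {B : ℕ} (hB : 1 ≤ B) {κ n m r ε : ℝ} (hκ : 1 ≤ κ) (hε : 0 < ε)
    (hn : 1 ≤ n) (hm : 1 ≤ m) (hr0 : 0 ≤ r) (hr : r ≤ κ * m)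
    (hL : 1 / 2 ≤ Real.log (n * m / ε)) :
    Real.log (1 / (ε / (B * ((n + 1) * (r + 1))))) ≤
      (2 * Real.log (4 * B * κ) + 1) * Real.log (n * m / ε) := by
  have hB' : (1 : ℝ) ≤ B := by exact_mod_cast hB
  have hκm : 1 ≤ κ * m := one_le_mul_of_one_le_of_one_le hκ hm
  have hc : 1 ≤ 4 * B * κ := one_le_mul_of_one_le_of_one_le (by linarith) hκ
  have h1 : 1 / (ε / (B * ((n + 1) * (r + 1)))) ≤ 4 * B * κ * (n * m / ε) := by
    rw [one_div_div, ← mul_div_assoc, div_le_div_iff_of_pos_right hε]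
    have h2 : (n + 1) * (r + 1) ≤ 2 * n * (2 * (κ * m)) :=
      mul_le_mul (by linarith) (by linarith) (by linarith) (by linarith)
    calc B * ((n + 1) * (r + 1)) ≤ B * (2 * n * (2 * (κ * m))) :=
          mul_le_mul_of_nonneg_left h2 (by linarith)
      _ = 4 * B * κ * (n * m) := by ring
  have h3 := Real.log_le_log (by positivity) h1
  rw [Real.log_mul (by positivity) (by positivity)] at h3
  have h4 : 0 ≤ Real.log (4 * B * κ) := Real.log_nonneg hc
  have h5 := mul_le_mul_of_nonneg_left hL h4
  linarith

theorem numSteps_le {D B : ℕ} (hB : 1 ≤ B) {κ n m r ε N : ℝ} (hκ : 1 ≤ κ) (hε : 0 < ε)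
    (hn : 1 ≤ n) (hm : 1 ≤ m) (hr0 : 0 ≤ r) (hr : r ≤ κ * m)
    (hL : 1 / 2 ≤ Real.log (n * m / ε))
    (hN : N ≤ D * (r + 1) * Real.log (1 / (ε / (B * ((n + 1) * (r + 1))))) + 1) :
    N ≤ (2 * D * κ * (2 * Real.log (4 * B * κ) + 1) + 2) * (m * Real.log (n * m / ε)) := by
  have hlog := log_inv_accuracy_le hB hκ hε hn hm hr0 hr hL
  have hκm : 1 ≤ κ * m := one_le_mul_of_one_le_of_one_le hκ hm
  have hB' : (1 : ℝ) ≤ B := by exact_mod_cast hB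
  have hc : 0 ≤ Real.log (4 * B * κ) :=
    Real.log_nonneg (one_le_mul_of_one_le_of_one_le (by linarith) hκ)
  generalize Real.log (n * m / ε) = L at *
  generalize Real.log (4 * B * κ) = Λ at *
  have h1 : D * (r + 1) ≤ D * (2 * (κ * m)) :=
    mul_le_mul_of_nonneg_left (by linarith) (Nat.cast_nonneg D)
  have h2 : D * (r + 1) * Real.log (1 / (ε / (B * ((n + 1) * (r + 1))))) ≤
      D * (2 * (κ * m)) * ((2 * Λ + 1) * L) :=
    (mul_le_mul_of_nonneg_left hlog (by positivity)).trans
      (mul_le_mul_of_nonneg_right h1 (mul_nonneg (by linarith) (by linarith)))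
  have h3 : 1 * (1 / 2) ≤ m * L := mul_le_mul hm hL (by norm_num) (by linarith)
  linarith

theorem ratioTime_le {m q N M ℓ : ℕ} {κ c n L I : ℝ} (hκ : 0 ≤ κ) (hc : 0 ≤ c) (hn : 1 ≤ n)
    (hm : 1 ≤ m) (hL : 1 / 2 ≤ L) (hI : 1 ≤ I) (hN : (N : ℝ) ≤ κ * (m * L))
    (hM : (M : ℝ) ≤ c * (n * I)) :
    (ratioTime m q N M ℓ : ℝ) ≤
      (c * (κ * (15 * q + 26) + 34) + 10) * (n * I * (m * L * (ℓ + 1))) := by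
  have hm' : (1 : ℝ) ≤ m := by exact_mod_cast hm
  have hℓ : (0 : ℝ) ≤ ℓ := Nat.cast_nonneg ℓ
  have hLℓ : 1 / 2 * 1 ≤ L * ((ℓ : ℝ) + 1) :=
    mul_le_mul hL (by linarith) zero_le_one (by linarith)
  have hmW : (m : ℝ) * (1 / 2 * 1) ≤ m * (L * (ℓ + 1)) :=
    mul_le_mul_of_nonneg_left hLℓ (by linarith)
  have hnI : 1 ≤ n * I := one_le_mul_of_one_le_of_one_le hn hI
  have h1 : (26 * (ℓ : ℝ) + 15 * q + 24) ≤ (15 * q + 26) * (ℓ + 1) := by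
    have := mul_nonneg (Nat.cast_nonneg (α := ℝ) q) hℓ
    linarith
  have h2 : (N : ℝ) * (26 * ℓ + 15 * q + 24) ≤ κ * (m * L) * ((15 * q + 26) * (ℓ + 1)) :=
    mul_le_mul hN h1 (by positivity) (by positivity)
  have h3 : 4 * (m : ℝ) + N * (26 * ℓ + 15 * q + 24) + 13 ≤
      (κ * (15 * q + 26) + 34) * (m * L * (ℓ + 1)) := by linarith
  have h4 := mul_le_mul hM h3 (by positivity) (by positivity)
  have h5 : 1 * (1 / 2) ≤ n * I * (m * L * (ℓ + 1)) :=
    mul_le_mul hnI (by linarith) (by norm_num) (by linarith)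
  rw [ratioTime]
  push_cast
  linarith

/-- The final product is at least n²m/2, so the lower-order terms 6n, 5m, 5n², 20n and 11 cost 2(6 +
5 + 5 + 20 + 11) = 94 times the product. -/
theorem totalTime_le_of_ratioTime_le {n m q N M ℓ : ℕ} {κ L I : ℝ} (hn : 1 ≤ n)
    (hm : 1 ≤ m) (hL : 1 / 2 ≤ L) (hI : 1 ≤ I)
    (h : (ratioTime m q N M ℓ : ℝ) ≤ κ * (n * I * (m * L * (ℓ + 1)))) :
    (totalTime n m q N M ℓ : ℝ) ≤ (κ + 94) * ((n : ℝ) ^ 2 * m * (ℓ + 1) * I * L) := by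
  have hn' : (1 : ℝ) ≤ n := by exact_mod_cast hn
  have hm' : (1 : ℝ) ≤ m := by exact_mod_cast hm
  have hℓ : (0 : ℝ) ≤ ℓ := Nat.cast_nonneg ℓ
  have hn2 : (n : ℝ) ≤ n ^ 2 := by rw [sq]; exact le_mul_of_one_le_left (by linarith) hn'
  have hLℓ : 1 / 2 * 1 ≤ L * ((ℓ : ℝ) + 1) :=
    mul_le_mul hL (by linarith) zero_le_one (by linarith)
  have hILℓ : 1 * (1 / 2 * 1) ≤ I * (L * ((ℓ : ℝ) + 1)) :=
    mul_le_mul hI hLℓ (by norm_num) (by linarith)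
  have h1 : (n : ℝ) ^ 2 * m * (1 * (1 / 2 * 1)) ≤ n ^ 2 * m * (I * (L * (ℓ + 1))) :=
    mul_le_mul_of_nonneg_left hILℓ (by positivity)
  have h2 : (n : ℝ) ^ 2 ≤ n ^ 2 * m := le_mul_of_one_le_right (by positivity) hm'
  have h3 : (m : ℝ) ≤ n ^ 2 * m := le_mul_of_one_le_left (by positivity) (hn'.trans hn2)
  have h4 := mul_le_mul_of_nonneg_left h (Nat.cast_nonneg (α := ℝ) n)
  rw [totalTime]
  push_cast
  linarith

theorem totalTime_le (q D B c₀ : ℕ) (hB : 1 ≤ B) (K : ℝ) :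
    ∃ A : ℝ, 0 ≤ A ∧ ∀ (n m r ℓ N M : ℕ) (ε : ℝ), 0 < ε → ε < 1 → 2 ≤ n * m → (r : ℝ) ≤ K * m →
      (N : ℝ) ≤ D * (r + 1) * Real.log (1 / (ε / (B * ((n + 1) * (r + 1))))) + 1 →
      (M : ℝ) ≤ c₀ * (n + 1) / (ε * ε) + 1 →
      (totalTime n m q N M ℓ : ℝ) ≤
        A * ((n : ℝ) ^ 2 * m * (ℓ + 1) * (ε ^ 2)⁻¹ * Real.log (n * m / ε)) := by
  have hK1 : 1 ≤ max K 1 := le_max_right _ _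
  have hB' : (1 : ℝ) ≤ B := by exact_mod_cast hB
  have hc : 0 ≤ Real.log (4 * B * max K 1) :=
    Real.log_nonneg (one_le_mul_of_one_le_of_one_le (by linarith) hK1)
  refine ⟨(2 * c₀ + 1) * ((2 * D * max K 1 * (2 * Real.log (4 * B * max K 1) + 1) + 2) *
    (15 * q + 26) + 34) + 10 + 94, by positivity, ?_⟩
  intro n m r ℓ N M ε hε hε1 hnm hr hN hM
  have hn : 1 ≤ n := Nat.one_le_iff_ne_zero.2 (by rintro rfl; simp at hnm)
  have hm : 1 ≤ m := Nat.one_le_iff_ne_zero.2 (by rintro rfl; simp at hnm)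
  have hn' : (1 : ℝ) ≤ n := by exact_mod_cast hn
  have hm' : (1 : ℝ) ≤ m := by exact_mod_cast hm
  have hnm' : (2 : ℝ) ≤ n * m := by exact_mod_cast hnm
  have hL : 1 / 2 ≤ Real.log (n * m / ε) := by
    have h1 : (2 : ℝ) ≤ n * m / ε := by
      rw [le_div_iff₀ hε]; linarith
    have h2 := Real.log_le_log (by norm_num) h1
    linarith [Real.log_two_gt_d9]
  have hI : 1 ≤ (ε ^ 2)⁻¹ := one_le_inv₀ (by positivity) |>.2 (pow_le_one₀ hε.le hε1.le)
  have hnI : 1 ≤ n * (ε ^ 2)⁻¹ := one_le_mul_of_one_le_of_one_le hn' hI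
  have hM' : (M : ℝ) ≤ (2 * c₀ + 1) * (n * (ε ^ 2)⁻¹) := by
    rw [← sq, div_eq_mul_inv] at hM
    have h2 : c₀ * ((n : ℝ) + 1) * (ε ^ 2)⁻¹ ≤ c₀ * (2 * n) * (ε ^ 2)⁻¹ := by
      gcongr; linarith
    linarith
  exact totalTime_le_of_ratioTime_le hn hm hL hI <|
    ratioTime_le (by positivity) (by positivity) hn' hm hL hI
      (numSteps_le hB hK1 hε hn' hm' (Nat.cast_nonneg r)
        (hr.trans (mul_le_mul_of_nonneg_right (le_max_left _ _) (by linarith))) hL hN) hM'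

/-! ## The conditions for rapid mixing -/

section Influence

theorem influence_zero (y : ℝ) : influence y 0 = 0 := by simp [influence]

theorem influence_mono {y : ℝ} (hy : 1 ≤ y) {i j : ℕ} (hij : i ≤ j) :
    influence y i ≤ influence y j := by
  have h : y⁻¹ ^ j ≤ y⁻¹ ^ i :=
    pow_le_pow_of_le_one (by positivity) (inv_le_one_of_one_le₀ hy) hij
  have h1 : 0 < y⁻¹ ^ i := by positivity
  have h2 : 0 < y⁻¹ ^ j := by positivity
  rw [influence, influence, div_le_div_iff₀ (by linarith) (by linarith)]
  nlinarith

theorem influence_nonneg {y : ℝ} (hy : 1 ≤ y) (i : ℕ) : 0 ≤ influence y i := by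
  rw [← influence_zero y]
  exact influence_mono hy (Nat.zero_le i)

/-- The influence is tanh(i log(y)/2), and tanh is subadditive on the nonnegative reals; `key` is
this subadditivity. -/
theorem influence_le_mul {y : ℝ} (hy : 1 ≤ y) (i : ℕ) : influence y i ≤ i * influence y 1 := by
  induction i with
  | zero => simp [influence_zero]
  | succ i ih =>
    have hx0 : 0 < y⁻¹ := by positivity
    have hx1 : y⁻¹ ≤ 1 := inv_le_one_of_one_le₀ hy
    have hX0 : 0 < y⁻¹ ^ i := by positivity
    have hX1 : y⁻¹ ^ i ≤ 1 := pow_le_one₀ hx0.le hx1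
    have key : influence y (i + 1) ≤ influence y i + influence y 1 := by
      simp only [influence, pow_succ, pow_zero, one_mul]
      set x := y⁻¹
      set X := x ^ i
      have hXx : 0 < X * x := by positivity
      have hXx1 : X * x ≤ 1 := mul_le_one₀ hX1 hx0.le hx1
      rw [div_add_div _ _ (by linarith) (by linarith), div_le_div_iff₀ (by linarith) (by positivity)]
      have h1 : (1 + X) * (1 + x) ≤ 2 * (1 + X * x) := by nlinarith
      have h2 : (1 - X) * (1 + x) + (1 + X) * (1 - x) = 2 * (1 - X * x) := by ring
      rw [h2]
      nlinarith
    push_cast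
    linarith

variable {m r q : ℕ} {C : Fin r → Fin m → ℤ} {y : ℝ}

theorem sum_influence_le_of_dParam {d ι : ℕ} (hy : 1 ≤ y) (hd : dParam C ≤ d)
    (hι : iotaParam C ≤ ι) (k : Fin r) :
    ∑ j ∈ Finset.univ.erase k, influence y (edges C k ∩ edges C j).card ≤ d * influence y ι := by
  classical
  have h1 : ∑ j ∈ Finset.univ.erase k, influence y (edges C k ∩ edges C j).card =
      ∑ j ∈ Finset.univ.filter (fun j => j ≠ k ∧ (edges C k ∩ edges C j).Nonempty),
        influence y (edges C k ∩ edges C j).card := by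
    refine (Finset.sum_subset ?_ ?_).symm
    · intro j hj
      simpa using (Finset.mem_filter.1 hj).2.1
    · intro j hj hj'
      have hjk : j ≠ k := (Finset.mem_erase.1 hj).1
      have : edges C k ∩ edges C j = ∅ := by
        by_contra hne
        exact hj' (by simp [hjk, Finset.nonempty_iff_ne_empty, hne])
      rw [this, Finset.card_empty, influence_zero]
  rw [h1]
  have h2 : (Finset.univ.filter
      (fun j => j ≠ k ∧ (edges C k ∩ edges C j).Nonempty)).card ≤ d :=
    (Finset.le_sup (f := fun k => (Finset.univ.filter
      fun j => j ≠ k ∧ (edges C k ∩ edges C j).Nonempty).card) (Finset.mem_univ k)).trans hd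
  refine (Finset.sum_le_card_nsmul _ _ (influence y ι) fun j hj => influence_mono hy ?_).trans ?_
  · have hjk : j ≠ k := (Finset.mem_filter.1 hj).2.1
    exact (Finset.le_sup (f := fun p : Fin r × Fin r => (edges C p.1 ∩ edges C p.2).card)
      (b := (k, j)) (by simp [hjk.symm])).trans hι
  · rw [nsmul_eq_mul]
    exact mul_le_mul_of_nonneg_right (by exact_mod_cast h2) (influence_nonneg hy ι)

/-- Double counting: the sizes of the intersections with C_k sum to the number of pairs of an edge
of C_k and another subgraph through it. There are at most ℓ edges, with at most s - 1 other
subgraphs each. -/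
theorem sum_influence_le_of_ellParam {ℓ s : ℕ} (hy : 1 ≤ y) (hℓ : ellParam C ≤ ℓ)
    (hs : sParam C ≤ s) (k : Fin r) :
    ∑ j ∈ Finset.univ.erase k, influence y (edges C k ∩ edges C j).card ≤
      (ℓ * (s - 1) : ℕ) * influence y 1 := by
  classical
  refine (Finset.sum_le_sum fun j _ => influence_le_mul hy _).trans ?_
  rw [← Finset.sum_mul]
  refine mul_le_mul_of_nonneg_right ?_ (influence_nonneg hy 1)
  have h1 : ∑ j ∈ Finset.univ.erase k, (edges C k ∩ edges C j).card =
      ∑ e ∈ edges C k, ((Finset.univ.erase k).filter fun j => e ∈ edges C j).card := by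
    simp only [Finset.card_filter, ← Finset.filter_mem_eq_inter]
    rw [Finset.sum_comm]
  have h2 : ∀ e ∈ edges C k,
      ((Finset.univ.erase k).filter fun j => e ∈ edges C j).card ≤ s - 1 := by
    intro e he
    have h3 : (Finset.univ.filter fun j => e ∈ edges C j).card ≤ s :=
      (Finset.le_sup (f := fun e : Fin m => (Finset.univ.filter fun j => e ∈ edges C j).card)
        (Finset.mem_univ e)).trans hs
    rw [Finset.filter_erase, Finset.card_erase_of_mem (by simp [he])]
    omega
  have h4 : ∑ j ∈ Finset.univ.erase k, (edges C k ∩ edges C j).card ≤ ℓ * (s - 1) := by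
    rw [h1]
    refine (Finset.sum_le_card_nsmul _ _ _ h2).trans ?_
    rw [smul_eq_mul]
    exact Nat.mul_le_mul_right _
      ((Finset.le_sup (f := fun k => (edges C k).card) (Finset.mem_univ k)).trans hℓ)
  exact_mod_cast h4

theorem inv_one_add_div {w : ℝ} (hw : 1 < w) :
    (1 + q / (w - 1))⁻¹ = 1 - q / (w - 1 + q) := by
  have h1 : 0 < w - 1 := by linarith
  have h2 : 0 < w - 1 + q := by positivity
  field_simp
  ring

/-- For X = y^(-ι) the claim is (d + 1)(1 - X) < 2. Bernoulli's inequality gives 1 - X ≤ ιq/(w - 1 +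
q), and the resulting sufficient condition is precisely the hypothesis on w. -/
theorem mul_influence_lt_one_of_dParam {d ι : ℕ} {w : ℝ} (hw : 1 < w)
    (h : ((d : ℝ) + 1) * ι / 2 * q - ((q : ℝ) - 1) < w) :
    d * influence (1 + q / (w - 1)) ι < 1 := by
  have h2 : 0 < w - 1 + q := by have := Nat.cast_nonneg (α := ℝ) q; linarith
  have hx1 : q / (w - 1 + q) ≤ 1 := by
    rw [div_le_one h2]; linarith
  have hX := one_add_mul_le_pow (a := -(q / (w - 1 + q))) (by linarith) ι
  rw [← sub_eq_add_neg] at hX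
  rw [influence, inv_one_add_div hw]
  set X := (1 - q / (w - 1 + q)) ^ ι
  have h3 : ι * (q / (w - 1 + q)) * (d + 1) < 2 := by
    rw [mul_div_assoc', div_mul_eq_mul_div, div_lt_iff₀ h2]
    nlinarith
  have hX0 : 0 ≤ X := pow_nonneg (by linarith) ι
  rw [mul_div_assoc', div_lt_one (by linarith)]
  have hd : (0 : ℝ) ≤ d + 1 := by positivity
  nlinarith

/-- The influence of a single common edge is q/(2(w - 1) + q), so w > 1 + q(ℓ(s - 1) - 1)/2 would
suffice. The hypothesis is stronger because q - 1 ≥ q/2. -/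
theorem mul_influence_lt_one_of_ellParam {ℓ s : ℕ} (hq : 2 ≤ q) (hℓ : 3 ≤ ℓ) (hs : 2 ≤ s)
    {w : ℝ} (hw : 1 < w) (h : ((q : ℝ) - 1) * ((ℓ : ℝ) * s - 1) < w) :
    (ℓ * (s - 1) : ℕ) * influence (1 + q / (w - 1)) 1 < 1 := by
  have hq' : (2 : ℝ) ≤ q := by exact_mod_cast hq
  have hℓ' : (3 : ℝ) ≤ ℓ := by exact_mod_cast hℓ
  have hs' : (2 : ℝ) ≤ s := by exact_mod_cast hs
  have h2 : 0 < w - 1 + q := by linarith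
  have h3 : influence (1 + q / (w - 1)) 1 = q / (2 * (w - 1) + q) := by
    rw [influence, inv_one_add_div hw, pow_one]
    have : 2 * (w - 1) + (q : ℝ) ≠ 0 := by linarith
    have h4 : 1 + (1 - q / (w - 1 + q)) = (2 * (w - 1) + q) / (w - 1 + q) := by
      field_simp; ring
    rw [h4, sub_sub_cancel, div_div_div_cancel_right₀ h2.ne']
  rw [h3, Nat.cast_mul, Nat.cast_sub (by omega), Nat.cast_one, mul_div_assoc',
    div_lt_one (by linarith)]
  nlinarith [mul_nonneg (mul_nonneg (by linarith : (0 : ℝ) ≤ ℓ) (by linarith : (0 : ℝ) ≤ s))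
    (sub_nonneg.2 hq')]

end Influence

/-! ### From contraction of the chain to the two algorithms -/

/-- The algorithm works whenever the chain contracts. -/
theorem exists_program {q : ℕ} (hq : 2 ≤ q) {w : ℝ} (hw : 1 < w) (K : ℝ) {ρ : ℝ} (hρ : ρ < 1) :
    ∃ (P : Prog) (A : ℝ), 0 ≤ A ∧ ∀ (n m r ℓ : ℕ) (G : Multigraph n m) (C : Fin r → Fin m → ℤ),
      G.IsEvenGeneratingSet C → (r : ℝ) ≤ K * m → (∀ k, (edges C k).card ≤ ℓ) →
      (∀ k, ∑ j ∈ Finset.univ.erase k,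
        influence (1 + q / (w - 1)) (edges C k ∩ edges C j).card ≤ ρ) →
      ∀ ε : ℝ, 0 < ε → ε < 1 → ∃ t : ℕ, ApproxCounts P q G C w ε t ∧
        (2 ≤ n * m → (t : ℝ) ≤
          A * ((n : ℝ) ^ 2 * m * (ℓ + 1) * (ε ^ 2)⁻¹ * Real.log (n * m / ε))) := by
  -- The constants built into the program depend only on q, w and the gap 1 - ρ: D bounds 1/(1 - ρ),
  -- B the range of the edge weight, and c₀ its relative variance.
  obtain ⟨D', hD'⟩ := exists_nat_one_div_lt (sub_pos.2 hρ)
  obtain ⟨B', hB'⟩ := exists_nat_ge (16 * (q / (w - 1)))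
  obtain ⟨c₀, hc₀⟩ := exists_nat_ge (128 * (1 + q / (w - 1)))
  obtain ⟨A, hA, htime⟩ := totalTime_le q (D' + 1) (B' + 1) c₀ (by omega) K
  refine ⟨pottsProgram q (D' + 1) (B' + 1) c₀, A, hA, ?_⟩
  intro n m r ℓ G C hC hr hℓ hinf ε hε hε1
  have hθ : 0 < ε / (((B' + 1 : ℕ) : ℝ) * ((n + 1) * (r + 1))) := by positivity
  have hθ1 : ε / (((B' + 1 : ℕ) : ℝ) * ((n + 1) * (r + 1))) ≤ 1 := by
    rw [div_le_one (by positivity)]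
    have h1 : (1 : ℝ) ≤ ((B' + 1 : ℕ) : ℝ) := by push_cast; linarith [Nat.cast_nonneg (α := ℝ) B']
    have h2 : (1 : ℝ) ≤ ((n : ℝ) + 1) * (r + 1) := by
      nlinarith [Nat.cast_nonneg (α := ℝ) n, Nat.cast_nonneg (α := ℝ) r,
        mul_nonneg (Nat.cast_nonneg (α := ℝ) n) (Nat.cast_nonneg (α := ℝ) r)]
    nlinarith
  obtain ⟨N, hN1, hN2, hN3⟩ := exists_steps (D := D' + 1) (by omega) r hθ hθ1
  obtain ⟨M, hM1, hM2, hM3⟩ := exists_samples (x := c₀ * ((n : ℝ) + 1) / (ε * ε)) (by positivity)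
  refine ⟨totalTime n m q N M ℓ, Suitable.approxCounts (D := D' + 1) (B := B' + 1) (c₀ := c₀)
    ⟨hq, hw, hε, hε1, hC, hℓ, fun k => (hinf k).trans ?_, ?_, hc₀, hN1, hN2, hM1, hM2⟩,
    fun hnm => htime n m r ℓ N M ε hε hε1 hnm hr hN3 hM3⟩
  · push_cast
    linarith
  · push_cast
    linarith

end PottsFlow

theorem theorem2 (q : ℕ) (hq : 2 ≤ q) :
    (∀ d ι : ℕ, 2 ≤ d → 1 ≤ ι → ∀ K w : ℝ,
      ((d : ℝ) + 1) * ι / 2 * q - ((q : ℝ) - 1) < w →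
      ∃ (P : PottsFlow.Prog) (A : ℝ), ∀ (n m r : ℕ) (G : PottsFlow.Multigraph n m)
        (C : Fin r → Fin m → ℤ),
        G.IsEvenGeneratingSet C → (r : ℝ) ≤ K * m →
        PottsFlow.dParam C ≤ d → PottsFlow.iotaParam C ≤ ι →
        ∀ ε : ℝ, 0 < ε → ε < 1 →
          ∃ t : ℕ, PottsFlow.ApproxCounts P q G C w ε t ∧
            (2 ≤ n * m →
              (t : ℝ) ≤ A * ((n : ℝ) ^ 2 * (m : ℝ) ^ 2 * (ε ^ 2)⁻¹ * Real.log (n * m / ε)))) ∧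
    (∀ ℓ s : ℕ, 3 ≤ ℓ → 2 ≤ s → ∀ K w : ℝ,
      ((q : ℝ) - 1) * ((ℓ : ℝ) * s - 1) < w →
      ∃ (P : PottsFlow.Prog) (A : ℝ), ∀ (n m r : ℕ) (G : PottsFlow.Multigraph n m)
        (C : Fin r → Fin m → ℤ),
        G.IsEvenGeneratingSet C → (r : ℝ) ≤ K * m →
        PottsFlow.ellParam C ≤ ℓ → PottsFlow.sParam C ≤ s →
        ∀ ε : ℝ, 0 < ε → ε < 1 →
          ∃ t : ℕ, PottsFlow.ApproxCounts P q G C w ε t ∧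
            (2 ≤ n * m →
              (t : ℝ) ≤ A * ((n : ℝ) ^ 2 * (m : ℝ) * (ε ^ 2)⁻¹ * Real.log (n * m / ε)))) := by
  have hq' : (2 : ℝ) ≤ q := by exact_mod_cast hq
  have hy : ∀ w : ℝ, 1 < w → 1 ≤ 1 + q / (w - 1) := fun w hw =>
    le_add_of_nonneg_right (div_nonneg (by linarith) (by linarith))
  constructor
  · intro d ι hd hι K w hw
    have hd' : (2 : ℝ) ≤ d := by exact_mod_cast hd
    have hι' : (1 : ℝ) ≤ ι := by exact_mod_cast hι
    have hw1 : 1 < w := by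
      have h1 : 3 ≤ ((d : ℝ) + 1) * ι := by nlinarith
      nlinarith
    obtain ⟨P, A, hA, h⟩ := PottsFlow.exists_program hq hw1 K
      (PottsFlow.mul_influence_lt_one_of_dParam hw1 hw)
    -- Subgraph sizes are not controlled here, so ℓ is taken to be m, and m(m + 1) ≤ 2m² accounts
    -- for the factor 2.
    refine ⟨P, 2 * A, fun n m r G C hC hr hdC hιC ε hε hε1 => ?_⟩
    obtain ⟨t, ht, htime⟩ := h n m r m G C hC hr (fun k => by simpa using Finset.card_le_univ (PottsFlow.edges C k))
      (PottsFlow.sum_influence_le_of_dParam (hy w hw1) hdC hιC) ε hε hε1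
    refine ⟨t, ht, fun hnm => (htime hnm).trans ?_⟩
    have hm1 : (1 : ℝ) ≤ m := by
      have : m ≠ 0 := by rintro rfl; simp at hnm
      exact_mod_cast Nat.one_le_iff_ne_zero.2 this
    have hlog : 0 ≤ Real.log (n * m / ε) := by
      refine Real.log_nonneg ?_
      rw [le_div_iff₀ hε]
      have : (2 : ℝ) ≤ n * m := by exact_mod_cast hnm
      linarith
    have h0 : 0 ≤ A * ((n : ℝ) ^ 2 * m * (ε ^ 2)⁻¹ * Real.log (n * m / ε)) := by positivity
    nlinarith
  · intro ℓ s hℓ hs K w hw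
    have hℓ' : (3 : ℝ) ≤ ℓ := by exact_mod_cast hℓ
    have hs' : (2 : ℝ) ≤ s := by exact_mod_cast hs
    have hw1 : 1 < w := by
      have h1 : 6 ≤ (ℓ : ℝ) * s := by nlinarith
      nlinarith
    obtain ⟨P, A, hA, h⟩ := PottsFlow.exists_program hq hw1 K
      (PottsFlow.mul_influence_lt_one_of_ellParam hq hℓ hs hw1 hw)
    refine ⟨P, A * (ℓ + 1), fun n m r G C hC hr hℓC hsC ε hε hε1 => ?_⟩
    obtain ⟨t, ht, htime⟩ := h n m r ℓ G C hC hr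
      (fun k => (Finset.le_sup (f := fun k => (PottsFlow.edges C k).card)
        (Finset.mem_univ k)).trans hℓC)
      (PottsFlow.sum_influence_le_of_ellParam (hy w hw1) hℓC hsC) ε hε hε1
    refine ⟨t, ht, fun hnm => (htime hnm).trans (le_of_eq ?_)⟩
    ring
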